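/- **Theorem (Bounding Theorem for $\lambda^A$ with credit existentials).** If $\Delta\mid\Gamma\vdash_f M:A$ in the language $\lambda^A$ below, then $M\sqsubseteq^A\|M\|$, where $\|M\|$ is the recurrence extracted from $M$. **Numbers.** Multiplicities $k,k'$ range over $\{1,2,\dots\}\cup\{\infty\}$; $a,b,d$ over $\mathbb N\cup\{\infty\}$ with $0\cdot\infty=0$. Net credits $r$ and cost constants $q$ lie in $\overline{\mathbb Z}=\mathbb Z\cup\{\pm\infty\}$, with $\infty+(-\infty)=\infty$, $\infty\cdot 0=0$, and $\infty\cdot q=\pm\infty$ according to the sign of $q\neq0$. **Source language.** Credit terms over $\Delta=\alpha_1,\dots,\alpha_n$ are finite sums of credit variables and natural numbers, up to the laws of addition. Types are $1,\ A\otimes B,\ A\oplus B,\ A\mathbin{\&}B,\ A\multimap B,\ {!}^k_cA,\ \mathbb N,\ \mathsf{list}\,A,\ \exists\alpha.A$. A resource term $f$ is a linear form in the term variables and credit variables, plus a constant, with all coefficients in $\mathbb N\cup\{\infty\}$, ordered coefficientwise. The judgment $\Delta\mid\Gamma\vdash_f M:A$ is generated by the following rules ($\Delta,\Gamma$ fixed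 unless shown): - $\vdash_f x:A$ if $x:A\in\Gamma$ and $f\ge x$. Also $\vdash_f():1$, $\vdash_f0:\mathbb N$ and $\vdash_f[\,]:\mathsf{list}\,A$ for every $f$. $S$, $\mathsf{inl}$, $\mathsf{inr}$ and $\mathsf{tick}$ keep $f$. - If $\vdash_fM:A$ and $\vdash_gN:B$, then $\vdash_{f+g}(M,N):A\otimes B$; likewise $M::N$ with $B=\mathsf{list}\,A$. If $\vdash_fM:A\multimap B$ and $\vdash_gN:A$, then $\vdash_{f+g}M\,N:B$. If $\Gamma,x:A\vdash_{f+x}M:B$, then $\vdash_f\lambda x.M:A\multimap B$. If $\vdash_fM:A$ and $\vdash_fN:B$, then $\vdash_f\langle M,N\rangle:A\mathbin\&B$; projections $\pi_i$ keep $f$. - With $\vdash_fM$ of the eliminated type and conclusion at $k'f+g$: $\mathsf{split}_{k'}(x,y)=M\ \mathsf{in}\ N$ needs $\Gamma,x{:}A,y{:}B\vdash_{g+k'x+k'y}N:C$; $\mathsf{case}_{k'}(M,x.N_1,y.N_2)$ needs $\Gamma,x{:}A\vdash_{g+k'x}N_1:C$ and $\Gamma,y{:}B\vdash_{g+k'y}N_2:C$;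 $\mathsf{transfer}_{k'}\,{!}^k_cx=M\ \mathsf{to}\ N$ needs $\Gamma,x{:}A\vdash_{g+k'(kx+c)}N:C$; $\mathsf{unpack}_{k'}(\alpha,x)=M\ \mathsf{in}\ N$ needs $\Delta,\alpha\mid\Gamma,x{:}A\vdash_{g+k'x}N:C$ with $\alpha$ fresh for $\Gamma,g,C$. - If $\vdash_fM:A$ and $g\ge kf+c$, then $\vdash_g\mathsf{save}^k_cM:{!}^k_cA$. If $\vdash_{f+c}M:A$, then $\vdash_f\mathsf{create}_cM:A$. If $\vdash_fM:A$, then $\vdash_{f+c}\mathsf{spend}_cM:A$. If $\vdash_fM:A[c/\alpha]$, then $\vdash_f\mathsf{pack}_\alpha(c,M):\exists\alpha.A$. - If $\vdash_gN_1:1\multimap C$, then $\vdash_{f+g+h}\mathsf{nrec}(M,N_1,N_2):C$ when $\vdash_fM:\mathbb N$ and $\vdash_hN_2:{!}^\infty_0(\mathbb N\otimes(1\multimap C)\multimap C)$, and $\vdash_{f+g+h}\mathsf{lrec}(M,N_1,N_2):C$ when $\vdash_fM:\mathsf{list}\,A$ and $\vdash_hN_2:{!}^\infty_0(A\otimes(\mathsf{list}\,A\mathbin\&C)\multimap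 C)$. **Evaluation.** $M\downarrow^{(n,r)}v$ is call-by-value big-step evaluation of closed terms ($\lambda$-abstractions and $\langle M,N\rangle$ are values), where the pairs $(n,r)$ of the subevaluations are added, except: $\mathsf{tick}$ adds $1$ to $n$; $\mathsf{create}_\ell$ and $\mathsf{spend}_\ell$ add $\ell$ and $-\ell$ to $r$; $\mathsf{save}^k_\ell M$ multiplies $r$ by $k$; $\mathsf{split},\mathsf{case},\mathsf{transfer},\mathsf{unpack}$ with multiplicity $k'$ multiply the $r$ of the scrutinee by $k'$. The recursors evaluate all three arguments, to $v$, $\lambda x.N_1'$ and $\mathsf{save}^\infty_0(\lambda x.N_2')$. On $0$ or $[\,]$ they continue with $N_1'[()/x]$. On $S\,v_0$ they continue with $N_2'[(v_0,\lambda z.\mathsf{nrec}(v_0,\lambda x.N_1',\mathsf{save}^\infty_0\lambda x.N_2'))/x]$, and on $v_1::v_2$ with $N_2'[(v_1,\langle v_2,\mathsf{lrec}(v_2,\lambda x.N_1',\mathsf{save}^\infty_0\lambda x.N_2')\rangle)/x]$. **Recurrence language $\lambda^{\mathbb C}$.** This is a simply typed $\lambda$-calculus with types $\mathbb C$ (costs),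 $\$$ (credits), $1,\mathbb N,\times,+,\to,\mathsf{list}$ and with recursors $\mathsf{nrec}(E,E_1,E_2)$, $\mathsf{lrec}(E,E_1,E_2)$ ($E_1:1\to T$, and $E_2:\mathbb N\times T\to T$, resp. $E_2:S\times(\mathsf{list}\,S\times T)\to T$). Costs have constants $q\in\overline{\mathbb Z}$, addition, negation and multiplication by multiplicities; $\$$ has constants $\ell\in\mathbb N$, addition and a coercion $\mathsf{to}\mathbb C:\$\to\mathbb C$. The judgment $\Gamma\vdash E\le_TE'$ on well-typed terms is the least relation closed under: reflexivity; transitivity; congruence in principal positions of elimination forms; $\beta$-reducts are below their redexes; on $\mathbb C$, the laws of an ordered commutative monoid, $-\infty\le E$, $\infty\le\infty+E$, evaluation (in both directions) of the operations on constants, the order of $\overline{\mathbb Z}$ on constants, monotonicity of $k\cdot$, $k(E+F)\le kE+kF$, antitonicity of negation, monotonicity of $\mathsf{to}\mathbb C$ and $\mathsf{to}\mathbb C(\ell)=\ell$; on $\$$, the laws of addition, congruence of addition, and symmetry (credit amounts are ordered discretely). **Extraction.** $\langle1\rangle=1$, $\langle\mathbb N\rangle=\mathbb N$, $\langle A\otimes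 B\rangle=\langle A\rangle\times\langle B\rangle$, $\langle A\oplus B\rangle=\langle A\rangle+\langle B\rangle$, $\langle A\mathbin\&B\rangle=\|A\|\times\|B\|$, $\langle A\multimap B\rangle=\langle A\rangle\to\|B\|$, $\langle{!}^k_cA\rangle=\langle A\rangle$, $\langle\mathsf{list}\,A\rangle=\mathsf{list}\,\langle A\rangle$, $\langle\exists\alpha.A\rangle=\$\times\langle A\rangle$, and $\|A\|=\mathbb C\times\langle A\rangle$. Write $E_c=\pi_1E$, $E_p=\pi_2E$ and $E+_cF=(E+F_c,F_p)$. Credit variables become variables of type $\$$. Then: - $\|x\|=(0,x)$, $\|()\|=(0,())$, $\|0\|=(0,0)$, $\|[\,]\|=(0,[\,])$, $\|\lambda x.M\|=(0,\lambda x.\|M\|)$, $\|\langle M,N\rangle\|=(0,(\|M\|,\|N\|))$. Eager constructors add the costs of their arguments and apply the constructor to the potentials. - $\|\mathsf{split}_{k'}(x,y)=M\ \mathsf{in}\ N\|=k'\|M\|_c+_c\|N\|[\pi_1\|M\|_p/x,\pi_2\|M\|_p/y]$; $\|\mathsf{case}_{k'}(M,x.N_1,y.N_2)\|=k'\|M\|_c+_c\mathsf{case}(\|M\|_p,x.\|N_1\|,y.\|N_2\|)$;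 $\|\pi_iM\|=\|M\|_c+_c\pi_i\|M\|_p$; $\|M\,N\|=(\|M\|_c+\|N\|_c)+_c\|M\|_p\|N\|_p$. - $\|\mathsf{save}^k_cM\|=(k\|M\|_c,\|M\|_p)$; $\|\mathsf{transfer}_{k'}\,{!}^k_cx=M\ \mathsf{to}\ N\|=k'\|M\|_c+_c\|N\|[\|M\|_p/x]$; $\|\mathsf{tick}\,M\|=1+_c\|M\|$; $\|\mathsf{create}_cM\|=\mathsf{to}\mathbb C(c)+_c\|M\|$; $\|\mathsf{spend}_cM\|=-\mathsf{to}\mathbb C(c)+_c\|M\|$. - $\|\mathsf{pack}_\alpha(c,M)\|=(\|M\|_c,(c,\|M\|_p))$; $\|\mathsf{unpack}_{k'}(\alpha,x)=M\ \mathsf{in}\ N\|=k'\|M\|_c+_c\|N\|[\pi_1\|M\|_p/\alpha,\pi_2\|M\|_p/x]$. - With $K=(\|M\|_c+\|N_1\|_c)+\|N_2\|_c$: $\|\mathsf{nrec}(M,N_1,N_2)\|=K+_c\mathsf{nrec}(\|M\|_p,\|N_1\|_p,\lambda p.\|N_2\|_p(\pi_1p,\lambda z.\pi_2p))$ and $\|\mathsf{lrec}(M,N_1,N_2)\|=K+_c\mathsf{lrec}(\|M\|_p,\|N_1\|_p,\lambda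 p.\|N_2\|_p(\pi_1p,((0,\pi_1\pi_2p),\pi_2\pi_2p)))$. **Bounding relations.** For closed $\vdash_aM:A$ and $\vdash E:\|A\|$, $M\sqsubseteq^{A,a}E$ holds iff whenever $M\downarrow^{(n,r)}v$, we have $n\le_{\mathbb C}E_c-r$, $a+r\ge0$ and $v\sqsubseteq_{\rm val}^{A,a+r}E_p$. For $\vdash_av:A$ and $\vdash E:\langle A\rangle$ (these typings are part of each instance of the relation), $v\sqsubseteq^{A,a}_{\rm val}E$ is defined by recursion on the number of type constructors of $A$: - $()\sqsubseteq_{\rm val}^{1,a}E$ iff $()\le E$. $(v_1,v_2)\sqsubseteq_{\rm val}^{A_1\otimes A_2,a}E$ iff $a=a_1+a_2$ with $v_i\sqsubseteq_{\rm val}^{A_i,a_i}\pi_iE$ for some $a_1,a_2$. $\mathsf{inl}\,v\sqsubseteq_{\rm val}^{A\oplus B,a}E$ iff $\mathsf{inl}\,E'\le E$ and $v\sqsubseteq_{\rm val}^{A,a}E'$ for some $E'$; similarly for $\mathsf{inr}$. - $\langle M,N\rangle\sqsubseteq_{\rm val}^{A\&B,a}E$ iff $M\sqsubseteq^{A,a}\pi_1E$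 and $N\sqsubseteq^{B,a}\pi_2E$. $\lambda x.M\sqsubseteq_{\rm val}^{A\multimap B,a}E$ iff $v\sqsubseteq_{\rm val}^{A,d}E'$ implies $M[v/x]\sqsubseteq^{B,a+d}E\,E'$ for all $d,v,E'$. $\mathsf{save}^k_\ell v\sqsubseteq_{\rm val}^{!^k_\ell A,a}E$ iff $kd+\ell\le a$ and $v\sqsubseteq_{\rm val}^{A,d}E$ for some $d\ge 0$. - $0\sqsubseteq_{\rm val}^{\mathbb N,a}E$ iff $0\le E$. $S\,v\sqsubseteq_{\rm val}^{\mathbb N,a}E$ iff $S\,E'\le E$ and $v\sqsubseteq_{\rm val}^{\mathbb N,a}E'$ for some $E'$. $[\,]\sqsubseteq_{\rm val}^{\mathsf{list}A,a}E$ iff $[\,]\le E$. $v_1::v_2\sqsubseteq_{\rm val}^{\mathsf{list}A,a}E$ iff $E_1::E_2\le E$, $a=a_1+a_2$, $v_1\sqsubseteq_{\rm val}^{A,a_1}E_1$ and $v_2\sqsubseteq_{\rm val}^{\mathsf{list}A,a_2}E_2$ for some $E_i,a_i$. - $\mathsf{pack}_\alpha(\ell,v)\sqsubseteq_{\rm val}^{\exists\alpha.A,a}E$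 iff $\ell\le_\$\pi_1E$ and $v\sqsubseteq_{\rm val}^{A[\ell/\alpha],a}\pi_2E$. For $\Delta\mid\Gamma\vdash_fM:A$, the open relation $M\sqsubseteq^AE$ means: for all assignments $\omega$ of natural numbers and $\Omega$ of closed terms of type $\$$ to the credit variables with $\omega(\alpha)\le_\$\Omega(\alpha)$ for every $\alpha\in\Delta$, and for all $\sigma,\theta,\Theta$ with $\theta(x)\sqsubseteq_{\rm val}^{B[\omega],\sigma(x)}\Theta(x)$ for every $x:B\in\Gamma$, we have $M[\omega,\theta]\sqsubseteq^{A[\omega],\,f[\omega,\sigma]}E[\Omega,\Theta]$. -/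

import Mathlib

namespace Amortized

/-- Extension of a finite tuple (substitution, environment, context) by one last entry.  Throughout,
variables are well-scoped indices and the most recently bound variable is the last one. -/
def extend {X : Type} {n : ℕ} (s : Fin n → X) (x : X) : Fin (n + 1) → X :=
  Fin.snoc (α := fun _ => X) s x

/-! ## Extended integers -/

/-- `ℤ ∪ {-∞, ∞}`, where `∞` absorbs under addition, so `∞ + (-∞) = ∞`. -/
abbrev ExtInt : Type := WithTop (WithBot ℤ)

namespace ExtInt

def ofInt (z : ℤ) : ExtInt := ((z : WithBot ℤ) : WithTop (WithBot ℤ))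

/-- `-∞`. -/
def negInf : ExtInt := ((⊥ : WithBot ℤ) : WithTop (WithBot ℤ))

def ofENat : ℕ∞ → ExtInt
  | ⊤ => ⊤
  | (n : ℕ) => ofInt n

def neg : ExtInt → ExtInt
  | none => negInf
  | some none => ⊤
  | some (some z) => ofInt (-z)

open Classical in
/-- Multiplication by `k ∈ ℕ ∪ {∞}`, with `∞ * 0 = 0`. -/
noncomputable def scale (k : ℕ∞) (q : ExtInt) : ExtInt :=
  if k = ⊤ then (if q = 0 then 0 else if 0 < q then ⊤ else negInf) else k.toNat • q

end ExtInt

/-- Multiplicities: positive natural numbers and `∞`. -/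
abbrev Mult : Type := {k : ℕ∞ // 0 < k}

def Mult.inf : Mult := ⟨⊤, ENat.top_pos⟩

/-! ## Credit terms -/

/-- Credit terms over `δ` credit variables, up to the equations of addition on natural numbers:
`const + ∑ i, coef i * αᵢ`. -/
@[ext] structure Cred (δ : ℕ) where
  const : ℕ
  coef : Fin δ → ℕ

namespace Cred

def lit {δ : ℕ} (m : ℕ) : Cred δ := ⟨m, fun _ => 0⟩

def var {δ : ℕ} (i : Fin δ) : Cred δ := ⟨0, Pi.single i 1⟩

def subst {δ δ' : ℕ} (s : Fin δ → Cred δ') (c : Cred δ) : Cred δ' :=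
  ⟨c.const + ∑ i, c.coef i * (s i).const, fun j => ∑ i, c.coef i * (s i).coef j⟩

def weaken {δ : ℕ} (c : Cred δ) : Cred (δ + 1) := ⟨c.const, extend c.coef 0⟩

/-- Lift a credit substitution under a binder of a credit variable. -/
def lift {δ δ' : ℕ} (s : Fin δ → Cred δ') : Fin (δ + 1) → Cred (δ' + 1) :=
  extend (fun i => (s i).weaken) (var (Fin.last δ'))

end Cred

/-! ## Types of the intermediate language -/

/-- Types with free credit variables among `δ`.  `amp` is the lazy (negative) product `&`,
`bang k c A` is `!^k_c A`, and `ex A` is `∃ α. A`. -/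
inductive Ty : ℕ → Type
  | unit {δ : ℕ} : Ty δ
  | tensor {δ : ℕ} (A B : Ty δ) : Ty δ
  | plus {δ : ℕ} (A B : Ty δ) : Ty δ
  | amp {δ : ℕ} (A B : Ty δ) : Ty δ
  | lolli {δ : ℕ} (A B : Ty δ) : Ty δ
  | bang {δ : ℕ} (k : Mult) (c : Cred δ) (A : Ty δ) : Ty δ
  | nat {δ : ℕ} : Ty δ
  | list {δ : ℕ} (A : Ty δ) : Ty δ
  | ex {δ : ℕ} (A : Ty (δ + 1)) : Ty δ

namespace Ty

/-- Substitution of credit terms for the credit variables of a type. -/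
def subst : {δ δ' : ℕ} → (Fin δ → Cred δ') → Ty δ → Ty δ'
  | _, _, _, unit => unit
  | _, _, s, tensor A B => tensor (A.subst s) (B.subst s)
  | _, _, s, plus A B => plus (A.subst s) (B.subst s)
  | _, _, s, amp A B => amp (A.subst s) (B.subst s)
  | _, _, s, lolli A B => lolli (A.subst s) (B.subst s)
  | _, _, s, bang k c A => bang k (c.subst s) (A.subst s)
  | _, _, _, nat => nat
  | _, _, s, list A => list (A.subst s)
  | _, _, s, ex A => ex (A.subst (Cred.lift s))

/-- `A[c/α]` for the last credit variable `α`. -/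
def inst {δ : ℕ} (A : Ty (δ + 1)) (c : Cred δ) : Ty δ := A.subst (extend Cred.var c)

def weaken {δ : ℕ} (A : Ty δ) : Ty (δ + 1) := A.subst (fun i => Cred.var i.castSucc)

/-- Number of type constructors. -/
def size : {δ : ℕ} → Ty δ → ℕ
  | _, unit => 1
  | _, tensor A B => A.size + B.size + 1
  | _, plus A B => A.size + B.size + 1
  | _, amp A B => A.size + B.size + 1
  | _, lolli A B => A.size + B.size + 1
  | _, bang _ _ A => A.size + 1
  | _, nat => 1
  | _, list A => A.size + 1
  | _, ex A => A.size + 1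

theorem size_subst {δ : ℕ} (A : Ty δ) :
    ∀ {δ' : ℕ} (s : Fin δ → Cred δ'), (A.subst s).size = A.size := by
  induction A <;> intro δ' s <;> simp_all [subst, size]

theorem size_inst {δ : ℕ} (A : Ty (δ + 1)) (c : Cred δ) : (A.inst c).size = A.size :=
  size_subst A _

end Ty

/-! ## Terms of the intermediate language -/

/-- Terms with `δ` credit variables and `n` term variables.
* `split k M N` is `split_k (x, y) = M in N`, `caseOf k M N₁ N₂` is `case_k (M, x.N₁, y.N₂)`,
* `save k c M` is `save^k_c M`, `transfer k' k c M N` is `transfer_{k'} !^k_c x = M to N`,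
* `create c M`, `spend c M`, `tick M` are the cost and credit operations,
* `pack c M` packs the credit term `c`, `unpack k M N` is `unpack_k (α, x) = M in N`. -/
inductive Tm : ℕ → ℕ → Type
  | var {δ n : ℕ} (i : Fin n) : Tm δ n
  | unit {δ n : ℕ} : Tm δ n
  | pair {δ n : ℕ} (M N : Tm δ n) : Tm δ n
  | split {δ n : ℕ} (k : Mult) (M : Tm δ n) (N : Tm δ (n + 2)) : Tm δ n
  | inl {δ n : ℕ} (M : Tm δ n) : Tm δ n
  | inr {δ n : ℕ} (M : Tm δ n) : Tm δ n
  | caseOf {δ n : ℕ} (k : Mult) (M : Tm δ n) (N₁ N₂ : Tm δ (n + 1)) : Tm δ n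
  | lazyPair {δ n : ℕ} (M N : Tm δ n) : Tm δ n
  | fst {δ n : ℕ} (M : Tm δ n) : Tm δ n
  | snd {δ n : ℕ} (M : Tm δ n) : Tm δ n
  | lam {δ n : ℕ} (M : Tm δ (n + 1)) : Tm δ n
  | app {δ n : ℕ} (M N : Tm δ n) : Tm δ n
  | save {δ n : ℕ} (k : Mult) (c : Cred δ) (M : Tm δ n) : Tm δ n
  | transfer {δ n : ℕ} (k' k : Mult) (c : Cred δ) (M : Tm δ n) (N : Tm δ (n + 1)) : Tm δ n
  | zero {δ n : ℕ} : Tm δ n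
  | succ {δ n : ℕ} (M : Tm δ n) : Tm δ n
  | nrec {δ n : ℕ} (M N₁ N₂ : Tm δ n) : Tm δ n
  | nil {δ n : ℕ} : Tm δ n
  | cons {δ n : ℕ} (M N : Tm δ n) : Tm δ n
  | lrec {δ n : ℕ} (M N₁ N₂ : Tm δ n) : Tm δ n
  | tick {δ n : ℕ} (M : Tm δ n) : Tm δ n
  | create {δ n : ℕ} (c : Cred δ) (M : Tm δ n) : Tm δ n
  | spend {δ n : ℕ} (c : Cred δ) (M : Tm δ n) : Tm δ n
  | pack {δ n : ℕ} (c : Cred δ) (M : Tm δ n) : Tm δ n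
  | unpack {δ n : ℕ} (k : Mult) (M : Tm δ n) (N : Tm (δ + 1) (n + 1)) : Tm δ n

namespace Tm

/-- Substitution of credit terms for credit variables. -/
def csubst : {δ δ' n : ℕ} → (Fin δ → Cred δ') → Tm δ n → Tm δ' n
  | _, _, _, _, var i => var i
  | _, _, _, _, unit => unit
  | _, _, _, s, pair M N => pair (M.csubst s) (N.csubst s)
  | _, _, _, s, split k M N => split k (M.csubst s) (N.csubst s)
  | _, _, _, s, inl M => inl (M.csubst s)
  | _, _, _, s, inr M => inr (M.csubst s)
  | _, _, _, s, caseOf k M N₁ N₂ => caseOf k (M.csubst s) (N₁.csubst s) (N₂.csubst s)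
  | _, _, _, s, lazyPair M N => lazyPair (M.csubst s) (N.csubst s)
  | _, _, _, s, fst M => fst (M.csubst s)
  | _, _, _, s, snd M => snd (M.csubst s)
  | _, _, _, s, lam M => lam (M.csubst s)
  | _, _, _, s, app M N => app (M.csubst s) (N.csubst s)
  | _, _, _, s, save k c M => save k (c.subst s) (M.csubst s)
  | _, _, _, s, transfer k' k c M N => transfer k' k (c.subst s) (M.csubst s) (N.csubst s)
  | _, _, _, _, zero => zero
  | _, _, _, s, succ M => succ (M.csubst s)
  | _, _, _, s, nrec M N₁ N₂ => nrec (M.csubst s) (N₁.csubst s) (N₂.csubst s)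
  | _, _, _, _, nil => nil
  | _, _, _, s, cons M N => cons (M.csubst s) (N.csubst s)
  | _, _, _, s, lrec M N₁ N₂ => lrec (M.csubst s) (N₁.csubst s) (N₂.csubst s)
  | _, _, _, s, tick M => tick (M.csubst s)
  | _, _, _, s, create c M => create (c.subst s) (M.csubst s)
  | _, _, _, s, spend c M => spend (c.subst s) (M.csubst s)
  | _, _, _, s, pack c M => pack (c.subst s) (M.csubst s)
  | _, _, _, s, unpack k M N => unpack k (M.csubst s) (N.csubst (Cred.lift s))

/-- Lift a renaming of variables under a binder. -/
def liftRen {n m : ℕ} (r : Fin n → Fin m) : Fin (n + 1) → Fin (m + 1) :=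
  extend (fun i => (r i).castSucc) (Fin.last m)

/-- Renaming of term variables. -/
def rename : {δ n m : ℕ} → (Fin n → Fin m) → Tm δ n → Tm δ m
  | _, _, _, r, var i => var (r i)
  | _, _, _, _, unit => unit
  | _, _, _, r, pair M N => pair (M.rename r) (N.rename r)
  | _, _, _, r, split k M N => split k (M.rename r) (N.rename (liftRen (liftRen r)))
  | _, _, _, r, inl M => inl (M.rename r)
  | _, _, _, r, inr M => inr (M.rename r)
  | _, _, _, r, caseOf k M N₁ N₂ =>
      caseOf k (M.rename r) (N₁.rename (liftRen r)) (N₂.rename (liftRen r))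
  | _, _, _, r, lazyPair M N => lazyPair (M.rename r) (N.rename r)
  | _, _, _, r, fst M => fst (M.rename r)
  | _, _, _, r, snd M => snd (M.rename r)
  | _, _, _, r, lam M => lam (M.rename (liftRen r))
  | _, _, _, r, app M N => app (M.rename r) (N.rename r)
  | _, _, _, r, save k c M => save k c (M.rename r)
  | _, _, _, r, transfer k' k c M N => transfer k' k c (M.rename r) (N.rename (liftRen r))
  | _, _, _, _, zero => zero
  | _, _, _, r, succ M => succ (M.rename r)
  | _, _, _, r, nrec M N₁ N₂ => nrec (M.rename r) (N₁.rename r) (N₂.rename r)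
  | _, _, _, _, nil => nil
  | _, _, _, r, cons M N => cons (M.rename r) (N.rename r)
  | _, _, _, r, lrec M N₁ N₂ => lrec (M.rename r) (N₁.rename r) (N₂.rename r)
  | _, _, _, r, tick M => tick (M.rename r)
  | _, _, _, r, create c M => create c (M.rename r)
  | _, _, _, r, spend c M => spend c (M.rename r)
  | _, _, _, r, pack c M => pack c (M.rename r)
  | _, _, _, r, unpack k M N => unpack k (M.rename r) (N.rename (liftRen r))

def weaken {δ n : ℕ} (M : Tm δ n) : Tm δ (n + 1) := M.rename Fin.castSucc

def cweaken {δ n : ℕ} (M : Tm δ n) : Tm (δ + 1) n := M.csubst (fun i => Cred.var i.castSucc)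

/-- Lift a substitution under a binder of a term variable. -/
def lift {δ n m : ℕ} (t : Fin n → Tm δ m) : Fin (n + 1) → Tm δ (m + 1) :=
  extend (fun i => (t i).weaken) (var (Fin.last m))

/-- Simultaneous capture-avoiding substitution for term variables. -/
def subst : {δ n m : ℕ} → (Fin n → Tm δ m) → Tm δ n → Tm δ m
  | _, _, _, t, var i => t i
  | _, _, _, _, unit => unit
  | _, _, _, t, pair M N => pair (M.subst t) (N.subst t)
  | _, _, _, t, split k M N => split k (M.subst t) (N.subst (lift (lift t)))
  | _, _, _, t, inl M => inl (M.subst t)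
  | _, _, _, t, inr M => inr (M.subst t)
  | _, _, _, t, caseOf k M N₁ N₂ =>
      caseOf k (M.subst t) (N₁.subst (lift t)) (N₂.subst (lift t))
  | _, _, _, t, lazyPair M N => lazyPair (M.subst t) (N.subst t)
  | _, _, _, t, fst M => fst (M.subst t)
  | _, _, _, t, snd M => snd (M.subst t)
  | _, _, _, t, lam M => lam (M.subst (lift t))
  | _, _, _, t, app M N => app (M.subst t) (N.subst t)
  | _, _, _, t, save k c M => save k c (M.subst t)
  | _, _, _, t, transfer k' k c M N => transfer k' k c (M.subst t) (N.subst (lift t))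
  | _, _, _, _, zero => zero
  | _, _, _, t, succ M => succ (M.subst t)
  | _, _, _, t, nrec M N₁ N₂ => nrec (M.subst t) (N₁.subst t) (N₂.subst t)
  | _, _, _, _, nil => nil
  | _, _, _, t, cons M N => cons (M.subst t) (N.subst t)
  | _, _, _, t, lrec M N₁ N₂ => lrec (M.subst t) (N₁.subst t) (N₂.subst t)
  | _, _, _, t, tick M => tick (M.subst t)
  | _, _, _, t, create c M => create c (M.subst t)
  | _, _, _, t, spend c M => spend c (M.subst t)
  | _, _, _, t, pack c M => pack c (M.subst t)
  | _, _, _, t, unpack k M N =>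
      unpack k (M.subst t) (N.subst (lift (fun i => (t i).cweaken)))

/-- `M[N/x]` for the last variable `x`. -/
def inst {δ n : ℕ} (M : Tm δ (n + 1)) (N : Tm δ n) : Tm δ n := M.subst (extend var N)

/-- `M[N₁/x, N₂/y]` for the last two variables `x, y`. -/
def inst₂ {δ n : ℕ} (M : Tm δ (n + 2)) (N₁ N₂ : Tm δ n) : Tm δ n :=
  M.subst (extend (extend var N₁) N₂)

/-- `M[c/α]` for the last credit variable `α`. -/
def cinst {δ n : ℕ} (M : Tm (δ + 1) n) (c : Cred δ) : Tm δ n := M.csubst (extend Cred.var c)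

end Tm

/-! ## Resource terms and typing -/

/-- Resource terms `∑ⱼ var j * xⱼ + ∑ᵢ cvar i * αᵢ + const` with coefficients in `ℕ ∪ {∞}`,
up to the usual arithmetic identities.  The last two summands form the bank. -/
@[ext] structure Res (δ n : ℕ) where
  var : Fin n → ℕ∞
  cvar : Fin δ → ℕ∞
  const : ℕ∞

namespace Res

variable {δ n : ℕ}

instance : Add (Res δ n) :=
  ⟨fun f g => ⟨fun j => f.var j + g.var j, fun i => f.cvar i + g.cvar i, f.const + g.const⟩⟩

/-- The coefficient-wise order. -/
instance : LE (Res δ n) :=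
  ⟨fun f g => (∀ j, f.var j ≤ g.var j) ∧ (∀ i, f.cvar i ≤ g.cvar i) ∧ f.const ≤ g.const⟩

def scale (k : ℕ∞) (f : Res δ n) : Res δ n :=
  ⟨fun j => k * f.var j, fun i => k * f.cvar i, k * f.const⟩

/-- The resource term `x`. -/
def ofVar (j : Fin n) : Res δ n := ⟨Pi.single j 1, fun _ => 0, 0⟩

/-- A credit term as a bank. -/
def ofCred (c : Cred δ) : Res δ n := ⟨fun _ => 0, fun i => (c.coef i : ℕ∞), (c.const : ℕ∞)⟩

/-- The constant bank `a`. -/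
def bank (a : ℕ∞) : Res δ n := ⟨fun _ => 0, fun _ => 0, a⟩

/-- `f + a x` for a new variable `x`. -/
def push (f : Res δ n) (a : ℕ∞) : Res δ (n + 1) := ⟨extend f.var a, f.cvar, f.const⟩

/-- Weakening by a new credit variable. -/
def cweaken (f : Res δ n) : Res (δ + 1) n := ⟨f.var, extend f.cvar 0, f.const⟩

/-- `f[ω, σ]`: the value of `f` at credit amounts for the credit and term variables. -/
noncomputable def eval (f : Res δ n) (w : Fin δ → ℕ) (s : Fin n → ℕ∞) : ℕ∞ :=
  ∑ j, f.var j * s j + ∑ i, f.cvar i * (w i : ℕ∞) + f.const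

end Res

/-- The typing judgment `Δ | Γ ⊢_f M : A`, with `Δ` consisting of `δ` credit variables and `Γ`
assigning types to `n` term variables. -/
inductive HasTy : {δ n : ℕ} → (Fin n → Ty δ) → Res δ n → Tm δ n → Ty δ → Prop
  | var {δ n : ℕ} {Γ : Fin n → Ty δ} {f : Res δ n} (j : Fin n) :
      Res.ofVar j ≤ f → HasTy Γ f (.var j) (Γ j)
  | unit {δ n : ℕ} {Γ : Fin n → Ty δ} {f : Res δ n} : HasTy Γ f .unit .unit
  | pair {δ n : ℕ} {Γ : Fin n → Ty δ} {f g : Res δ n} {M N : Tm δ n} {A B : Ty δ} :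
      HasTy Γ f M A → HasTy Γ g N B → HasTy Γ (f + g) (.pair M N) (.tensor A B)
  | split {δ n : ℕ} {Γ : Fin n → Ty δ} {f g : Res δ n} {k : Mult} {M : Tm δ n}
      {N : Tm δ (n + 2)} {A B C : Ty δ} :
      HasTy Γ f M (.tensor A B) →
      HasTy (extend (extend Γ A) B) ((g.push k.1).push k.1) N C →
      HasTy Γ (f.scale k.1 + g) (.split k M N) C
  | inl {δ n : ℕ} {Γ : Fin n → Ty δ} {f : Res δ n} {M : Tm δ n} {A B : Ty δ} :
      HasTy Γ f M A → HasTy Γ f (.inl M) (.plus A B)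
  | inr {δ n : ℕ} {Γ : Fin n → Ty δ} {f : Res δ n} {M : Tm δ n} {A B : Ty δ} :
      HasTy Γ f M B → HasTy Γ f (.inr M) (.plus A B)
  | caseOf {δ n : ℕ} {Γ : Fin n → Ty δ} {f g : Res δ n} {k : Mult} {M : Tm δ n}
      {N₁ N₂ : Tm δ (n + 1)} {A B C : Ty δ} :
      HasTy Γ f M (.plus A B) →
      HasTy (extend Γ A) (g.push k.1) N₁ C →
      HasTy (extend Γ B) (g.push k.1) N₂ C →
      HasTy Γ (f.scale k.1 + g) (.caseOf k M N₁ N₂) C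
  | lazyPair {δ n : ℕ} {Γ : Fin n → Ty δ} {f : Res δ n} {M N : Tm δ n} {A B : Ty δ} :
      HasTy Γ f M A → HasTy Γ f N B → HasTy Γ f (.lazyPair M N) (.amp A B)
  | fst {δ n : ℕ} {Γ : Fin n → Ty δ} {f : Res δ n} {M : Tm δ n} {A B : Ty δ} :
      HasTy Γ f M (.amp A B) → HasTy Γ f (.fst M) A
  | snd {δ n : ℕ} {Γ : Fin n → Ty δ} {f : Res δ n} {M : Tm δ n} {A B : Ty δ} :
      HasTy Γ f M (.amp A B) → HasTy Γ f (.snd M) B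
  | lam {δ n : ℕ} {Γ : Fin n → Ty δ} {f : Res δ n} {M : Tm δ (n + 1)} {A B : Ty δ} :
      HasTy (extend Γ A) (f.push 1) M B → HasTy Γ f (.lam M) (.lolli A B)
  | app {δ n : ℕ} {Γ : Fin n → Ty δ} {f g : Res δ n} {M N : Tm δ n} {A B : Ty δ} :
      HasTy Γ f M (.lolli A B) → HasTy Γ g N A → HasTy Γ (f + g) (.app M N) B
  | save {δ n : ℕ} {Γ : Fin n → Ty δ} {f g : Res δ n} {k : Mult} {c : Cred δ} {M : Tm δ n}
      {A : Ty δ} :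
      HasTy Γ f M A → f.scale k.1 + Res.ofCred c ≤ g → HasTy Γ g (.save k c M) (.bang k c A)
  | transfer {δ n : ℕ} {Γ : Fin n → Ty δ} {f g : Res δ n} {k' k : Mult} {c : Cred δ}
      {M : Tm δ n} {N : Tm δ (n + 1)} {A C : Ty δ} :
      HasTy Γ f M (.bang k c A) →
      HasTy (extend Γ A) ((g + (Res.ofCred c).scale k'.1).push (k'.1 * k.1)) N C →
      HasTy Γ (f.scale k'.1 + g) (.transfer k' k c M N) C
  | zero {δ n : ℕ} {Γ : Fin n → Ty δ} {f : Res δ n} : HasTy Γ f .zero .nat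
  | succ {δ n : ℕ} {Γ : Fin n → Ty δ} {f : Res δ n} {M : Tm δ n} :
      HasTy Γ f M .nat → HasTy Γ f (.succ M) .nat
  | nrec {δ n : ℕ} {Γ : Fin n → Ty δ} {f g h : Res δ n} {M N₁ N₂ : Tm δ n} {C : Ty δ} :
      HasTy Γ f M .nat →
      HasTy Γ g N₁ (.lolli .unit C) →
      HasTy Γ h N₂ (.bang .inf (.lit 0) (.lolli (.tensor .nat (.lolli .unit C)) C)) →
      HasTy Γ (f + g + h) (.nrec M N₁ N₂) C
  | nil {δ n : ℕ} {Γ : Fin n → Ty δ} {f : Res δ n} {A : Ty δ} : HasTy Γ f .nil (.list A)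
  | cons {δ n : ℕ} {Γ : Fin n → Ty δ} {f g : Res δ n} {M N : Tm δ n} {A : Ty δ} :
      HasTy Γ f M A → HasTy Γ g N (.list A) → HasTy Γ (f + g) (.cons M N) (.list A)
  | lrec {δ n : ℕ} {Γ : Fin n → Ty δ} {f g h : Res δ n} {M N₁ N₂ : Tm δ n} {A C : Ty δ} :
      HasTy Γ f M (.list A) →
      HasTy Γ g N₁ (.lolli .unit C) →
      HasTy Γ h N₂ (.bang .inf (.lit 0) (.lolli (.tensor A (.amp (.list A) C)) C)) →
      HasTy Γ (f + g + h) (.lrec M N₁ N₂) C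
  | tick {δ n : ℕ} {Γ : Fin n → Ty δ} {f : Res δ n} {M : Tm δ n} {A : Ty δ} :
      HasTy Γ f M A → HasTy Γ f (.tick M) A
  | create {δ n : ℕ} {Γ : Fin n → Ty δ} {f : Res δ n} {c : Cred δ} {M : Tm δ n} {A : Ty δ} :
      HasTy Γ (f + Res.ofCred c) M A → HasTy Γ f (.create c M) A
  | spend {δ n : ℕ} {Γ : Fin n → Ty δ} {f : Res δ n} {c : Cred δ} {M : Tm δ n} {A : Ty δ} :
      HasTy Γ f M A → HasTy Γ (f + Res.ofCred c) (.spend c M) A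
  | pack {δ n : ℕ} {Γ : Fin n → Ty δ} {f : Res δ n} {c : Cred δ} {M : Tm δ n}
      {A : Ty (δ + 1)} :
      HasTy Γ f M (A.inst c) → HasTy Γ f (.pack c M) (.ex A)
  | unpack {δ n : ℕ} {Γ : Fin n → Ty δ} {f g : Res δ n} {k : Mult} {M : Tm δ n}
      {N : Tm (δ + 1) (n + 1)} {A : Ty (δ + 1)} {C : Ty δ} :
      HasTy Γ f M (.ex A) →
      HasTy (extend (fun j => (Γ j).weaken) A) (g.cweaken.push k.1) N C.weaken →
      HasTy Γ (f.scale k.1 + g) (.unpack k M N) C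

/-! ## Operational semantics -/

/-- The big-step judgment `M ↓^(m, r) v` for closed terms: `m` counts ticks and `r` is the net amount
of credits created.  Since multiplicities may be `∞`, `r` is an extended integer. -/
inductive Eval : Tm 0 0 → ℕ → ExtInt → Tm 0 0 → Prop
  | unit : Eval .unit 0 0 .unit
  | pair {M N v w : Tm 0 0} {m₁ m₂ : ℕ} {r₁ r₂ : ExtInt} :
      Eval M m₁ r₁ v → Eval N m₂ r₂ w → Eval (.pair M N) (m₁ + m₂) (r₁ + r₂) (.pair v w)
  | split {k : Mult} {M v₁ v₂ v : Tm 0 0} {N : Tm 0 2} {m₁ m₂ : ℕ} {r₁ r₂ : ExtInt} :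
      Eval M m₁ r₁ (.pair v₁ v₂) → Eval (N.inst₂ v₁ v₂) m₂ r₂ v →
      Eval (.split k M N) (m₁ + m₂) (ExtInt.scale k.1 r₁ + r₂) v
  | inl {M v : Tm 0 0} {m : ℕ} {r : ExtInt} : Eval M m r v → Eval (.inl M) m r (.inl v)
  | inr {M v : Tm 0 0} {m : ℕ} {r : ExtInt} : Eval M m r v → Eval (.inr M) m r (.inr v)
  | caseInl {k : Mult} {M v₁ v : Tm 0 0} {N₁ N₂ : Tm 0 1} {m₁ m₂ : ℕ} {r₁ r₂ : ExtInt} :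
      Eval M m₁ r₁ (.inl v₁) → Eval (N₁.inst v₁) m₂ r₂ v →
      Eval (.caseOf k M N₁ N₂) (m₁ + m₂) (ExtInt.scale k.1 r₁ + r₂) v
  | caseInr {k : Mult} {M v₁ v : Tm 0 0} {N₁ N₂ : Tm 0 1} {m₁ m₂ : ℕ} {r₁ r₂ : ExtInt} :
      Eval M m₁ r₁ (.inr v₁) → Eval (N₂.inst v₁) m₂ r₂ v →
      Eval (.caseOf k M N₁ N₂) (m₁ + m₂) (ExtInt.scale k.1 r₁ + r₂) v
  | lazyPair {M N : Tm 0 0} : Eval (.lazyPair M N) 0 0 (.lazyPair M N)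
  | fst {M M₁ M₂ v : Tm 0 0} {m₁ m₂ : ℕ} {r₁ r₂ : ExtInt} :
      Eval M m₁ r₁ (.lazyPair M₁ M₂) → Eval M₁ m₂ r₂ v → Eval (.fst M) (m₁ + m₂) (r₁ + r₂) v
  | snd {M M₁ M₂ v : Tm 0 0} {m₁ m₂ : ℕ} {r₁ r₂ : ExtInt} :
      Eval M m₁ r₁ (.lazyPair M₁ M₂) → Eval M₂ m₂ r₂ v → Eval (.snd M) (m₁ + m₂) (r₁ + r₂) v
  | lam {M : Tm 0 1} : Eval (.lam M) 0 0 (.lam M)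
  | app {M N w v : Tm 0 0} {M' : Tm 0 1} {m₁ m₂ m₃ : ℕ} {r₁ r₂ r₃ : ExtInt} :
      Eval M m₁ r₁ (.lam M') → Eval N m₂ r₂ w → Eval (M'.inst w) m₃ r₃ v →
      Eval (.app M N) (m₁ + m₂ + m₃) (r₁ + r₂ + r₃) v
  | save {k : Mult} {c : Cred 0} {M v : Tm 0 0} {m : ℕ} {r : ExtInt} :
      Eval M m r v → Eval (.save k c M) m (ExtInt.scale k.1 r) (.save k c v)
  | transfer {k' k : Mult} {c : Cred 0} {M v₁ v : Tm 0 0} {N : Tm 0 1} {m₁ m₂ : ℕ}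
      {r₁ r₂ : ExtInt} :
      Eval M m₁ r₁ (.save k c v₁) → Eval (N.inst v₁) m₂ r₂ v →
      Eval (.transfer k' k c M N) (m₁ + m₂) (ExtInt.scale k'.1 r₁ + r₂) v
  | zero : Eval .zero 0 0 .zero
  | succ {M v : Tm 0 0} {m : ℕ} {r : ExtInt} : Eval M m r v → Eval (.succ M) m r (.succ v)
  | nrecZero {M N₁ N₂ v : Tm 0 0} {N₁' N₂' : Tm 0 1} {m₁ m₂ m₃ m₄ : ℕ} {r₁ r₂ r₃ r₄ : ExtInt} :
      Eval M m₁ r₁ .zero → Eval N₁ m₂ r₂ (.lam N₁') →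
      Eval N₂ m₃ r₃ (.save .inf (.lit 0) (.lam N₂')) → Eval (N₁'.inst .unit) m₄ r₄ v →
      Eval (.nrec M N₁ N₂) (m₁ + m₂ + m₃ + m₄) (r₁ + r₂ + r₃ + r₄) v
  | nrecSucc {M N₁ N₂ v₀ v : Tm 0 0} {N₁' N₂' : Tm 0 1} {m₁ m₂ m₃ m₄ : ℕ}
      {r₁ r₂ r₃ r₄ : ExtInt} :
      Eval M m₁ r₁ (.succ v₀) → Eval N₁ m₂ r₂ (.lam N₁') →
      Eval N₂ m₃ r₃ (.save .inf (.lit 0) (.lam N₂')) →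
      Eval (N₂'.inst (.pair v₀
        (.lam (Tm.weaken (.nrec v₀ (.lam N₁') (.save .inf (.lit 0) (.lam N₂'))))))) m₄ r₄ v →
      Eval (.nrec M N₁ N₂) (m₁ + m₂ + m₃ + m₄) (r₁ + r₂ + r₃ + r₄) v
  | nil : Eval .nil 0 0 .nil
  | cons {M N v w : Tm 0 0} {m₁ m₂ : ℕ} {r₁ r₂ : ExtInt} :
      Eval M m₁ r₁ v → Eval N m₂ r₂ w → Eval (.cons M N) (m₁ + m₂) (r₁ + r₂) (.cons v w)
  | lrecNil {M N₁ N₂ v : Tm 0 0} {N₁' N₂' : Tm 0 1} {m₁ m₂ m₃ m₄ : ℕ} {r₁ r₂ r₃ r₄ : ExtInt} :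
      Eval M m₁ r₁ .nil → Eval N₁ m₂ r₂ (.lam N₁') →
      Eval N₂ m₃ r₃ (.save .inf (.lit 0) (.lam N₂')) → Eval (N₁'.inst .unit) m₄ r₄ v →
      Eval (.lrec M N₁ N₂) (m₁ + m₂ + m₃ + m₄) (r₁ + r₂ + r₃ + r₄) v
  | lrecCons {M N₁ N₂ v₁ v₂ v : Tm 0 0} {N₁' N₂' : Tm 0 1} {m₁ m₂ m₃ m₄ : ℕ}
      {r₁ r₂ r₃ r₄ : ExtInt} :
      Eval M m₁ r₁ (.cons v₁ v₂) → Eval N₁ m₂ r₂ (.lam N₁') →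
      Eval N₂ m₃ r₃ (.save .inf (.lit 0) (.lam N₂')) →
      Eval (N₂'.inst (.pair v₁ (.lazyPair v₂
        (.lrec v₂ (.lam N₁') (.save .inf (.lit 0) (.lam N₂')))))) m₄ r₄ v →
      Eval (.lrec M N₁ N₂) (m₁ + m₂ + m₃ + m₄) (r₁ + r₂ + r₃ + r₄) v
  | tick {M v : Tm 0 0} {m : ℕ} {r : ExtInt} : Eval M m r v → Eval (.tick M) (m + 1) r v
  | create {c : Cred 0} {M v : Tm 0 0} {m : ℕ} {r : ExtInt} :
      Eval M m r v → Eval (.create c M) m (r + ExtInt.ofInt c.const) v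
  | spend {c : Cred 0} {M v : Tm 0 0} {m : ℕ} {r : ExtInt} :
      Eval M m r v → Eval (.spend c M) m (r + ExtInt.ofInt (-c.const)) v
  | pack {c : Cred 0} {M v : Tm 0 0} {m : ℕ} {r : ExtInt} :
      Eval M m r v → Eval (.pack c M) m r (.pack c v)
  | unpack {k : Mult} {c : Cred 0} {M v₁ v : Tm 0 0} {N : Tm 1 1} {m₁ m₂ : ℕ} {r₁ r₂ : ExtInt} :
      Eval M m₁ r₁ (.pack c v₁) → Eval ((N.cinst c).inst v₁) m₂ r₂ v →
      Eval (.unpack k M N) (m₁ + m₂) (ExtInt.scale k.1 r₁ + r₂) v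

/-! ## The recurrence language -/

/-- Types of the recurrence language; `cost` is `ℂ` and `cred` is `$`. -/
inductive CTy : Type
  | cost | cred | unit | nat
  | prod (S T : CTy)
  | sum (S T : CTy)
  | arr (S T : CTy)
  | list (S : CTy)

/-- Terms of the recurrence language with `n` variables. -/
inductive CTm : ℕ → Type
  | var {n : ℕ} (i : Fin n) : CTm n
  /-- cost constants, sum, negation and scaling of costs -/
  | const {n : ℕ} (q : ExtInt) : CTm n
  | add {n : ℕ} (E F : CTm n) : CTm n
  | neg {n : ℕ} (E : CTm n) : CTm n
  | scale {n : ℕ} (k : Mult) (E : CTm n) : CTm n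
  /-- credit constants, sum of credits, and the coercion from credits to costs -/
  | credLit {n : ℕ} (m : ℕ) : CTm n
  | credAdd {n : ℕ} (E F : CTm n) : CTm n
  | toCost {n : ℕ} (E : CTm n) : CTm n
  | unit {n : ℕ} : CTm n
  | pair {n : ℕ} (E F : CTm n) : CTm n
  | fst {n : ℕ} (E : CTm n) : CTm n
  | snd {n : ℕ} (E : CTm n) : CTm n
  | inl {n : ℕ} (E : CTm n) : CTm n
  | inr {n : ℕ} (E : CTm n) : CTm n
  | caseOf {n : ℕ} (E : CTm n) (F₁ F₂ : CTm (n + 1)) : CTm n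
  | lam {n : ℕ} (E : CTm (n + 1)) : CTm n
  | app {n : ℕ} (E F : CTm n) : CTm n
  | zero {n : ℕ} : CTm n
  | succ {n : ℕ} (E : CTm n) : CTm n
  | nrec {n : ℕ} (E F₁ F₂ : CTm n) : CTm n
  | nil {n : ℕ} : CTm n
  | cons {n : ℕ} (E F : CTm n) : CTm n
  | lrec {n : ℕ} (E F₁ F₂ : CTm n) : CTm n

namespace CTm

/-- Renaming of variables. -/
def rename : {n m : ℕ} → (Fin n → Fin m) → CTm n → CTm m
  | _, _, r, var i => var (r i)
  | _, _, _, const q => const q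
  | _, _, r, add E F => add (E.rename r) (F.rename r)
  | _, _, r, neg E => neg (E.rename r)
  | _, _, r, scale k E => scale k (E.rename r)
  | _, _, _, credLit m => credLit m
  | _, _, r, credAdd E F => credAdd (E.rename r) (F.rename r)
  | _, _, r, toCost E => toCost (E.rename r)
  | _, _, _, unit => unit
  | _, _, r, pair E F => pair (E.rename r) (F.rename r)
  | _, _, r, fst E => fst (E.rename r)
  | _, _, r, snd E => snd (E.rename r)
  | _, _, r, inl E => inl (E.rename r)
  | _, _, r, inr E => inr (E.rename r)
  | _, _, r, caseOf E F₁ F₂ =>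
      caseOf (E.rename r) (F₁.rename (Tm.liftRen r)) (F₂.rename (Tm.liftRen r))
  | _, _, r, lam E => lam (E.rename (Tm.liftRen r))
  | _, _, r, app E F => app (E.rename r) (F.rename r)
  | _, _, _, zero => zero
  | _, _, r, succ E => succ (E.rename r)
  | _, _, r, nrec E F₁ F₂ => nrec (E.rename r) (F₁.rename r) (F₂.rename r)
  | _, _, _, nil => nil
  | _, _, r, cons E F => cons (E.rename r) (F.rename r)
  | _, _, r, lrec E F₁ F₂ => lrec (E.rename r) (F₁.rename r) (F₂.rename r)

def weaken {n : ℕ} (E : CTm n) : CTm (n + 1) := E.rename Fin.castSucc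

/-- Lift a substitution under a binder. -/
def lift {n m : ℕ} (t : Fin n → CTm m) : Fin (n + 1) → CTm (m + 1) :=
  extend (fun i => (t i).weaken) (var (Fin.last m))

/-- Simultaneous capture-avoiding substitution. -/
def subst : {n m : ℕ} → (Fin n → CTm m) → CTm n → CTm m
  | _, _, t, var i => t i
  | _, _, _, const q => const q
  | _, _, t, add E F => add (E.subst t) (F.subst t)
  | _, _, t, neg E => neg (E.subst t)
  | _, _, t, scale k E => scale k (E.subst t)
  | _, _, _, credLit m => credLit m
  | _, _, t, credAdd E F => credAdd (E.subst t) (F.subst t)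
  | _, _, t, toCost E => toCost (E.subst t)
  | _, _, _, unit => unit
  | _, _, t, pair E F => pair (E.subst t) (F.subst t)
  | _, _, t, fst E => fst (E.subst t)
  | _, _, t, snd E => snd (E.subst t)
  | _, _, t, inl E => inl (E.subst t)
  | _, _, t, inr E => inr (E.subst t)
  | _, _, t, caseOf E F₁ F₂ => caseOf (E.subst t) (F₁.subst (lift t)) (F₂.subst (lift t))
  | _, _, t, lam E => lam (E.subst (lift t))
  | _, _, t, app E F => app (E.subst t) (F.subst t)
  | _, _, _, zero => zero
  | _, _, t, succ E => succ (E.subst t)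
  | _, _, t, nrec E F₁ F₂ => nrec (E.subst t) (F₁.subst t) (F₂.subst t)
  | _, _, _, nil => nil
  | _, _, t, cons E F => cons (E.subst t) (F.subst t)
  | _, _, t, lrec E F₁ F₂ => lrec (E.subst t) (F₁.subst t) (F₂.subst t)

/-- `E[F/x]` for the last variable `x`. -/
def inst {n : ℕ} (E : CTm (n + 1)) (F : CTm n) : CTm n := E.subst (extend var F)

/-- `E[F₁/x, F₂/y]` for the last two variables `x, y`. -/
def inst₂ {n : ℕ} (E : CTm (n + 2)) (F₁ F₂ : CTm n) : CTm n :=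
  E.subst (extend (extend var F₁) F₂)

/-- `E +_c F = (E + π₁ F, π₂ F)`, adding a cost to a complexity. -/
def addCost {n : ℕ} (E F : CTm n) : CTm n := pair (add E (fst F)) (snd F)

/-- The `m`-fold sum `E + (E + (⋯ + 0))` of a credit expression. -/
def credMul {n : ℕ} : ℕ → CTm n → CTm n
  | 0, _ => credLit 0
  | m + 1, E => credAdd E (credMul m E)

end CTm

/-- The typing judgment `Γ ⊢ E : T` of the recurrence language. -/
inductive CHasTy : {n : ℕ} → (Fin n → CTy) → CTm n → CTy → Prop
  | var {n : ℕ} {Γ : Fin n → CTy} (i : Fin n) : CHasTy Γ (.var i) (Γ i)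
  | const {n : ℕ} {Γ : Fin n → CTy} (q : ExtInt) : CHasTy Γ (.const q) .cost
  | add {n : ℕ} {Γ : Fin n → CTy} {E F : CTm n} :
      CHasTy Γ E .cost → CHasTy Γ F .cost → CHasTy Γ (.add E F) .cost
  | neg {n : ℕ} {Γ : Fin n → CTy} {E : CTm n} : CHasTy Γ E .cost → CHasTy Γ (.neg E) .cost
  | scale {n : ℕ} {Γ : Fin n → CTy} {E : CTm n} (k : Mult) :
      CHasTy Γ E .cost → CHasTy Γ (.scale k E) .cost
  | credLit {n : ℕ} {Γ : Fin n → CTy} (m : ℕ) : CHasTy Γ (.credLit m) .cred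
  | credAdd {n : ℕ} {Γ : Fin n → CTy} {E F : CTm n} :
      CHasTy Γ E .cred → CHasTy Γ F .cred → CHasTy Γ (.credAdd E F) .cred
  | toCost {n : ℕ} {Γ : Fin n → CTy} {E : CTm n} :
      CHasTy Γ E .cred → CHasTy Γ (.toCost E) .cost
  | unit {n : ℕ} {Γ : Fin n → CTy} : CHasTy Γ .unit .unit
  | pair {n : ℕ} {Γ : Fin n → CTy} {E F : CTm n} {S T : CTy} :
      CHasTy Γ E S → CHasTy Γ F T → CHasTy Γ (.pair E F) (.prod S T)
  | fst {n : ℕ} {Γ : Fin n → CTy} {E : CTm n} {S T : CTy} :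
      CHasTy Γ E (.prod S T) → CHasTy Γ (.fst E) S
  | snd {n : ℕ} {Γ : Fin n → CTy} {E : CTm n} {S T : CTy} :
      CHasTy Γ E (.prod S T) → CHasTy Γ (.snd E) T
  | inl {n : ℕ} {Γ : Fin n → CTy} {E : CTm n} {S T : CTy} :
      CHasTy Γ E S → CHasTy Γ (.inl E) (.sum S T)
  | inr {n : ℕ} {Γ : Fin n → CTy} {E : CTm n} {S T : CTy} :
      CHasTy Γ E T → CHasTy Γ (.inr E) (.sum S T)
  | caseOf {n : ℕ} {Γ : Fin n → CTy} {E : CTm n} {F₁ F₂ : CTm (n + 1)} {S T U : CTy} :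
      CHasTy Γ E (.sum S T) → CHasTy (extend Γ S) F₁ U → CHasTy (extend Γ T) F₂ U →
      CHasTy Γ (.caseOf E F₁ F₂) U
  | lam {n : ℕ} {Γ : Fin n → CTy} {E : CTm (n + 1)} {S T : CTy} :
      CHasTy (extend Γ S) E T → CHasTy Γ (.lam E) (.arr S T)
  | app {n : ℕ} {Γ : Fin n → CTy} {E F : CTm n} {S T : CTy} :
      CHasTy Γ E (.arr S T) → CHasTy Γ F S → CHasTy Γ (.app E F) T
  | zero {n : ℕ} {Γ : Fin n → CTy} : CHasTy Γ .zero .nat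
  | succ {n : ℕ} {Γ : Fin n → CTy} {E : CTm n} : CHasTy Γ E .nat → CHasTy Γ (.succ E) .nat
  | nrec {n : ℕ} {Γ : Fin n → CTy} {E F₁ F₂ : CTm n} {T : CTy} :
      CHasTy Γ E .nat → CHasTy Γ F₁ (.arr .unit T) → CHasTy Γ F₂ (.arr (.prod .nat T) T) →
      CHasTy Γ (.nrec E F₁ F₂) T
  | nil {n : ℕ} {Γ : Fin n → CTy} {S : CTy} : CHasTy Γ .nil (.list S)
  | cons {n : ℕ} {Γ : Fin n → CTy} {E F : CTm n} {S : CTy} :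
      CHasTy Γ E S → CHasTy Γ F (.list S) → CHasTy Γ (.cons E F) (.list S)
  | lrec {n : ℕ} {Γ : Fin n → CTy} {E F₁ F₂ : CTm n} {S T : CTy} :
      CHasTy Γ E (.list S) → CHasTy Γ F₁ (.arr .unit T) →
      CHasTy Γ F₂ (.arr (.prod S (.prod (.list S) T)) T) →
      CHasTy Γ (.lrec E F₁ F₂) T

/-- The inequality judgment `Γ ⊢ E ≤_T F` of the recurrence language, a relation on well-typed
terms.  It consists of reflexivity, transitivity, congruence in the principal positions of
elimination forms, the fact that a `β`-reduct is bounded by its redex, and laws for costs and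
credits.  Costs are ordered as extended integers; credit amounts are ordered discretely. -/
inductive CLe : {n : ℕ} → (Fin n → CTy) → CTm n → CTm n → CTy → Prop
  | refl {n : ℕ} {Γ : Fin n → CTy} {E : CTm n} {T : CTy} : CHasTy Γ E T → CLe Γ E E T
  | trans {n : ℕ} {Γ : Fin n → CTy} {E F G : CTm n} {T : CTy} :
      CLe Γ E F T → CLe Γ F G T → CLe Γ E G T
  -- congruence in principal positions
  | fst {n : ℕ} {Γ : Fin n → CTy} {E F : CTm n} {S T : CTy} :
      CLe Γ E F (.prod S T) → CLe Γ (.fst E) (.fst F) S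
  | snd {n : ℕ} {Γ : Fin n → CTy} {E F : CTm n} {S T : CTy} :
      CLe Γ E F (.prod S T) → CLe Γ (.snd E) (.snd F) T
  | caseOf {n : ℕ} {Γ : Fin n → CTy} {E F : CTm n} {G₁ G₂ : CTm (n + 1)} {S T U : CTy} :
      CLe Γ E F (.sum S T) → CHasTy (extend Γ S) G₁ U → CHasTy (extend Γ T) G₂ U →
      CLe Γ (.caseOf E G₁ G₂) (.caseOf F G₁ G₂) U
  | app {n : ℕ} {Γ : Fin n → CTy} {E F G : CTm n} {S T : CTy} :
      CLe Γ E F (.arr S T) → CHasTy Γ G S → CLe Γ (.app E G) (.app F G) T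
  | nrec {n : ℕ} {Γ : Fin n → CTy} {E F G₁ G₂ : CTm n} {T : CTy} :
      CLe Γ E F .nat → CHasTy Γ G₁ (.arr .unit T) → CHasTy Γ G₂ (.arr (.prod .nat T) T) →
      CLe Γ (.nrec E G₁ G₂) (.nrec F G₁ G₂) T
  | lrec {n : ℕ} {Γ : Fin n → CTy} {E F G₁ G₂ : CTm n} {S T : CTy} :
      CLe Γ E F (.list S) → CHasTy Γ G₁ (.arr .unit T) →
      CHasTy Γ G₂ (.arr (.prod S (.prod (.list S) T)) T) →
      CLe Γ (.lrec E G₁ G₂) (.lrec F G₁ G₂) T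
  -- reducts are bounded by redexes
  | betaFst {n : ℕ} {Γ : Fin n → CTy} {E F : CTm n} {S T : CTy} :
      CHasTy Γ E S → CHasTy Γ F T → CLe Γ E (.fst (.pair E F)) S
  | betaSnd {n : ℕ} {Γ : Fin n → CTy} {E F : CTm n} {S T : CTy} :
      CHasTy Γ E S → CHasTy Γ F T → CLe Γ F (.snd (.pair E F)) T
  | betaInl {n : ℕ} {Γ : Fin n → CTy} {E : CTm n} {F₁ F₂ : CTm (n + 1)} {S T U : CTy} :
      CHasTy Γ E S → CHasTy (extend Γ S) F₁ U → CHasTy (extend Γ T) F₂ U →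
      CLe Γ (F₁.inst E) (.caseOf (.inl E) F₁ F₂) U
  | betaInr {n : ℕ} {Γ : Fin n → CTy} {E : CTm n} {F₁ F₂ : CTm (n + 1)} {S T U : CTy} :
      CHasTy Γ E T → CHasTy (extend Γ S) F₁ U → CHasTy (extend Γ T) F₂ U →
      CLe Γ (F₂.inst E) (.caseOf (.inr E) F₁ F₂) U
  | betaLam {n : ℕ} {Γ : Fin n → CTy} {E : CTm (n + 1)} {F : CTm n} {S T : CTy} :
      CHasTy (extend Γ S) E T → CHasTy Γ F S → CLe Γ (E.inst F) (.app (.lam E) F) T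
  | betaZero {n : ℕ} {Γ : Fin n → CTy} {F₁ F₂ : CTm n} {T : CTy} :
      CHasTy Γ F₁ (.arr .unit T) → CHasTy Γ F₂ (.arr (.prod .nat T) T) →
      CLe Γ (.app F₁ .unit) (.nrec .zero F₁ F₂) T
  | betaSucc {n : ℕ} {Γ : Fin n → CTy} {E F₁ F₂ : CTm n} {T : CTy} :
      CHasTy Γ E .nat → CHasTy Γ F₁ (.arr .unit T) → CHasTy Γ F₂ (.arr (.prod .nat T) T) →
      CLe Γ (.app F₂ (.pair E (.nrec E F₁ F₂))) (.nrec (.succ E) F₁ F₂) T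
  | betaNil {n : ℕ} {Γ : Fin n → CTy} {F₁ F₂ : CTm n} {S T : CTy} :
      CHasTy Γ F₁ (.arr .unit T) → CHasTy Γ F₂ (.arr (.prod S (.prod (.list S) T)) T) →
      CLe Γ (.app F₁ .unit) (.lrec .nil F₁ F₂) T
  | betaCons {n : ℕ} {Γ : Fin n → CTy} {E E' F₁ F₂ : CTm n} {S T : CTy} :
      CHasTy Γ E S → CHasTy Γ E' (.list S) → CHasTy Γ F₁ (.arr .unit T) →
      CHasTy Γ F₂ (.arr (.prod S (.prod (.list S) T)) T) →
      CLe Γ (.app F₂ (.pair E (.pair E' (.lrec E' F₁ F₂)))) (.lrec (.cons E E') F₁ F₂) T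
  -- costs
  | constLe {n : ℕ} {Γ : Fin n → CTy} {p q : ExtInt} :
      p ≤ q → CLe Γ (.const p) (.const q) .cost
  | botLe {n : ℕ} {Γ : Fin n → CTy} {E : CTm n} :
      CHasTy Γ E .cost → CLe Γ (.const ExtInt.negInf) E .cost
  | topAdd {n : ℕ} {Γ : Fin n → CTy} {E : CTm n} :
      CHasTy Γ E .cost → CLe Γ (.const ⊤) (.add (.const ⊤) E) .cost
  | add {n : ℕ} {Γ : Fin n → CTy} {E E' F F' : CTm n} :
      CLe Γ E F .cost → CLe Γ E' F' .cost → CLe Γ (.add E E') (.add F F') .cost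
  | addConst {n : ℕ} {Γ : Fin n → CTy} (p q : ExtInt) :
      CLe Γ (.add (.const p) (.const q)) (.const (p + q)) .cost
  | constAdd {n : ℕ} {Γ : Fin n → CTy} (p q : ExtInt) :
      CLe Γ (.const (p + q)) (.add (.const p) (.const q)) .cost
  | zeroAdd {n : ℕ} {Γ : Fin n → CTy} {E : CTm n} :
      CHasTy Γ E .cost → CLe Γ (.add (.const 0) E) E .cost
  | leZeroAdd {n : ℕ} {Γ : Fin n → CTy} {E : CTm n} :
      CHasTy Γ E .cost → CLe Γ E (.add (.const 0) E) .cost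
  | addComm {n : ℕ} {Γ : Fin n → CTy} {E F : CTm n} :
      CHasTy Γ E .cost → CHasTy Γ F .cost → CLe Γ (.add E F) (.add F E) .cost
  | addAssoc {n : ℕ} {Γ : Fin n → CTy} {E F G : CTm n} :
      CHasTy Γ E .cost → CHasTy Γ F .cost → CHasTy Γ G .cost →
      CLe Γ (.add (.add E F) G) (.add E (.add F G)) .cost
  | neg {n : ℕ} {Γ : Fin n → CTy} {E F : CTm n} :
      CLe Γ E F .cost → CLe Γ (.neg F) (.neg E) .cost
  | negConst {n : ℕ} {Γ : Fin n → CTy} (q : ExtInt) :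
      CLe Γ (.neg (.const q)) (.const q.neg) .cost
  | constNeg {n : ℕ} {Γ : Fin n → CTy} (q : ExtInt) :
      CLe Γ (.const q.neg) (.neg (.const q)) .cost
  | scale {n : ℕ} {Γ : Fin n → CTy} {E F : CTm n} (k : Mult) :
      CLe Γ E F .cost → CLe Γ (.scale k E) (.scale k F) .cost
  | scaleConst {n : ℕ} {Γ : Fin n → CTy} (k : Mult) (q : ExtInt) :
      CLe Γ (.scale k (.const q)) (.const (ExtInt.scale k.1 q)) .cost
  | constScale {n : ℕ} {Γ : Fin n → CTy} (k : Mult) (q : ExtInt) :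
      CLe Γ (.const (ExtInt.scale k.1 q)) (.scale k (.const q)) .cost
  | scaleAdd {n : ℕ} {Γ : Fin n → CTy} {E F : CTm n} (k : Mult) :
      CHasTy Γ E .cost → CHasTy Γ F .cost →
      CLe Γ (.scale k (.add E F)) (.add (.scale k E) (.scale k F)) .cost
  -- credits
  | toCost {n : ℕ} {Γ : Fin n → CTy} {E F : CTm n} :
      CLe Γ E F .cred → CLe Γ (.toCost E) (.toCost F) .cost
  | toCostLit {n : ℕ} {Γ : Fin n → CTy} (m : ℕ) :
      CLe Γ (.toCost (.credLit m)) (.const (ExtInt.ofInt m)) .cost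
  | litToCost {n : ℕ} {Γ : Fin n → CTy} (m : ℕ) :
      CLe Γ (.const (ExtInt.ofInt m)) (.toCost (.credLit m)) .cost
  | credSymm {n : ℕ} {Γ : Fin n → CTy} {E F : CTm n} :
      CLe Γ E F .cred → CLe Γ F E .cred
  | credAdd {n : ℕ} {Γ : Fin n → CTy} {E E' F F' : CTm n} :
      CLe Γ E F .cred → CLe Γ E' F' .cred → CLe Γ (.credAdd E E') (.credAdd F F') .cred
  | credAddLit {n : ℕ} {Γ : Fin n → CTy} (m m' : ℕ) :
      CLe Γ (.credAdd (.credLit m) (.credLit m')) (.credLit (m + m')) .cred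
  | credZeroAdd {n : ℕ} {Γ : Fin n → CTy} {E : CTm n} :
      CHasTy Γ E .cred → CLe Γ (.credAdd (.credLit 0) E) E .cred
  | credAddComm {n : ℕ} {Γ : Fin n → CTy} {E F : CTm n} :
      CHasTy Γ E .cred → CHasTy Γ F .cred → CLe Γ (.credAdd E F) (.credAdd F E) .cred
  | credAddAssoc {n : ℕ} {Γ : Fin n → CTy} {E F G : CTm n} :
      CHasTy Γ E .cred → CHasTy Γ F .cred → CHasTy Γ G .cred →
      CLe Γ (.credAdd (.credAdd E F) G) (.credAdd E (.credAdd F G)) .cred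

/-- Typing of closed recurrence terms. -/
def CTyped (E : CTm 0) (T : CTy) : Prop := CHasTy (Fin.elim0 : Fin 0 → CTy) E T

/-- The inequality judgment on closed recurrence terms. -/
def CLeClosed (E F : CTm 0) (T : CTy) : Prop := CLe (Fin.elim0 : Fin 0 → CTy) E F T

/-! ## Recurrence extraction -/

/-- The potential type `⟨A⟩`. -/
def pot : {δ : ℕ} → Ty δ → CTy
  | _, .unit => .unit
  | _, .tensor A B => .prod (pot A) (pot B)
  | _, .plus A B => .sum (pot A) (pot B)
  | _, .amp A B => .prod (.prod .cost (pot A)) (.prod .cost (pot B))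
  | _, .lolli A B => .arr (pot A) (.prod .cost (pot B))
  | _, .bang _ _ A => pot A
  | _, .nat => .nat
  | _, .list A => .list (pot A)
  | _, .ex A => .prod .cred (pot A)

/-- The complexity type `‖A‖ = ℂ × ⟨A⟩`. -/
def cpx {δ : ℕ} (A : Ty δ) : CTy := .prod .cost (pot A)

/-- A credit term as a recurrence term of type `$`.  The recurrence context of a term with `δ` credit
variables and `n` term variables has the credit variables first. -/
def credTm {δ : ℕ} (n : ℕ) (c : Cred δ) : CTm (δ + n) :=
  (List.finRange δ).foldr
    (fun i E => .credAdd (CTm.credMul (c.coef i) (.var (Fin.castAdd n i))) E) (.credLit c.const)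

/-- The extracted recurrence `‖M‖`.  The costs and potentials of subterms are written `fst`, `snd`. -/
def extract : {δ n : ℕ} → Tm δ n → CTm (δ + n)
  | δ, _, .var i => .pair (.const 0) (.var (Fin.natAdd δ i))
  | _, _, .unit => .pair (.const 0) .unit
  | _, _, .pair M N =>
      .pair (.add (.fst (extract M)) (.fst (extract N))) (.pair (.snd (extract M)) (.snd (extract N)))
  | δ, n, .split k M N =>
      CTm.addCost (.scale k (.fst (extract M)))
        (CTm.inst₂ (n := δ + n) (extract (δ := δ) (n := n + 2) N) (.fst (.snd (extract M))) (.snd (.snd (extract M))))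
  | _, _, .inl M => .pair (.fst (extract M)) (.inl (.snd (extract M)))
  | _, _, .inr M => .pair (.fst (extract M)) (.inr (.snd (extract M)))
  | δ, n, .caseOf k M N₁ N₂ =>
      CTm.addCost (.scale k (.fst (extract M)))
        (.caseOf (.snd (extract M)) (extract (δ := δ) (n := n + 1) N₁)
          (extract (δ := δ) (n := n + 1) N₂))
  | _, _, .lazyPair M N => .pair (.const 0) (.pair (extract M) (extract N))
  | _, _, .fst M => CTm.addCost (.fst (extract M)) (.fst (.snd (extract M)))
  | _, _, .snd M => CTm.addCost (.fst (extract M)) (.snd (.snd (extract M)))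
  | δ, n, .lam M => .pair (.const 0) (.lam (extract (δ := δ) (n := n + 1) M))
  | _, _, .app M N =>
      CTm.addCost (.add (.fst (extract M)) (.fst (extract N)))
        (.app (.snd (extract M)) (.snd (extract N)))
  | _, _, .save k _ M => .pair (.scale k (.fst (extract M))) (.snd (extract M))
  | δ, n, .transfer k' _ _ M N =>
      CTm.addCost (.scale k' (.fst (extract M)))
        (CTm.inst (n := δ + n) (extract (δ := δ) (n := n + 1) N) (.snd (extract M)))
  | _, _, .zero => .pair (.const 0) .zero
  | _, _, .succ M => .pair (.fst (extract M)) (.succ (.snd (extract M)))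
  | δ, n, .nrec M N₁ N₂ =>
      CTm.addCost (.add (.add (.fst (extract M)) (.fst (extract N₁))) (.fst (extract N₂)))
        (.nrec (.snd (extract M)) (.snd (extract N₁))
          -- `λ p. ‖N₂‖_p (π₁ p, λ z. π₂ p)`
          (.lam (.app (CTm.weaken (.snd (extract N₂)))
            (.pair (.fst (.var (Fin.last (δ + n))))
              (.lam (CTm.weaken (.snd (.var (Fin.last (δ + n))))))))))
  | _, _, .nil => .pair (.const 0) .nil
  | _, _, .cons M N =>
      .pair (.add (.fst (extract M)) (.fst (extract N))) (.cons (.snd (extract M)) (.snd (extract N)))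
  | δ, n, .lrec M N₁ N₂ =>
      CTm.addCost (.add (.add (.fst (extract M)) (.fst (extract N₁))) (.fst (extract N₂)))
        (.lrec (.snd (extract M)) (.snd (extract N₁))
          -- `λ p. ‖N₂‖_p (π₁ p, ((0, π₁ π₂ p), π₂ π₂ p))`
          (.lam (.app (CTm.weaken (.snd (extract N₂)))
            (.pair (.fst (.var (Fin.last (δ + n))))
              (.pair (.pair (.const 0) (.fst (.snd (.var (Fin.last (δ + n))))))
                (.snd (.snd (.var (Fin.last (δ + n))))))))))
  | _, _, .tick M => CTm.addCost (.const (ExtInt.ofInt 1)) (extract M)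
  | _, n, .create c M => CTm.addCost (.toCost (credTm n c)) (extract M)
  | _, n, .spend c M => CTm.addCost (.neg (.toCost (credTm n c))) (extract M)
  | _, n, .pack c M => .pair (.fst (extract M)) (.pair (credTm n c) (.snd (extract M)))
  | δ, n, .unpack k M N =>
      CTm.addCost (.scale k (.fst (extract M)))
        -- `‖N‖[π₁ ‖M‖_p / α, π₂ ‖M‖_p / x]`
        ((extract N).subst (Fin.append
          (extend (fun i => CTm.var (Fin.castAdd n i)) (.fst (.snd (extract M))))
          (extend (fun j => CTm.var (Fin.natAdd δ j)) (.snd (.snd (extract M))))))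

/-! ## The bounding relation -/

/-- `⊢_a M : A` for closed terms. -/
def Typed (a : ℕ∞) (M : Tm 0 0) (A : Ty 0) : Prop :=
  HasTy (Fin.elim0 : Fin 0 → Ty 0) (Res.bank a) M A

/-- The expression bounding relation `M ⊑^{A,a} E`, given the value bounding relation `V` at `A`.
The resource bank `a + r` of the value is required to be nonnegative. -/
def ExpBdd (A : Ty 0) (V : ℕ∞ → Tm 0 0 → CTm 0 → Prop) (a : ℕ∞) (M : Tm 0 0) (E : CTm 0) : Prop :=
  Typed a M A ∧ CTyped E (cpx A) ∧
    ∀ (m : ℕ) (r : ExtInt) (v : Tm 0 0), Eval M m r v →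
      CLeClosed (.const (ExtInt.ofInt m)) (.add (.fst E) (.const r.neg)) .cost ∧
      ∃ b : ℕ∞, ExtInt.ofENat b = ExtInt.ofENat a + r ∧ V b v (.snd E)

/-- The value bounding relation at type `nat`, by induction on the value. -/
inductive NatBdd : Tm 0 0 → CTm 0 → Prop
  | zero {E : CTm 0} : CLeClosed .zero E .nat → NatBdd .zero E
  | succ {v : Tm 0 0} {E E' : CTm 0} :
      CLeClosed (.succ E') E .nat → NatBdd v E' → NatBdd (.succ v) E

/-- The value bounding relation at a list type with elements of potential type `T` related by `V`,
by induction on the value. -/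
inductive ListBdd (T : CTy) (V : ℕ∞ → Tm 0 0 → CTm 0 → Prop) : ℕ∞ → Tm 0 0 → CTm 0 → Prop
  | nil {a : ℕ∞} {E : CTm 0} : CLeClosed .nil E (.list T) → ListBdd T V a .nil E
  | cons {a₁ a₂ : ℕ∞} {v₁ v₂ : Tm 0 0} {E E₁ E₂ : CTm 0} :
      CLeClosed (.cons E₁ E₂) E (.list T) → V a₁ v₁ E₁ → ListBdd T V a₂ v₂ E₂ →
      ListBdd T V (a₁ + a₂) (.cons v₁ v₂) E

/-- The value bounding relation `v ⊑_val^{A,a} E` on closed well-typed values and potentials, by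
recursion on the number of type constructors of `A` (which is the same for `B[ℓ/α]` and `B`). -/
def ValBdd (A : Ty 0) (a : ℕ∞) (v : Tm 0 0) (E : CTm 0) : Prop :=
  Typed a v A ∧ CTyped E (pot A) ∧
  match A with
  | .unit => v = .unit ∧ CLeClosed .unit E .unit
  | .tensor B C => ∃ (v₁ v₂ : Tm 0 0) (a₁ a₂ : ℕ∞), v = .pair v₁ v₂ ∧ a₁ + a₂ = a ∧
      ValBdd B a₁ v₁ (.fst E) ∧ ValBdd C a₂ v₂ (.snd E)
  | .plus B C =>
      (∃ (v' : Tm 0 0) (E' : CTm 0), v = .inl v' ∧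
        CLeClosed (.inl E') E (.sum (pot B) (pot C)) ∧ ValBdd B a v' E') ∨
      (∃ (v' : Tm 0 0) (E' : CTm 0), v = .inr v' ∧
        CLeClosed (.inr E') E (.sum (pot B) (pot C)) ∧ ValBdd C a v' E')
  | .amp B C => ∃ M N : Tm 0 0, v = .lazyPair M N ∧
      ExpBdd B (fun b w F => ValBdd B b w F) a M (.fst E) ∧
      ExpBdd C (fun b w F => ValBdd C b w F) a N (.snd E)
  | .lolli B C => ∃ M : Tm 0 1, v = .lam M ∧
      ∀ (d : ℕ∞) (w : Tm 0 0) (E' : CTm 0), ValBdd B d w E' →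
        ExpBdd C (fun b w F => ValBdd C b w F) (a + d) (M.inst w) (.app E E')
  | .bang k c B => ∃ (v' : Tm 0 0) (d : ℕ∞), v = .save k c v' ∧
      k.1 * d + (c.const : ℕ∞) ≤ a ∧ ValBdd B d v' E
  | .nat => NatBdd v E
  | .list B => ListBdd (pot B) (fun b w F => ValBdd B b w F) a v E
  | .ex B => ∃ (c : Cred 0) (v' : Tm 0 0), v = .pack c v' ∧
      CLeClosed (.credLit c.const) (.fst E) .cred ∧ ValBdd (B.inst c) a v' (.snd E)
termination_by A.size
decreasing_by all_goals simp only [Ty.size, Ty.size_inst]; omega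

/-- `ω ⊑^Δ Ω`: each credit amount is bounded by the corresponding closed term of type `$`. -/
def CredBdd {δ : ℕ} (w : Fin δ → ℕ) (W : Fin δ → CTm 0) : Prop :=
  ∀ i, CLeClosed (.credLit (w i)) (W i) .cred

/-- `θ ⊑_sub^{Γ,σ} Θ`. -/
def SubBdd {n : ℕ} (Γ : Fin n → Ty 0) (s : Fin n → ℕ∞) (t : Fin n → Tm 0 0) (T : Fin n → CTm 0) :
    Prop :=
  ∀ j, ValBdd (Γ j) (s j) (t j) (T j)

/-- Credit amounts as a closing credit substitution. -/
def closeCred {δ : ℕ} (w : Fin δ → ℕ) : Fin δ → Cred 0 := fun i => Cred.lit (w i)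

/-- The bounding relation `M ⊑^A E` for open terms `Δ | Γ ⊢_f M : A`. -/
def OpenBdd {δ n : ℕ} (Γ : Fin n → Ty δ) (f : Res δ n) (M : Tm δ n) (A : Ty δ) (E : CTm (δ + n)) :
    Prop :=
  ∀ (w : Fin δ → ℕ) (W : Fin δ → CTm 0), CredBdd w W →
  ∀ (s : Fin n → ℕ∞) (t : Fin n → Tm 0 0) (T : Fin n → CTm 0),
    SubBdd (fun j => (Γ j).subst (closeCred w)) s t T →
    ExpBdd (A.subst (closeCred w)) (ValBdd (A.subst (closeCred w))) (f.eval w s)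
      ((M.csubst (closeCred w)).subst t) (E.subst (Fin.append W T))

end Amortized

namespace Amortized

/-! ## Tuples -/

/-! The bounding relation is a logical relation between source terms and recurrences, and the
theorem is its fundamental lemma, by induction on the typing derivation (`HasTy.outcomeBdd`). An
evaluation is a sequence of stages. A stage of cost `m` and net credit `r` turns a bank `a` into `a
+ r`, and the next stage starts from there, so both costs and net credits add up. `Outcome.seq` is
this composition, and nearly every elimination form is an instance of it. A multiplicity `k` scales
the first stage (`CLeClosed.cost_scale`, `ExtInt.scale_resource_le`). This is sound because `m ≤ k
m` for `k ≥ 1` and `k (p + q) ≤ k p + k q`. Surplus credits and enlarged recurrences are absorbed by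
`ValBdd.mono`, and the typing components of the relation come from substitution lemmas for source
typing and for extraction.

The real obstacle is adding two cost bounds when a net credit is `∞`. Since `∞ + (-∞) = ∞`, negation
is not additive there. What saves the argument is that `m ≤ E + (-∞)` can hold only if `∞ ≤ E`, and
`∞` absorbs every further summand. But `≤` is a derivability relation, so this is a canonicity
statement (`CLeClosed.top_le`). To prove it, every closed cost term gets an interval `[l, u]` of
constants, `CTm.LogRel` is shown to be a sound model of the inequality judgment, and `l ≤ E` is
shown derivable. Intervals are needed because a reduct lies below its redex and not conversely:
reduction preserves lower bounds only, while negation exchanges lower and upper bounds.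

For the recursors an inner induction on the value is used (`NatBdd.nrec_bdd`, `ListBdd.lrec_bdd`).
The step function is saved with multiplicity `∞`, and `d + ∞ d = ∞ d`, so one unfolding can be paid
for without shrinking the bank left to the recursive call. -/

@[simp] theorem extend_castSucc {X : Type} {n : ℕ} (s : Fin n → X) (x : X) (i : Fin n) :
    extend s x i.castSucc = s i := by simp [extend]

@[simp] theorem extend_last {X : Type} {n : ℕ} (s : Fin n → X) (x : X) :
    extend s x (Fin.last n) = x := by simp [extend]

theorem comp_extend {X Y : Type} {n : ℕ} (g : X → Y) (s : Fin n → X) (x : X) :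
    (fun i => g (extend s x i)) = extend (fun i => g (s i)) (g x) := by
  funext i
  induction i using Fin.lastCases <;> simp

/-- Credit variables come first in a recurrence context, so binding a term variable extends the
whole context at its end. The lengths `m + (n + 1)` and `m + n + 1` agree only by unfolding, hence
the explicit length here and in later statements on extraction. -/
theorem append_extend {X : Type} {m n : ℕ} (w : Fin m → X) (s : Fin n → X) (x : X) :
    Fin.append w (extend s x) = extend (n := m + n) (Fin.append w s) x := by
  simp [extend, Fin.append_snoc]

/-! ## Arithmetic of extended integers -/

namespace ExtInt

theorem cases {P : ExtInt → Prop} (top : P ⊤) (bot : P negInf) (int : ∀ z, P (ofInt z)) (q : ExtInt) :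
    P q := by
  rcases q with _ | _ | z
  exacts [top, bot, int z]

@[simp] theorem neg_top : neg ⊤ = negInf := rfl
@[simp] theorem neg_negInf : neg negInf = ⊤ := rfl
@[simp] theorem neg_ofInt (z : ℤ) : neg (ofInt z) = ofInt (-z) := rfl
theorem ofInt_zero : ofInt 0 = 0 := rfl
@[simp] theorem neg_zero : neg 0 = 0 := rfl
@[simp] theorem ofInt_add (a b : ℤ) : ofInt a + ofInt b = ofInt (a + b) := rfl
@[simp] theorem negInf_add_negInf : negInf + negInf = negInf := rfl
@[simp] theorem negInf_add_ofInt (b : ℤ) : negInf + ofInt b = negInf := rfl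
@[simp] theorem ofInt_add_negInf (b : ℤ) : ofInt b + negInf = negInf := rfl
@[simp] theorem ofInt_le (a b : ℤ) : ofInt a ≤ ofInt b ↔ a ≤ b := by simp [ofInt]
@[simp] theorem ofInt_lt (a b : ℤ) : ofInt a < ofInt b ↔ a < b := by simp [ofInt]
@[simp] theorem ofInt_inj (a b : ℤ) : ofInt a = ofInt b ↔ a = b := by simp [ofInt]
@[simp] theorem negInf_le (q : ExtInt) : negInf ≤ q := by
  induction q using cases <;> simp [negInf, ofInt]
@[simp] theorem negInf_lt_ofInt (z : ℤ) : negInf < ofInt z :=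
  WithTop.coe_lt_coe.2 (WithBot.bot_lt_coe z)
@[simp] theorem not_lt_negInf (q : ExtInt) : ¬ q < negInf := not_lt.2 (negInf_le q)
@[simp] theorem le_negInf (q : ExtInt) : q ≤ negInf ↔ q = negInf :=
  ⟨fun h => le_antisymm h (negInf_le _), fun h => h.le⟩
@[simp] theorem ofInt_ne_negInf (z : ℤ) : ofInt z ≠ negInf := by simp [negInf, ofInt]
@[simp] theorem negInf_ne_ofInt (z : ℤ) : negInf ≠ ofInt z := by simp [negInf, ofInt]
@[simp] theorem ofInt_ne_top (z : ℤ) : ofInt z ≠ ⊤ := by simp [ofInt]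
@[simp] theorem top_ne_ofInt (z : ℤ) : ⊤ ≠ ofInt z := by simp [ofInt]
@[simp] theorem negInf_ne_top : negInf ≠ ⊤ := by simp [negInf]
@[simp] theorem ofInt_lt_top (z : ℤ) : ofInt z < ⊤ := by simp [ofInt]
@[simp] theorem ofENat_top : ofENat ⊤ = ⊤ := rfl
@[simp] theorem ofENat_natCast (n : ℕ) : ofENat (n : ℕ∞) = ofInt n := rfl
@[simp] theorem ofENat_zero : ofENat 0 = 0 := rfl

theorem neg_antitone {p q : ExtInt} (h : p ≤ q) : neg q ≤ neg p := by
  induction p using cases <;> induction q using cases <;> simp_all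

/-- False for `⊤` and `negInf`: the left side would be `negInf` and the right side `⊤`. This is the
gap that `CLeClosed.top_le` has to close. -/
theorem neg_add_of_ne_top {p q : ExtInt} (hp : p ≠ ⊤) (hq : q ≠ ⊤) :
    neg (p + q) = neg p + neg q := by
  induction p using cases <;> induction q using cases <;> simp_all
  omega

theorem nsmul_top (m : ℕ) : (m + 1) • (⊤ : ExtInt) = ⊤ := by
  rw [succ_nsmul, WithTop.add_top]

theorem nsmul_negInf (m : ℕ) : (m + 1) • negInf = negInf := by
  induction m with
  | zero => simp
  | succ m ih => rw [succ_nsmul, ih]; rfl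

theorem nsmul_ofInt (m : ℕ) (z : ℤ) : m • ofInt z = ofInt (m * z) := by
  induction m with
  | zero => simp [ofInt_zero]
  | succ m ih => rw [succ_nsmul, ih, ofInt_add]; push_cast; ring_nf

theorem Mult.cases {P : Mult → Prop} (inf : P .inf)
    (nat : ∀ m : ℕ, P ⟨((m + 1 : ℕ) : ℕ∞), by simp⟩) (k : Mult) : P k := by
  rcases k with ⟨_ | _ | m, h⟩
  · exact inf
  · exact absurd h (lt_irrefl _)
  · exact nat m

theorem scale_nat (m : ℕ) (q : ExtInt) : scale ((m : ℕ) : ℕ∞) q = m • q := by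
  simp [scale]

@[simp] theorem scale_inf (q : ExtInt) :
    scale Mult.inf.1 q = if q = 0 then 0 else if 0 < q then ⊤ else negInf := by
  simp [scale, Mult.inf]

@[simp] theorem scale_zero (k : ℕ∞) : scale k 0 = 0 := by simp [scale]

@[simp] theorem scale_top (k : Mult) : scale k.1 ⊤ = ⊤ := by
  induction k using Mult.cases with
  | inf => simp
  | nat m => rw [scale_nat, nsmul_top]

theorem neg_scale (k : Mult) (q : ExtInt) : neg (scale k.1 q) = scale k.1 (neg q) := by
  induction k using Mult.cases with
  | inf =>
    simp only [scale_inf, ← ofInt_zero]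
    induction q using cases with
    | top => simp
    | bot => simp
    | int z =>
      simp only [neg_ofInt, ofInt_inj, ofInt_lt]
      rcases lt_trichotomy z 0 with h | h | h
      · simp [h.ne, h.not_gt, h]
      · simp [h]
      · simp [h.ne', h, h.not_gt]
  | nat m =>
    simp only [scale_nat]
    induction q using cases with
    | top => simp [nsmul_top, nsmul_negInf]
    | bot => simp [nsmul_top, nsmul_negInf]
    | int z => simp [nsmul_ofInt]

theorem scale_mono (k : ℕ∞) {p q : ExtInt} (h : p ≤ q) : scale k p ≤ scale k q := by
  unfold scale
  split_ifs <;> first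
    | exact le_top
    | exact negInf_le _
    | exact le_rfl
    | exact nsmul_le_nsmul_right h _
    | (subst_vars; grind)

/-- An equality for finite `k`. For `k = ∞` it can be strict: with `p = 1` and `q = -2` the left
side is `-∞` and the right side `∞`. A positive summand makes the right side `⊤`; if both are
nonpositive, the sum vanishes only when both do. -/
theorem scale_add_le (k : Mult) (p q : ExtInt) :
    scale k.1 (p + q) ≤ scale k.1 p + scale k.1 q := by
  induction k using Mult.cases with
  | inf =>
    simp only [scale_inf]
    by_cases hp : 0 < p
    · simp [hp, hp.ne']
    by_cases hq : 0 < q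
    · simp [hq, hq.ne']
    simp only [hp, hq, if_false]
    push Not at hp hq
    rcases hp.eq_or_lt with rfl | hp
    · simp [hq.not_gt]
    have : p + q < 0 := by
      induction p using cases <;> induction q using cases <;> simp_all [← ofInt_zero]
      omega
    simp [this.ne, this.not_gt]
  | nat m => simp only [scale_nat, nsmul_add, le_refl]

theorem ofENat_add (a b : ℕ∞) : ofENat (a + b) = ofENat a + ofENat b := by
  induction a using ENat.recTopCoe with
  | top => simp
  | coe a =>
    induction b using ENat.recTopCoe with
    | top => simp
    | coe b => rw [← Nat.cast_add, ofENat_natCast]; simp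

theorem ofENat_le {a b : ℕ∞} : ofENat a ≤ ofENat b ↔ a ≤ b := by
  induction a using ENat.recTopCoe <;> induction b using ENat.recTopCoe <;> simp

theorem scale_ofENat (k : Mult) (b : ℕ∞) : scale k.1 (ofENat b) = ofENat (k.1 * b) := by
  induction k using Mult.cases with
  | inf =>
    rw [scale_inf]
    rcases eq_or_ne b 0 with rfl | hb
    · simp
    have h : 0 < ofENat b := by
      rw [← ofENat_zero]
      exact lt_of_le_not_ge (ofENat_le.2 bot_le) (fun h => hb (by simpa using ofENat_le.1 h))
    simp [h, h.ne', Mult.inf, hb]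
  | nat m =>
    rw [scale_nat]
    induction b using ENat.recTopCoe with
    | top => rw [ofENat_top, nsmul_top, ENat.mul_top (by simp)]; rfl
    | coe b => rw [← Nat.cast_mul, ofENat_natCast, ofENat_natCast, nsmul_ofInt]; simp

/-- Produces the banks of values: a net balance that dominates some bank is nonnegative, hence
itself a bank. -/
theorem exists_ofENat_of_le {a : ℕ∞} {q : ExtInt} (h : ofENat a ≤ q) :
    ∃ b, ofENat b = q ∧ a ≤ b := by
  induction q using cases with
  | top => exact ⟨⊤, rfl, le_top⟩
  | bot =>
    induction a using ENat.recTopCoe <;> simp at h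
  | int z =>
    have hz : 0 ≤ z := by
      rw [← ofInt_le, ofInt_zero, ← ofENat_zero]
      exact (ofENat_le.2 bot_le).trans h
    lift z to ℕ using hz
    exact ⟨z, rfl, ofENat_le.1 h⟩

end ExtInt

/-! ## Renaming and substitution in the recurrence language -/

namespace Tm

@[simp] theorem liftRen_castSucc {n m : ℕ} (r : Fin n → Fin m) (i : Fin n) :
    liftRen r i.castSucc = (r i).castSucc := by simp [liftRen]

@[simp] theorem liftRen_last {n m : ℕ} (r : Fin n → Fin m) :
    liftRen r (Fin.last n) = Fin.last m := by simp [liftRen]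

end Tm

namespace CTm

@[simp] theorem lift_castSucc {n m : ℕ} (t : Fin n → CTm m) (i : Fin n) :
    lift t i.castSucc = (t i).weaken := by simp [lift]

@[simp] theorem lift_last {n m : ℕ} (t : Fin n → CTm m) :
    lift t (Fin.last n) = var (Fin.last m) := by simp [lift]

theorem lift_var_comp {n m : ℕ} (r : Fin n → Fin m) :
    lift (fun i => var (r i)) = fun i => var (Tm.liftRen r i) := by
  funext i
  induction i using Fin.lastCases <;> simp [weaken, rename]

theorem rename_eq_subst {n : ℕ} (E : CTm n) :
    ∀ {m : ℕ} (r : Fin n → Fin m), E.rename r = E.subst (fun i => var (r i)) := by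
  induction E <;> intro m r <;> simp only [rename, subst, lift_var_comp, *]

theorem lift_comp_liftRen {n m l : ℕ} (t : Fin m → CTm l) (r : Fin n → Fin m) :
    (fun i => lift t (Tm.liftRen r i)) = lift (fun i => t (r i)) := by
  funext i
  induction i using Fin.lastCases <;> simp

/-- Composition laws come in the order renaming then substitution, substitution then renaming, two
substitutions. Each needs its predecessors under a binder, where a lifted substitution weakens, that
is renames, its entries. -/
theorem subst_rename {n : ℕ} (E : CTm n) :
    ∀ {m l : ℕ} (r : Fin n → Fin m) (t : Fin m → CTm l),
      (E.rename r).subst t = E.subst (fun i => t (r i)) := by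
  induction E <;> intro m l r t <;> simp only [rename, subst, lift_comp_liftRen, *]

theorem weaken_rename {n m : ℕ} (E : CTm n) (r : Fin n → Fin m) :
    (E.rename r).weaken = E.weaken.rename (Tm.liftRen r) := by
  simp [weaken, rename_eq_subst _ r, rename_eq_subst _ (Tm.liftRen r), subst_rename]
  rw [rename_eq_subst, ← rename_eq_subst E r, subst_rename]

theorem lift_rename {n m l : ℕ} (t : Fin n → CTm m) (r : Fin m → Fin l) :
    (fun i => (lift t i).rename (Tm.liftRen r)) = lift (fun i => (t i).rename r) := by
  funext i
  induction i using Fin.lastCases <;> simp [weaken_rename, rename]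

theorem rename_subst {n : ℕ} (E : CTm n) :
    ∀ {m l : ℕ} (t : Fin n → CTm m) (r : Fin m → Fin l),
      (E.subst t).rename r = E.subst (fun i => (t i).rename r) := by
  induction E <;> intro m l t r <;> simp only [rename, subst, lift_rename, *]

theorem weaken_subst_lift {n m : ℕ} (E : CTm n) (t : Fin n → CTm m) :
    E.weaken.subst (lift t) = (E.subst t).weaken := by
  simp [weaken, subst_rename, rename_subst]

theorem lift_subst {n m l : ℕ} (t : Fin n → CTm m) (u : Fin m → CTm l) :
    (fun i => (lift t i).subst (lift u)) = lift (fun i => (t i).subst u) := by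
  funext i
  induction i using Fin.lastCases <;> simp [weaken_subst_lift, subst]

theorem subst_subst {n : ℕ} (E : CTm n) :
    ∀ {m l : ℕ} (t : Fin n → CTm m) (u : Fin m → CTm l),
      (E.subst t).subst u = E.subst (fun i => (t i).subst u) := by
  induction E <;> intro m l t u <;> simp only [subst, lift_subst, *]

theorem lift_var {n : ℕ} : lift (var : Fin n → CTm n) = var := by
  funext i
  induction i using Fin.lastCases <;> simp [weaken, rename]

@[simp] theorem subst_var {n : ℕ} (E : CTm n) : E.subst var = E := by
  induction E <;> simp only [subst, lift_var, *]

@[simp] theorem weaken_inst {n : ℕ} (E F : CTm n) : E.weaken.inst F = E := by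
  simp [weaken, inst, subst_rename]

theorem weaken_subst_extend {n m : ℕ} (E : CTm n) (t : Fin n → CTm m) (F : CTm m) :
    E.weaken.subst (extend t F) = E.subst t := by
  simp [weaken, subst_rename]

theorem inst_subst_lift {n m : ℕ} (E : CTm (n + 1)) (t : Fin n → CTm m) (F : CTm m) :
    (E.subst (lift t)).inst F = E.subst (extend t F) := by
  rw [inst, subst_subst]
  congr 1
  funext i
  induction i using Fin.lastCases <;> simp [subst, weaken_subst_extend]

theorem subst_inst {n m : ℕ} (E : CTm (n + 1)) (F : CTm n) (t : Fin n → CTm m) :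
    (E.inst F).subst t = E.subst (extend t (F.subst t)) := by
  rw [inst, subst_subst, comp_extend]
  rfl

theorem subst_inst₂ {n m : ℕ} (E : CTm (n + 2)) (F G : CTm n) (t : Fin n → CTm m) :
    (E.inst₂ F G).subst t = E.subst (extend (extend t (F.subst t)) (G.subst t)) := by
  rw [inst₂, subst_subst, comp_extend, comp_extend]
  rfl

theorem subst_credMul {n m : ℕ} (k : ℕ) (E : CTm n) (t : Fin n → CTm m) :
    (credMul k E).subst t = credMul k (E.subst t) := by
  induction k <;> simp_all [credMul, subst]

end CTm

/-! ## Typing of the recurrence language -/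

theorem CHasTy.rename {n : ℕ} {Γ : Fin n → CTy} {E : CTm n} {T : CTy} (h : CHasTy Γ E T) :
    ∀ {m : ℕ} {Γ' : Fin m → CTy} (r : Fin n → Fin m), (∀ i, Γ' (r i) = Γ i) →
      CHasTy Γ' (E.rename r) T := by
  have key : ∀ {n m : ℕ} {Γ : Fin n → CTy} {Γ' : Fin m → CTy} {r : Fin n → Fin m} (S : CTy),
      (∀ i, Γ' (r i) = Γ i) → ∀ i, extend Γ' S (Tm.liftRen r i) = extend Γ S i := by
    intro n m Γ Γ' r S h i
    induction i using Fin.lastCases <;> simp [h]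
  induction h with
  | var i => intro m Γ' r hr; rw [← hr]; exact .var _
  | caseOf _ _ _ ih ih₁ ih₂ =>
    intro m Γ' r hr; exact .caseOf (ih r hr) (ih₁ _ (key _ hr)) (ih₂ _ (key _ hr))
  | lam _ ih => intro m Γ' r hr; exact .lam (ih _ (key _ hr))
  | _ => intro m Γ' r hr; constructor <;> solve_by_elim

theorem CHasTy.weaken {n : ℕ} {Γ : Fin n → CTy} {E : CTm n} {S T : CTy} (h : CHasTy Γ E T) :
    CHasTy (extend Γ S) E.weaken T :=
  h.rename _ (fun i => by simp)

theorem CHasTy.lift {n m : ℕ} {Γ : Fin n → CTy} {Γ' : Fin m → CTy} {t : Fin n → CTm m} (S : CTy)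
    (h : ∀ i, CHasTy Γ' (t i) (Γ i)) (i : Fin (n + 1)) :
    CHasTy (extend Γ' S) (CTm.lift t i) (extend Γ S i) := by
  induction i using Fin.lastCases with
  | cast i => simpa using (h i).weaken
  | last => simpa using CHasTy.var (Γ := extend Γ' S) (Fin.last m)

theorem CHasTy.subst {n : ℕ} {Γ : Fin n → CTy} {E : CTm n} {T : CTy} (h : CHasTy Γ E T) :
    ∀ {m : ℕ} {Γ' : Fin m → CTy} (t : Fin n → CTm m), (∀ i, CHasTy Γ' (t i) (Γ i)) →
      CHasTy Γ' (E.subst t) T := by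
  induction h with
  | var i => intro m Γ' t ht; exact ht i
  | caseOf _ _ _ ih ih₁ ih₂ =>
    intro m Γ' t ht; exact .caseOf (ih t ht) (ih₁ _ (.lift _ ht)) (ih₂ _ (.lift _ ht))
  | lam _ ih => intro m Γ' t ht; exact .lam (ih _ (.lift _ ht))
  | _ => intro m Γ' t ht; constructor <;> solve_by_elim

theorem CHasTy.extend {n m : ℕ} {Γ : Fin n → CTy} {Γ' : Fin m → CTy} {t : Fin n → CTm m} {F : CTm m}
    {S : CTy} (ht : ∀ i, CHasTy Γ' (t i) (Γ i)) (hF : CHasTy Γ' F S) (i : Fin (n + 1)) :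
    CHasTy Γ' (Amortized.extend t F i) (Amortized.extend Γ S i) := by
  induction i using Fin.lastCases <;> simp [ht, hF]

theorem CHasTy.inst {n : ℕ} {Γ : Fin n → CTy} {E : CTm (n + 1)} {F : CTm n} {S T : CTy}
    (h : CHasTy (Amortized.extend Γ S) E T) (hF : CHasTy Γ F S) : CHasTy Γ (E.inst F) T :=
  h.subst _ (CHasTy.extend CHasTy.var hF)

theorem CHasTy.addCost {n : ℕ} {Γ : Fin n → CTy} {E F : CTm n} {T : CTy} (hE : CHasTy Γ E .cost)
    (hF : CHasTy Γ F (.prod .cost T)) : CHasTy Γ (E.addCost F) (.prod .cost T) :=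
  .pair (.add hE hF.fst) hF.snd

theorem CHasTy.credMul {n : ℕ} {Γ : Fin n → CTy} {E : CTm n} (h : CHasTy Γ E .cred) (k : ℕ) :
    CHasTy Γ (CTm.credMul k E) .cred := by
  induction k with
  | zero => exact .credLit 0
  | succ k ih => exact .credAdd h ih

/-- Allows typings to be recovered from derived inequalities instead of being carried along. -/
theorem CLe.typed {n : ℕ} {Γ : Fin n → CTy} {E F : CTm n} {T : CTy} (h : CLe Γ E F T) :
    CHasTy Γ E T ∧ CHasTy Γ F T := by
  induction h with
  | refl h => exact ⟨h, h⟩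
  | trans _ _ h h' => exact ⟨h.1, h'.2⟩
  | betaInl h h₁ h₂ => exact ⟨h₁.inst h, .caseOf h.inl h₁ h₂⟩
  | betaInr h h₁ h₂ => exact ⟨h₂.inst h, .caseOf h.inr h₁ h₂⟩
  | betaLam h h' => exact ⟨h.inst h', .app h.lam h'⟩
  | betaZero h₁ h₂ => exact ⟨.app h₁ .unit, .nrec .zero h₁ h₂⟩
  | betaNil h₁ h₂ => exact ⟨.app h₁ .unit, .lrec .nil h₁ h₂⟩
  | betaSucc h h₁ h₂ => exact ⟨.app h₂ (.pair h (.nrec h h₁ h₂)), .nrec h.succ h₁ h₂⟩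
  | betaCons h h' h₁ h₂ =>
    exact ⟨.app h₂ (.pair h (.pair h' (.lrec h' h₁ h₂))), .lrec (.cons h h') h₁ h₂⟩
  | fst _ ih => exact ⟨ih.1.fst, ih.2.fst⟩
  | snd _ ih => exact ⟨ih.1.snd, ih.2.snd⟩
  | caseOf _ h₁ h₂ ih => exact ⟨.caseOf ih.1 h₁ h₂, .caseOf ih.2 h₁ h₂⟩
  | app _ h ih => exact ⟨.app ih.1 h, .app ih.2 h⟩
  | nrec _ h₁ h₂ ih => exact ⟨.nrec ih.1 h₁ h₂, .nrec ih.2 h₁ h₂⟩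
  | lrec _ h₁ h₂ ih => exact ⟨.lrec ih.1 h₁ h₂, .lrec ih.2 h₁ h₂⟩
  | betaFst h h' => exact ⟨h, .fst (.pair h h')⟩
  | betaSnd h h' => exact ⟨h', .snd (.pair h h')⟩
  | credSymm _ ih => exact ih.symm
  | _ => constructor <;> (repeat first | assumption | (apply And.left; assumption) | (apply And.right; assumption) | constructor)

/-! ## Canonicity of the recurrence language -/

namespace CTm

/-- Weak head reduction. -/
inductive Step : {n : ℕ} → CTm n → CTm n → Prop
  | fst {n : ℕ} {E E' : CTm n} : Step E E' → Step (.fst E) (.fst E')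
  | snd {n : ℕ} {E E' : CTm n} : Step E E' → Step (.snd E) (.snd E')
  | caseOf {n : ℕ} {E E' : CTm n} {F₁ F₂ : CTm (n + 1)} :
      Step E E' → Step (.caseOf E F₁ F₂) (.caseOf E' F₁ F₂)
  | app {n : ℕ} {E E' F : CTm n} : Step E E' → Step (.app E F) (.app E' F)
  | nrec {n : ℕ} {E E' F₁ F₂ : CTm n} : Step E E' → Step (.nrec E F₁ F₂) (.nrec E' F₁ F₂)
  | lrec {n : ℕ} {E E' F₁ F₂ : CTm n} : Step E E' → Step (.lrec E F₁ F₂) (.lrec E' F₁ F₂)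
  | betaFst {n : ℕ} {E F : CTm n} : Step (.fst (.pair E F)) E
  | betaSnd {n : ℕ} {E F : CTm n} : Step (.snd (.pair E F)) F
  | betaInl {n : ℕ} {E : CTm n} {F₁ F₂ : CTm (n + 1)} :
      Step (.caseOf (.inl E) F₁ F₂) (F₁.inst E)
  | betaInr {n : ℕ} {E : CTm n} {F₁ F₂ : CTm (n + 1)} :
      Step (.caseOf (.inr E) F₁ F₂) (F₂.inst E)
  | betaLam {n : ℕ} {E : CTm (n + 1)} {F : CTm n} : Step (.app (.lam E) F) (E.inst F)
  | betaZero {n : ℕ} {F₁ F₂ : CTm n} : Step (.nrec .zero F₁ F₂) (.app F₁ .unit)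
  | betaSucc {n : ℕ} {E F₁ F₂ : CTm n} :
      Step (.nrec (.succ E) F₁ F₂) (.app F₂ (.pair E (.nrec E F₁ F₂)))
  | betaNil {n : ℕ} {F₁ F₂ : CTm n} : Step (.lrec .nil F₁ F₂) (.app F₁ .unit)
  | betaCons {n : ℕ} {E E' F₁ F₂ : CTm n} :
      Step (.lrec (.cons E E') F₁ F₂) (.app F₂ (.pair E (.pair E' (.lrec E' F₁ F₂))))

/-- Underlies the uniqueness of canonical forms, credit values and cost intervals, without which the
logical relation would not be transitive. -/
theorem Step.deterministic {n : ℕ} {E F G : CTm n} (h : Step E F) : Step E G → F = G := by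
  induction h generalizing G with
  | betaFst | betaSnd | betaInl | betaInr | betaLam | betaZero | betaSucc | betaNil | betaCons =>
    intro h'
    cases h' <;> first | rfl | (rename_i h; cases h)
  | fst h ih | snd h ih | caseOf h ih | app h ih | nrec h ih | lrec h ih =>
    intro h'
    cases h' <;> rename_i h' <;> first | rw [ih h'] | cases h

/-- Weak head reduction takes place only in principal positions of eliminators, exactly where the
inequality judgment is a congruence. -/
theorem Step.le {n : ℕ} {E E' : CTm n} (h : Step E E') :
    ∀ {Γ : Fin n → CTy} {T : CTy}, CHasTy Γ E T → CLe Γ E' E T := by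
  induction h with
  | fst _ ih => intro Γ T h; cases h with | fst h => exact .fst (ih h)
  | snd _ ih => intro Γ T h; cases h with | snd h => exact .snd (ih h)
  | caseOf _ ih => intro Γ T h; cases h with | caseOf h h₁ h₂ => exact .caseOf (ih h) h₁ h₂
  | app _ ih => intro Γ T h; cases h with | app h h₁ => exact .app (ih h) h₁
  | nrec _ ih => intro Γ T h; cases h with | nrec h h₁ h₂ => exact .nrec (ih h) h₁ h₂
  | lrec _ ih => intro Γ T h; cases h with | lrec h h₁ h₂ => exact .lrec (ih h) h₁ h₂
  | betaFst => intro Γ T h; cases h with | fst h => cases h with | pair h h' => exact .betaFst h h'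
  | betaSnd => intro Γ T h; cases h with | snd h => cases h with | pair h h' => exact .betaSnd h h'
  | betaInl =>
    intro Γ T h; cases h with | caseOf h h₁ h₂ => cases h with | inl h => exact .betaInl h h₁ h₂
  | betaInr =>
    intro Γ T h; cases h with | caseOf h h₁ h₂ => cases h with | inr h => exact .betaInr h h₁ h₂
  | betaLam => intro Γ T h; cases h with | app h h' => cases h with | lam h => exact .betaLam h h'
  | betaZero => intro Γ T h; cases h with | nrec h h₁ h₂ => exact .betaZero h₁ h₂
  | betaSucc =>
    intro Γ T h; cases h with | nrec h h₁ h₂ => cases h with | succ h => exact .betaSucc h h₁ h₂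
  | betaNil => intro Γ T h; cases h with | lrec h h₁ h₂ => exact .betaNil h₁ h₂
  | betaCons =>
    intro Γ T h
    cases h with | lrec h h₁ h₂ => cases h with | cons h h' => exact .betaCons h h' h₁ h₂

/-- Reflexive-transitive closure of weak head reduction. -/
abbrev Steps (E F : CTm 0) : Prop := Relation.ReflTransGen Step E F

/-- Transitive closure of weak head reduction. -/
abbrev Steps₁ (E F : CTm 0) : Prop := Relation.TransGen Step E F

theorem Steps.map {f : CTm 0 → CTm 0} (hf : ∀ {E F}, Step E F → Step (f E) (f F)) {E F : CTm 0}
    (h : Steps E F) : Steps (f E) (f F) :=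
  Relation.ReflTransGen.lift f (fun _ _ => hf) _ _ h

theorem Steps₁.map {f : CTm 0 → CTm 0} (hf : ∀ {E F}, Step E F → Step (f E) (f F)) {E F : CTm 0}
    (h : Steps₁ E F) : Steps₁ (f E) (f F) :=
  Relation.TransGen.lift f (fun _ _ => hf) _ _ h

theorem Steps.unique {E V W : CTm 0} (hV : Steps E V) (hW : Steps E W) (nV : ∀ F, ¬ Step V F)
    (nW : ∀ F, ¬ Step W F) : V = W := by
  induction hV using Relation.ReflTransGen.head_induction_on with
  | refl =>
    rcases hW.cases_head with h | ⟨_, h, _⟩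
    exacts [h, absurd h (nV _)]
  | head h _ ih =>
    rcases hW.cases_head with rfl | ⟨_, h', hW⟩
    · exact absurd h (nW _)
    · exact ih (h.deterministic h' ▸ hW)

/-- The value of a closed credit expression. -/
inductive CredVal : CTm 0 → ℕ → Prop
  | credLit (m : ℕ) : CredVal (.credLit m) m
  | credAdd {E F : CTm 0} {m m' : ℕ} :
      CredVal E m → CredVal F m' → CredVal (.credAdd E F) (m + m')
  | step {E E' : CTm 0} {m : ℕ} : Step E E' → CredVal E' m → CredVal E m

/-- The greatest lower bound and the least upper bound of a closed cost expression among cost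
constants, where the upper bound `⊤` stands for the absence of information. -/
inductive CostVal : CTm 0 → ExtInt → ExtInt → Prop
  | const (q : ExtInt) : CostVal (.const q) q q
  | add {E F : CTm 0} {l u l' u' : ExtInt} :
      CostVal E l u → CostVal F l' u' → CostVal (.add E F) (l + l') (u + u')
  | neg {E : CTm 0} {l u : ExtInt} : CostVal E l u → CostVal (.neg E) u.neg l.neg
  | scale {E : CTm 0} {l u : ExtInt} (k : Mult) :
      CostVal E l u → CostVal (.scale k E) (ExtInt.scale k.1 l) (ExtInt.scale k.1 u)
  | toCost {E : CTm 0} {m : ℕ} :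
      CredVal E m → CostVal (.toCost E) (ExtInt.ofInt m) (ExtInt.ofInt m)
  | step {E E' : CTm 0} {l u : ExtInt} : Step E E' → CostVal E' l u → CostVal E l ⊤

theorem CredVal.unique {E : CTm 0} {m m' : ℕ} (h : CredVal E m) : CredVal E m' → m = m' := by
  induction h generalizing m' with
  | credLit => intro h'; cases h' with | credLit => rfl | step h => cases h
  | credAdd _ _ ih ih' =>
    intro h'; cases h' with | credAdd h h' => rw [ih h, ih' h'] | step h => cases h
  | step h _ ih =>
    intro h'
    cases h' with
    | step h' hE => exact ih (h.deterministic h' ▸ hE)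
    | _ => cases h

/-- Cost operators do not reduce and a reducible term has no other rule, so the head of the term
determines the last rule of the derivation. -/
theorem CostVal.unique {E : CTm 0} {l u l' u' : ExtInt} (h : CostVal E l u) :
    CostVal E l' u' → l = l' ∧ u = u' := by
  induction h generalizing l' u' with
  | const => intro h'; cases h' with | const => exact ⟨rfl, rfl⟩ | step h => cases h
  | add _ _ ih ih' =>
    intro h'
    cases h' with
    | add h h' => rw [(ih h).1, (ih h).2, (ih' h').1, (ih' h').2]; exact ⟨rfl, rfl⟩
    | step h => cases h
  | neg _ ih =>
    intro h'
    cases h' with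
    | neg h => rw [(ih h).1, (ih h).2]; exact ⟨rfl, rfl⟩
    | step h => cases h
  | scale _ _ ih =>
    intro h'
    cases h' with
    | scale _ h => rw [(ih h).1, (ih h).2]; exact ⟨rfl, rfl⟩
    | step h => cases h
  | toCost hE =>
    intro h'
    cases h' with
    | toCost h => rw [hE.unique h]; exact ⟨rfl, rfl⟩
    | step h => cases h
  | step h _ ih =>
    intro h'
    cases h' with
    | step h' hE => exact ⟨(ih (h.deterministic h' ▸ hE)).1, rfl⟩
    | _ => cases h

theorem CredVal.le {E : CTm 0} {m : ℕ} (h : CredVal E m) :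
    CTyped E .cred → CLeClosed (.credLit m) E .cred := by
  induction h with
  | credLit m => exact fun _ => .refl (.credLit m)
  | credAdd _ _ ih ih' =>
    intro h
    cases h with | credAdd h h' => exact (CLe.credAddLit _ _).credSymm.trans (.credAdd (ih h) (ih' h'))
  | step h _ ih => exact fun hE => (ih (h.le hE).typed.1).trans (h.le hE)

/-- The endpoints are bounds in the judgment itself, which is what carries semantic information back
to derivability. The upper bound is conditional because the judgment has no law placing an arbitrary
cost below `∞`. -/
theorem CostVal.le {E : CTm 0} {l u : ExtInt} (h : CostVal E l u) :
    CTyped E .cost → CLeClosed (.const l) E .cost ∧ (u = ⊤ ∨ CLeClosed E (.const u) .cost) := by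
  induction h with
  | const q => exact fun h => ⟨.refl h, .inr (.refl h)⟩
  | add _ _ ih ih' =>
    intro h
    cases h with
    | add h h' =>
      obtain ⟨h₁, h₂⟩ := ih h
      obtain ⟨h₁', h₂'⟩ := ih' h'
      refine ⟨(CLe.constAdd _ _).trans (h₁.add h₁'), ?_⟩
      rcases h₂ with rfl | h₂
      · simp
      rcases h₂' with rfl | h₂'
      · simp
      exact .inr ((h₂.add h₂').trans (.addConst _ _))
  | neg _ ih =>
    intro h
    cases h with
    | neg h =>
      obtain ⟨h₁, h₂⟩ := ih h
      refine ⟨?_, .inr (h₁.neg.trans (.negConst _))⟩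
      -- If nothing is known above `E`, the lower endpoint of its negation is `-∞`, which lies below
      -- every cost.
      rcases h₂ with rfl | h₂
      · exact .botLe h.neg
      · exact (CLe.constNeg _).trans h₂.neg
  | scale k _ ih =>
    intro h
    cases h with
    | scale _ h =>
      obtain ⟨h₁, h₂⟩ := ih h
      refine ⟨(CLe.constScale _ _).trans (h₁.scale k), ?_⟩
      rcases h₂ with rfl | h₂
      · simp
      · exact .inr ((h₂.scale k).trans (.scaleConst _ _))
  | toCost hE =>
    intro h
    cases h with
    | toCost h =>
      exact ⟨(CLe.litToCost _).trans (hE.le h).toCost,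
        .inr ((hE.le h).credSymm.toCost.trans (.toCostLit _))⟩
  | step h _ ih => exact fun hE => ⟨(ih (h.le hE).typed.1).1.trans (h.le hE), .inl rfl⟩

/-- Closed terms of type `nat` with the same canonical form. -/
inductive NatRel : CTm 0 → CTm 0 → Prop
  | zero {E F : CTm 0} : Steps E .zero → Steps F .zero → NatRel E F
  | succ {E F G : CTm 0} : Steps E (.succ G) → Steps F (.succ G) → NatRel G G → NatRel E F

/-- Closed terms of a list type with the same canonical form. -/
inductive ListRel (R : CTm 0 → CTm 0 → Prop) : CTm 0 → CTm 0 → Prop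
  | nil {E F : CTm 0} : Steps E .nil → Steps F .nil → ListRel R E F
  | cons {E F G H : CTm 0} : Steps E (.cons G H) → Steps F (.cons G H) → R G G →
      ListRel R H H → ListRel R E F

/-- The logical relation that interprets the inequality judgment on closed terms. -/
def LogRel : CTy → CTm 0 → CTm 0 → Prop
  | .cost, E, F => ∃ l u l' u', CostVal E l u ∧ CostVal F l' u' ∧ l ≤ l' ∧ u ≤ u'
  | .cred, E, F => ∃ m, CredVal E m ∧ CredVal F m
  | .unit, _, _ => True
  | .nat, E, F => NatRel E F
  | .prod S T, E, F => LogRel S (.fst E) (.fst F) ∧ LogRel T (.snd E) (.snd F)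
  | .sum S T, E, F => ∃ G, (Steps E (.inl G) ∧ Steps F (.inl G) ∧ LogRel S G G) ∨
      (Steps E (.inr G) ∧ Steps F (.inr G) ∧ LogRel T G G)
  | .arr S T, E, F => ∀ G, LogRel S G G → LogRel T (.app E G) (.app F G)
  | .list S, E, F => ListRel (LogRel S) E F

/-- Uniqueness of the interval, credit value or canonical form of the middle term identifies its two
witnesses. -/
theorem LogRel.trans : ∀ {T : CTy} {E F G : CTm 0}, LogRel T E F → LogRel T F G → LogRel T E G
  | .cost, _, _, _, ⟨l, u, _, _, h₁, h₂, hl, hu⟩, ⟨_, _, l', u', h₃, h₄, hl', hu'⟩ => by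
    obtain ⟨rfl, rfl⟩ := h₂.unique h₃
    exact ⟨l, u, l', u', h₁, h₄, hl.trans hl', hu.trans hu'⟩
  | .cred, _, _, _, ⟨m, h₁, h₂⟩, ⟨_, h₃, h₄⟩ => ⟨m, h₁, h₂.unique h₃ ▸ h₄⟩
  | .unit, _, _, _, _, _ => trivial
  | .prod _ _, _, _, _, ⟨h₁, h₂⟩, ⟨h₁', h₂'⟩ => ⟨h₁.trans h₁', h₂.trans h₂'⟩
  | .arr _ _, _, _, _, h, h' => fun G hG => (h G hG).trans (h' G hG)
  | .nat, _, _, _, h, h' => by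
    rcases h with ⟨h₁, h₂⟩ | ⟨h₁, h₂, hG⟩ <;> rcases h' with ⟨h₁', h₂'⟩ | ⟨h₁', h₂', hG'⟩ <;>
      cases h₂.unique h₁' nofun nofun
    exacts [.zero h₁ h₂', .succ h₁ h₂' hG]
  | .list _, _, _, _, h, h' => by
    rcases h with ⟨h₁, h₂⟩ | ⟨h₁, h₂, hG, hH⟩ <;>
      rcases h' with ⟨h₁', h₂'⟩ | ⟨h₁', h₂', hG', hH'⟩ <;> cases h₂.unique h₁' nofun nofun
    exacts [.nil h₁ h₂', .cons h₁ h₂' hG hH]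
  | .sum _ _, _, _, _, ⟨G, h⟩, ⟨_, h'⟩ => by
    rcases h with ⟨h₁, h₂, hG⟩ | ⟨h₁, h₂, hG⟩ <;> rcases h' with ⟨h₁', h₂', hG'⟩ | ⟨h₁', h₂', hG'⟩ <;>
      cases h₂.unique h₁' nofun nofun
    exacts [⟨G, .inl ⟨h₁, h₂', hG⟩⟩, ⟨G, .inr ⟨h₁, h₂', hG⟩⟩]

/-- This mirrors the rule that a reduct is below its redex. Expansion resets the upper endpoint to
`⊤`, which is harmless on the larger side but would break `u ≤ u'` on the smaller one. -/
theorem LogRel.expand_right : ∀ {T : CTy} {E F F' : CTm 0}, LogRel T E F' → Step F F' → LogRel T E F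
  | .cost, _, _, _, ⟨l, u, l', _, h₁, h₂, hl, _⟩, h =>
    ⟨l, u, l', ⊤, h₁, .step h h₂, hl, le_top⟩
  | .cred, _, _, _, ⟨m, h₁, h₂⟩, h => ⟨m, h₁, .step h h₂⟩
  | .unit, _, _, _, _, _ => trivial
  | .prod _ _, _, _, _, ⟨h₁, h₂⟩, h => ⟨h₁.expand_right (.fst h), h₂.expand_right (.snd h)⟩
  | .arr _ _, _, _, _, h', h => fun G hG => (h' G hG).expand_right (.app h)
  | .nat, _, _, _, h', h => by
    rcases h' with ⟨h₁, h₂⟩ | ⟨h₁, h₂, hG⟩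
    exacts [.zero h₁ (.head h h₂), .succ h₁ (.head h h₂) hG]
  | .list _, _, _, _, h', h => by
    rcases h' with ⟨h₁, h₂⟩ | ⟨h₁, h₂, hG, hH⟩
    exacts [.nil h₁ (.head h h₂), .cons h₁ (.head h h₂) hG hH]
  | .sum _ _, _, _, _, ⟨G, h'⟩, h => by
    rcases h' with ⟨h₁, h₂, hG⟩ | ⟨h₁, h₂, hG⟩
    exacts [⟨G, .inl ⟨h₁, .head h h₂, hG⟩⟩, ⟨G, .inr ⟨h₁, .head h h₂, hG⟩⟩]

theorem CostVal.expand {E E' : CTm 0} {l u : ExtInt} (h : Steps₁ E E') (hE : CostVal E' l u) :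
    CostVal E l ⊤ := by
  induction h using Relation.TransGen.head_induction_on with
  | single h => exact .step h hE
  | head h _ ih => exact .step h ih

theorem CredVal.expand {E E' : CTm 0} {m : ℕ} (h : Steps₁ E E') (hE : CredVal E' m) :
    CredVal E m := by
  induction h using Relation.TransGen.head_induction_on with
  | single h => exact .step h hE
  | head h _ ih => exact .step h ih

/-- At least one step is required on each side, so that both upper endpoints become `⊤`. If the
right term took no step, its endpoint could remain finite while the left one is already `⊤`. -/
theorem LogRel.expand : ∀ {T : CTy} {E E' F F' : CTm 0}, LogRel T E' F' → Steps₁ E E' → Steps₁ F F' →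
    LogRel T E F
  | .cost, _, _, _, _, ⟨l, _, l', _, h₁, h₂, hl, _⟩, hE, hF =>
    ⟨l, ⊤, l', ⊤, h₁.expand hE, h₂.expand hF, hl, le_rfl⟩
  | .cred, _, _, _, _, ⟨m, h₁, h₂⟩, hE, hF => ⟨m, h₁.expand hE, h₂.expand hF⟩
  | .unit, _, _, _, _, _, _, _ => trivial
  | .prod _ _, _, _, _, _, ⟨h₁, h₂⟩, hE, hF =>
    ⟨h₁.expand (Steps₁.map .fst hE) (Steps₁.map .fst hF),
      h₂.expand (Steps₁.map .snd hE) (Steps₁.map .snd hF)⟩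
  | .arr _ _, _, _, _, _, h', hE, hF => fun G hG =>
    (h' G hG).expand (Steps₁.map (f := (app · G)) .app hE)
      (Steps₁.map (f := (app · G)) .app hF)
  | .nat, _, _, _, _, h', hE, hF => by
    rcases h' with ⟨h₁, h₂⟩ | ⟨h₁, h₂, hG⟩
    exacts [.zero (hE.to_reflTransGen.trans h₁) (hF.to_reflTransGen.trans h₂),
      .succ (hE.to_reflTransGen.trans h₁) (hF.to_reflTransGen.trans h₂) hG]
  | .list _, _, _, _, _, h', hE, hF => by
    rcases h' with ⟨h₁, h₂⟩ | ⟨h₁, h₂, hG, hH⟩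
    exacts [.nil (hE.to_reflTransGen.trans h₁) (hF.to_reflTransGen.trans h₂),
      .cons (hE.to_reflTransGen.trans h₁) (hF.to_reflTransGen.trans h₂) hG hH]
  | .sum _ _, _, _, _, _, ⟨G, h'⟩, hE, hF => by
    rcases h' with ⟨h₁, h₂, hG⟩ | ⟨h₁, h₂, hG⟩
    exacts [⟨G, .inl ⟨hE.to_reflTransGen.trans h₁, hF.to_reflTransGen.trans h₂, hG⟩⟩,
      ⟨G, .inr ⟨hE.to_reflTransGen.trans h₁, hF.to_reflTransGen.trans h₂, hG⟩⟩]

theorem LogRel.expand_step {T : CTy} {E F : CTm 0} (h : LogRel T F F) (hE : Step E F) :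
    LogRel T E E :=
  h.expand (.single hE) (.single hE)

theorem LogRel.pair {S T : CTy} {E F : CTm 0} (hE : LogRel S E E) (hF : LogRel T F F) :
    LogRel (.prod S T) (.pair E F) (.pair E F) :=
  ⟨hE.expand_step .betaFst, hF.expand_step .betaSnd⟩

/-- Related scrutinees have literally the same canonical form, so both sides reach the same instance
of the same branch. Self-relatedness of the branches therefore suffices. The closing `β` step makes
each reduction nonempty, as `LogRel.expand` demands; the recursors below follow the same pattern. -/
theorem LogRel.caseOf {S T U : CTy} {E E' : CTm 0} {F₁ F₂ : CTm 1} (h : LogRel (.sum S T) E E')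
    (h₁ : ∀ G, LogRel S G G → LogRel U (F₁.inst G) (F₁.inst G))
    (h₂ : ∀ G, LogRel T G G → LogRel U (F₂.inst G) (F₂.inst G)) :
    LogRel U (.caseOf E F₁ F₂) (.caseOf E' F₁ F₂) := by
  have key {E V : CTm 0} (h : Steps E V) : Steps (.caseOf E F₁ F₂) (.caseOf V F₁ F₂) :=
    Steps.map (f := (CTm.caseOf · F₁ F₂)) .caseOf h
  obtain ⟨G, ⟨h, h', hG⟩ | ⟨h, h', hG⟩⟩ := h
  · exact (h₁ G hG).expand (.tail' (key h) .betaInl) (.tail' (key h') .betaInl)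
  · exact (h₂ G hG).expand (.tail' (key h) .betaInr) (.tail' (key h') .betaInr)

theorem LogRel.nrec {T : CTy} {E E' F₁ F₂ : CTm 0} (h : LogRel .nat E E')
    (h₁ : LogRel (.arr .unit T) F₁ F₁) (h₂ : LogRel (.arr (.prod .nat T) T) F₂ F₂) :
    LogRel T (.nrec E F₁ F₂) (.nrec E' F₁ F₂) := by
  have key {E V : CTm 0} (h : Steps E V) : Steps (.nrec E F₁ F₂) (.nrec V F₁ F₂) :=
    Steps.map (f := (CTm.nrec · F₁ F₂)) .nrec h
  replace h : NatRel E E' := h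
  induction h with
  | zero h h' =>
    exact (h₁ .unit trivial).expand (.tail' (key h) .betaZero) (.tail' (key h') .betaZero)
  | succ h h' hG ih =>
    exact (h₂ _ (.pair (S := .nat) hG ih)).expand (.tail' (key h) .betaSucc)
      (.tail' (key h') .betaSucc)

theorem LogRel.lrec {S T : CTy} {E E' F₁ F₂ : CTm 0} (h : LogRel (.list S) E E')
    (h₁ : LogRel (.arr .unit T) F₁ F₁)
    (h₂ : LogRel (.arr (.prod S (.prod (.list S) T)) T) F₂ F₂) :
    LogRel T (.lrec E F₁ F₂) (.lrec E' F₁ F₂) := by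
  have key {E V : CTm 0} (h : Steps E V) : Steps (.lrec E F₁ F₂) (.lrec V F₁ F₂) :=
    Steps.map (f := (CTm.lrec · F₁ F₂)) .lrec h
  replace h : ListRel (LogRel S) E E' := h
  induction h with
  | nil h h' =>
    exact (h₁ .unit trivial).expand (.tail' (key h) .betaNil) (.tail' (key h') .betaNil)
  | cons h h' hG hH ih =>
    exact (h₂ _ (.pair hG (.pair (S := .list S) hH ih))).expand (.tail' (key h) .betaCons)
      (.tail' (key h') .betaCons)

theorem LogRel.cost_map {E F E' F' : CTm 0} {g : ExtInt → ExtInt} (hg : Monotone g)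
    (h : LogRel .cost E F) (hE : ∀ l u, CostVal E l u → CostVal E' (g l) (g u))
    (hF : ∀ l u, CostVal F l u → CostVal F' (g l) (g u)) : LogRel .cost E' F' := by
  obtain ⟨l, u, l', u', h₁, h₂, hl, hu⟩ := h
  exact ⟨_, _, _, _, hE _ _ h₁, hF _ _ h₂, hg hl, hg hu⟩

theorem LogRel.scale {E F : CTm 0} (k : Mult) (h : LogRel .cost E F) :
    LogRel .cost (.scale k E) (.scale k F) :=
  h.cost_map (fun _ _ => ExtInt.scale_mono k.1) (fun _ _ => .scale k) (fun _ _ => .scale k)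

theorem LogRel.add {E F E' F' : CTm 0} (h : LogRel .cost E F) (h' : LogRel .cost E' F') :
    LogRel .cost (.add E E') (.add F F') := by
  obtain ⟨l, u, l', u', h₁, h₂, hl, hu⟩ := h
  obtain ⟨k, v, k', v', h₁', h₂', hk, hv⟩ := h'
  exact ⟨_, _, _, _, .add h₁ h₁', .add h₂ h₂', add_le_add hl hk, add_le_add hu hv⟩

/-- Negation exchanges the endpoints, so antitonicity could not be validated by lower endpoints
alone. -/
theorem LogRel.neg {E F : CTm 0} (h : LogRel .cost E F) : LogRel .cost (.neg F) (.neg E) := by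
  obtain ⟨l, u, l', u', h₁, h₂, hl, hu⟩ := h
  exact ⟨_, _, _, _, .neg h₂, .neg h₁, ExtInt.neg_antitone hu, ExtInt.neg_antitone hl⟩

theorem LogRel.toCost {E F : CTm 0} (h : LogRel .cred E F) :
    LogRel .cost (.toCost E) (.toCost F) := by
  obtain ⟨m, h₁, h₂⟩ := h
  exact ⟨_, _, _, _, .toCost h₁, .toCost h₂, le_rfl, le_rfl⟩

theorem LogRel.credAdd {E F E' F' : CTm 0} (h : LogRel .cred E F) (h' : LogRel .cred E' F') :
    LogRel .cred (.credAdd E E') (.credAdd F F') := by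
  obtain ⟨m, h₁, h₂⟩ := h
  obtain ⟨m', h₁', h₂'⟩ := h'
  exact ⟨_, .credAdd h₁ h₁', .credAdd h₂ h₂'⟩

/-- The relation is not reflexive on raw terms; reflexivity on well-typed ones is the existence half
of canonicity. In particular every closed well-typed cost term has an interval and every closed
credit term a value. -/
theorem LogRel.subst {n : ℕ} {Γ : Fin n → CTy} {E : CTm n} {T : CTy} (h : CHasTy Γ E T) :
    ∀ t : Fin n → CTm 0, (∀ i, LogRel (Γ i) (t i) (t i)) → LogRel T (E.subst t) (E.subst t) := by
  have key {n : ℕ} {Γ : Fin n → CTy} {E : CTm (n + 1)} {S T : CTy} {t : Fin n → CTm 0}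
      (h : ∀ t : Fin (n + 1) → CTm 0, (∀ i, LogRel (extend Γ S i) (t i) (t i)) →
        LogRel T (E.subst t) (E.subst t)) (ht : ∀ i, LogRel (Γ i) (t i) (t i)) (G : CTm 0)
      (hG : LogRel S G G) :
      LogRel T ((E.subst (CTm.lift t)).inst G) ((E.subst (CTm.lift t)).inst G) := by
    rw [inst_subst_lift]
    refine h _ fun i => ?_
    induction i using Fin.lastCases <;> simp [hG, ht]
  induction h with
  | var i => exact fun t ht => ht i
  | const q => exact fun t ht => ⟨q, q, q, q, .const q, .const q, le_rfl, le_rfl⟩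
  | add _ _ ih ih' => exact fun t ht => (ih t ht).add (ih' t ht)
  | neg _ ih => exact fun t ht => (ih t ht).neg
  | scale k _ ih => exact fun t ht => (ih t ht).scale k
  | credLit m => exact fun t ht => ⟨m, .credLit m, .credLit m⟩
  | credAdd _ _ ih ih' => exact fun t ht => (ih t ht).credAdd (ih' t ht)
  | toCost _ ih => exact fun t ht => (ih t ht).toCost
  | unit => exact fun t ht => trivial
  | pair _ _ ih ih' => exact fun t ht => (ih t ht).pair (ih' t ht)
  | fst _ ih => exact fun t ht => (ih t ht).1
  | snd _ ih => exact fun t ht => (ih t ht).2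
  | inl _ ih => exact fun t ht => ⟨_, .inl ⟨.refl, .refl, ih t ht⟩⟩
  | inr _ ih => exact fun t ht => ⟨_, .inr ⟨.refl, .refl, ih t ht⟩⟩
  | caseOf _ _ _ ih ih₁ ih₂ => exact fun t ht => (ih t ht).caseOf (key ih₁ ht) (key ih₂ ht)
  | lam _ ih => exact fun t ht G hG => (key ih ht G hG).expand_step .betaLam
  | app _ _ ih ih' => exact fun t ht => ih t ht _ (ih' t ht)
  | zero => exact fun t ht => NatRel.zero .refl .refl
  | succ _ ih => exact fun t ht => NatRel.succ .refl .refl (ih t ht)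
  | nrec _ _ _ ih ih₁ ih₂ => exact fun t ht => (ih t ht).nrec (ih₁ t ht) (ih₂ t ht)
  | nil => exact fun t ht => ListRel.nil .refl .refl
  | cons _ _ ih ih' => exact fun t ht => ListRel.cons .refl .refl (ih t ht) (ih' t ht)
  | lrec _ _ _ ih ih₁ ih₂ => exact fun t ht => (ih t ht).lrec (ih₁ t ht) (ih₂ t ht)

/-- Soundness of the model. Rules with a `β`-redex on the right follow from self-relatedness of the
reduct and `LogRel.expand_right`, the cost laws from comparing both endpoints, and symmetry on
credits from the fact that related credits have equal values. -/
theorem LogRel.of_le {n : ℕ} {Γ : Fin n → CTy} {E F : CTm n} {T : CTy} (h : CLe Γ E F T) :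
    ∀ t : Fin n → CTm 0, (∀ i, LogRel (Γ i) (t i) (t i)) → LogRel T (E.subst t) (F.subst t) := by
  have key {n : ℕ} {Γ : Fin n → CTy} {E : CTm (n + 1)} {S T : CTy} {t : Fin n → CTm 0}
      (h : CHasTy (extend Γ S) E T) (ht : ∀ i, LogRel (Γ i) (t i) (t i)) (G : CTm 0)
      (hG : LogRel S G G) :
      LogRel T ((E.subst (CTm.lift t)).inst G) ((E.subst (CTm.lift t)).inst G) := by
    rw [inst_subst_lift]
    refine LogRel.subst h _ fun i => ?_
    induction i using Fin.lastCases <;> simp [hG, ht]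
  have inst {n : ℕ} {E : CTm (n + 1)} {F : CTm n} (t : Fin n → CTm 0) :
      (E.inst F).subst t = (E.subst (CTm.lift t)).inst (F.subst t) := by
    rw [subst_inst, inst_subst_lift]
  induction h with
  | refl h => exact LogRel.subst h
  | trans _ _ ih ih' => exact fun t ht => (ih t ht).trans (ih' t ht)
  | fst _ ih => exact fun t ht => (ih t ht).1
  | snd _ ih => exact fun t ht => (ih t ht).2
  | caseOf _ h₁ h₂ ih => exact fun t ht => (ih t ht).caseOf (key h₁ ht) (key h₂ ht)
  | app _ h ih => exact fun t ht => ih t ht _ (.subst h t ht)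
  | nrec _ h₁ h₂ ih => exact fun t ht => (ih t ht).nrec (.subst h₁ t ht) (.subst h₂ t ht)
  | lrec _ h₁ h₂ ih => exact fun t ht => (ih t ht).lrec (.subst h₁ t ht) (.subst h₂ t ht)
  | betaFst h _ => exact fun t ht => (LogRel.subst h t ht).expand_right .betaFst
  | betaSnd _ h => exact fun t ht => (LogRel.subst h t ht).expand_right .betaSnd
  | betaInl h h₁ _ =>
    exact fun t ht => inst t ▸ (key h₁ ht _ (.subst h t ht)).expand_right .betaInl
  | betaInr h _ h₂ =>
    exact fun t ht => inst t ▸ (key h₂ ht _ (.subst h t ht)).expand_right .betaInr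
  | betaLam h h' =>
    exact fun t ht => inst t ▸ (key h ht _ (.subst h' t ht)).expand_right .betaLam
  | betaZero h₁ _ => exact fun t ht => (LogRel.subst (h₁.app .unit) t ht).expand_right .betaZero
  | betaSucc h h₁ h₂ =>
    exact fun t ht =>
      (LogRel.subst (h₂.app (.pair h (.nrec h h₁ h₂))) t ht).expand_right .betaSucc
  | betaNil h₁ _ => exact fun t ht => (LogRel.subst (h₁.app .unit) t ht).expand_right .betaNil
  | betaCons h h' h₁ h₂ =>
    exact fun t ht =>
      (LogRel.subst (h₂.app (.pair h (.pair h' (.lrec h' h₁ h₂)))) t ht).expand_right .betaCons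
  | constLe h => exact fun t ht => ⟨_, _, _, _, .const _, .const _, h, h⟩
  | botLe h =>
    intro t ht
    obtain ⟨l, u, _, _, h, _⟩ := LogRel.subst h t ht
    exact ⟨_, _, _, _, .const _, h, by simp, by simp⟩
  | topAdd h =>
    intro t ht
    obtain ⟨l, u, _, _, h, _⟩ := LogRel.subst h t ht
    exact ⟨_, _, _, _, .const _, .add (.const _) h, by simp, by simp⟩
  | add _ _ ih ih' => exact fun t ht => (ih t ht).add (ih' t ht)
  | addConst p q =>
    exact fun t ht => ⟨_, _, _, _, .add (.const _) (.const _), .const _, le_rfl, le_rfl⟩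
  | constAdd p q =>
    exact fun t ht => ⟨_, _, _, _, .const _, .add (.const _) (.const _), le_rfl, le_rfl⟩
  | zeroAdd h =>
    intro t ht
    obtain ⟨l, u, _, _, h, _⟩ := LogRel.subst h t ht
    exact ⟨_, _, _, _, .add (.const _) h, h, by simp, by simp⟩
  | leZeroAdd h =>
    intro t ht
    obtain ⟨l, u, _, _, h, _⟩ := LogRel.subst h t ht
    exact ⟨_, _, _, _, h, .add (.const _) h, by simp, by simp⟩
  | addComm h h' =>
    intro t ht
    obtain ⟨l, u, _, _, h, _⟩ := LogRel.subst h t ht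
    obtain ⟨l', u', _, _, h', _⟩ := LogRel.subst h' t ht
    exact ⟨_, _, _, _, .add h h', .add h' h, (add_comm _ _).le, (add_comm _ _).le⟩
  | addAssoc h h' h'' =>
    intro t ht
    obtain ⟨l, u, _, _, h, _⟩ := LogRel.subst h t ht
    obtain ⟨l', u', _, _, h', _⟩ := LogRel.subst h' t ht
    obtain ⟨l'', u'', _, _, h'', _⟩ := LogRel.subst h'' t ht
    exact ⟨_, _, _, _, .add (.add h h') h'', .add h (.add h' h''), (add_assoc _ _ _).le,
      (add_assoc _ _ _).le⟩
  | neg _ ih => exact fun t ht => (ih t ht).neg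
  | negConst q => exact fun t ht => ⟨_, _, _, _, .neg (.const _), .const _, le_rfl, le_rfl⟩
  | constNeg q => exact fun t ht => ⟨_, _, _, _, .const _, .neg (.const _), le_rfl, le_rfl⟩
  | scale k _ ih => exact fun t ht => (ih t ht).scale k
  | scaleConst k q => exact fun t ht => ⟨_, _, _, _, .scale k (.const _), .const _, le_rfl, le_rfl⟩
  | constScale k q => exact fun t ht => ⟨_, _, _, _, .const _, .scale k (.const _), le_rfl, le_rfl⟩
  | scaleAdd k h h' =>
    intro t ht
    obtain ⟨l, u, _, _, h, _⟩ := LogRel.subst h t ht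
    obtain ⟨l', u', _, _, h', _⟩ := LogRel.subst h' t ht
    exact ⟨_, _, _, _, .scale k (.add h h'), .add (.scale k h) (.scale k h'),
      ExtInt.scale_add_le k _ _, ExtInt.scale_add_le k _ _⟩
  | toCost _ ih => exact fun t ht => (ih t ht).toCost
  | toCostLit m =>
    exact fun t ht => ⟨_, _, _, _, .toCost (.credLit m), .const _, le_rfl, le_rfl⟩
  | litToCost m =>
    exact fun t ht => ⟨_, _, _, _, .const _, .toCost (.credLit m), le_rfl, le_rfl⟩
  | credSymm _ ih => exact fun t ht => let ⟨m, h, h'⟩ := ih t ht; ⟨m, h', h⟩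
  | credAdd _ _ ih ih' => exact fun t ht => (ih t ht).credAdd (ih' t ht)
  | credAddLit m m' =>
    exact fun t ht => ⟨m + m', .credAdd (.credLit m) (.credLit m'), .credLit _⟩
  | credZeroAdd h =>
    intro t ht
    obtain ⟨m, h, _⟩ := LogRel.subst h t ht
    exact ⟨0 + m, .credAdd (.credLit 0) h, (zero_add m).symm ▸ h⟩
  | credAddComm h h' =>
    intro t ht
    obtain ⟨m, h, _⟩ := LogRel.subst h t ht
    obtain ⟨m', h', _⟩ := LogRel.subst h' t ht
    exact ⟨m + m', .credAdd h h', add_comm m' m ▸ .credAdd h' h⟩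
  | credAddAssoc h h' h'' =>
    intro t ht
    obtain ⟨m, h, _⟩ := LogRel.subst h t ht
    obtain ⟨m', h', _⟩ := LogRel.subst h' t ht
    obtain ⟨m'', h'', _⟩ := LogRel.subst h'' t ht
    exact ⟨m + m' + m'', .credAdd (.credAdd h h') h'', add_assoc m m' m'' ▸ .credAdd h (.credAdd h' h'')⟩

end CTm

/-- A closed cost expression that stays above a constant other than `-∞` after the addition of `-∞`
is at least `∞`. -/
theorem CLeClosed.top_le {E : CTm 0} {p : ExtInt} (hp : p ≠ ExtInt.negInf)
    (h : CLeClosed (.const p) (.add E (.const ExtInt.negInf)) .cost) :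
    CLeClosed (.const ⊤) E .cost := by
  obtain ⟨l, u, l', u', h₁, h₂, hl, -⟩ := CTm.LogRel.of_le h Fin.elim0 (fun i => i.elim0)
  have hE : CTyped E .cost := by cases h.typed.2 with | add h _ => exact h
  -- The empty substitution is the identity, so the model speaks about the closed terms themselves.
  rw [show (Fin.elim0 : Fin 0 → CTm 0) = CTm.var from funext fun i => i.elim0, CTm.subst_var] at h₁ h₂
  cases h₁ with
  | step h => cases h
  | const =>
    cases h₂ with
    | step h => cases h
    | add h₂ h₃ =>
      cases h₃ with
      | step h => cases h
      | const =>
        rename_i l _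
        -- Here `l` is the lower endpoint of `E`. Any `l` other than `⊤` gives `l + negInf =
        -- negInf`, which would force `p = negInf`.
        induction l using ExtInt.cases with
        | top => exact (h₂.le hE).1
        | bot => exact absurd (by simpa using hl) hp
        | int z => exact absurd (by simpa using hl) hp

/-! ## Substitution in credit terms and types -/

namespace Cred

@[simp] theorem var_subst {δ δ' : ℕ} (s : Fin δ → Cred δ') (i : Fin δ) : (var i).subst s = s i := by
  ext <;> simp [subst, var, Pi.single_apply]

theorem subst_subst {δ δ' δ'' : ℕ} (c : Cred δ) (s : Fin δ → Cred δ') (s' : Fin δ' → Cred δ'') :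
    (c.subst s).subst s' = c.subst (fun i => (s i).subst s') := by
  ext
  · simp only [subst, mul_add, Finset.sum_add_distrib, Finset.mul_sum, Finset.sum_mul, mul_assoc,
      add_assoc]
    rw [Finset.sum_comm]
  · simp only [subst, Finset.mul_sum, Finset.sum_mul, mul_assoc]
    rw [Finset.sum_comm]

@[simp] theorem subst_var {δ : ℕ} (c : Cred δ) : c.subst var = c := by
  ext <;> simp [subst, var, Pi.single_apply]

@[simp] theorem lit_subst {δ δ' : ℕ} (m : ℕ) (s : Fin δ → Cred δ') : (lit m).subst s = lit m := by
  ext <;> simp [subst, lit]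

theorem weaken_eq_subst {δ : ℕ} (c : Cred δ) : c.weaken = c.subst (fun i => var i.castSucc) := by
  ext j
  · simp [weaken, subst, var]
  · induction j using Fin.lastCases with
    | cast j => simp [weaken, subst, var, Pi.single_apply]
    | last => simp [weaken, subst, var, Pi.single_apply, Fin.ext_iff, fun i : Fin δ => i.2.ne']

@[simp] theorem lift_castSucc {δ δ' : ℕ} (s : Fin δ → Cred δ') (i : Fin δ) :
    lift s i.castSucc = (s i).weaken := by simp [lift]

@[simp] theorem lift_last {δ δ' : ℕ} (s : Fin δ → Cred δ') :
    lift s (Fin.last δ) = var (Fin.last δ') := by simp [lift]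

theorem lift_subst {δ δ' δ'' : ℕ} (s : Fin δ → Cred δ') (s' : Fin δ' → Cred δ'') :
    (fun i => (lift s i).subst (lift s')) = lift (fun i => (s i).subst s') := by
  funext i
  induction i using Fin.lastCases <;> simp [weaken_eq_subst, subst_subst]

theorem lift_var {δ : ℕ} : lift (var : Fin δ → Cred δ) = var := by
  funext i
  induction i using Fin.lastCases <;> simp [weaken_eq_subst]

theorem lift_subst_extend {δ δ' δ'' : ℕ} (s : Fin δ → Cred δ') (s' : Fin δ' → Cred δ'')
    (c : Cred δ'') :
    (fun i => (lift s i).subst (extend s' c)) = extend (fun i => (s i).subst s') c := by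
  funext i
  induction i using Fin.lastCases <;> simp [weaken_eq_subst, subst_subst]

end Cred

namespace Ty

theorem subst_subst {δ : ℕ} (A : Ty δ) : ∀ {δ' δ'' : ℕ} (s : Fin δ → Cred δ') (s' : Fin δ' → Cred δ''),
    (A.subst s).subst s' = A.subst (fun i => (s i).subst s') := by
  induction A <;> intro δ' δ'' s s' <;> simp only [subst, Cred.subst_subst, Cred.lift_subst, *]

theorem subst_inst {δ δ' : ℕ} (A : Ty (δ + 1)) (c : Cred δ) (s : Fin δ → Cred δ') :
    (A.inst c).subst s = A.subst (extend s (c.subst s)) := by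
  rw [inst, subst_subst, comp_extend]
  simp

theorem inst_subst_lift {δ δ' : ℕ} (A : Ty (δ + 1)) (s : Fin δ → Cred δ') (c : Cred δ') :
    (A.subst (Cred.lift s)).inst c = A.subst (extend s c) := by
  rw [inst, subst_subst, Cred.lift_subst_extend]
  simp

theorem weaken_subst_extend {δ δ' : ℕ} (A : Ty δ) (s : Fin δ → Cred δ') (c : Cred δ') :
    A.weaken.subst (extend s c) = A.subst s := by
  simp [weaken, subst_subst]

theorem weaken_subst_lift {δ δ' : ℕ} (A : Ty δ) (s : Fin δ → Cred δ') :
    A.weaken.subst (Cred.lift s) = (A.subst s).weaken := by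
  simp [weaken, subst_subst, Cred.weaken_eq_subst]

end Ty

@[simp] theorem pot_subst {δ : ℕ} (A : Ty δ) : ∀ {δ' : ℕ} (s : Fin δ → Cred δ'),
    pot (A.subst s) = pot A := by
  induction A <;> intro δ' s <;> simp only [Ty.subst, pot, *]

@[simp] theorem cpx_subst {δ δ' : ℕ} (A : Ty δ) (s : Fin δ → Cred δ') : cpx (A.subst s) = cpx A := by
  simp [cpx]

/-! ## Substitution in terms -/

namespace Tm

theorem csubst_rename {δ n : ℕ} (M : Tm δ n) :
    ∀ {δ' m : ℕ} (r : Fin n → Fin m) (s : Fin δ → Cred δ'),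
      (M.rename r).csubst s = (M.csubst s).rename r := by
  induction M <;> intro δ' m r s <;> simp only [rename, csubst, *]

theorem csubst_csubst {δ n : ℕ} (M : Tm δ n) :
    ∀ {δ' δ'' : ℕ} (s : Fin δ → Cred δ') (s' : Fin δ' → Cred δ''),
      (M.csubst s).csubst s' = M.csubst (fun i => (s i).subst s') := by
  induction M <;> intro δ' δ'' s s' <;> simp only [csubst, Cred.subst_subst, Cred.lift_subst, *]

@[simp] theorem csubst_var {δ n : ℕ} (M : Tm δ n) : M.csubst Cred.var = M := by
  induction M <;> simp only [csubst, Cred.subst_var, Cred.lift_var, *]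

@[simp] theorem lift_castSucc {δ n m : ℕ} (t : Fin n → Tm δ m) (i : Fin n) :
    lift t i.castSucc = (t i).weaken := by simp [lift]

@[simp] theorem lift_last {δ n m : ℕ} (t : Fin n → Tm δ m) :
    lift t (Fin.last n) = var (Fin.last m) := by simp [lift]

theorem lift_var_comp {δ n m : ℕ} (r : Fin n → Fin m) :
    lift (fun i => (var (r i) : Tm δ m)) = fun i => var (liftRen r i) := by
  funext i
  induction i using Fin.lastCases <;> simp [weaken, rename]

theorem cweaken_var {δ n : ℕ} (i : Fin n) : (var i : Tm δ n).cweaken = var i := rfl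

theorem cweaken_rename {δ n m : ℕ} (M : Tm δ n) (r : Fin n → Fin m) :
    (M.rename r).cweaken = M.cweaken.rename r :=
  csubst_rename M r _

theorem cweaken_csubst_lift {δ δ' n : ℕ} (M : Tm δ n) (s : Fin δ → Cred δ') :
    M.cweaken.csubst (Cred.lift s) = (M.csubst s).cweaken := by
  simp [cweaken, csubst_csubst, Cred.weaken_eq_subst]

theorem rename_eq_subst {δ n : ℕ} (M : Tm δ n) :
    ∀ {m : ℕ} (r : Fin n → Fin m), M.rename r = M.subst (fun i => var (r i)) := by
  induction M <;> intro m r <;> simp only [rename, subst, lift_var_comp, cweaken_var, *]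

theorem lift_comp_liftRen {δ n m l : ℕ} (t : Fin m → Tm δ l) (r : Fin n → Fin m) :
    (fun i => lift t (liftRen r i)) = lift (fun i => t (r i)) := by
  funext i
  induction i using Fin.lastCases <;> simp

theorem subst_rename {δ n : ℕ} (M : Tm δ n) :
    ∀ {m l : ℕ} (r : Fin n → Fin m) (t : Fin m → Tm δ l),
      (M.rename r).subst t = M.subst (fun i => t (r i)) := by
  induction M <;> intro m l r t <;> simp only [rename, subst, lift_comp_liftRen, *]

theorem weaken_rename {δ n m : ℕ} (M : Tm δ n) (r : Fin n → Fin m) :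
    (M.rename r).weaken = M.weaken.rename (liftRen r) := by
  rw [weaken, weaken, rename_eq_subst (M.rename r), rename_eq_subst (M.rename _), subst_rename,
    subst_rename]
  simp

theorem lift_rename {δ n m l : ℕ} (t : Fin n → Tm δ m) (r : Fin m → Fin l) :
    (fun i => (lift t i).rename (liftRen r)) = lift (fun i => (t i).rename r) := by
  funext i
  induction i using Fin.lastCases <;> simp [weaken_rename, rename]

theorem rename_subst {δ n : ℕ} (M : Tm δ n) :
    ∀ {m l : ℕ} (t : Fin n → Tm δ m) (r : Fin m → Fin l),
      (M.subst t).rename r = M.subst (fun i => (t i).rename r) := by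
  induction M <;> intro m l t r <;> simp only [rename, subst, lift_rename, cweaken_rename, *]

theorem weaken_csubst {δ δ' n : ℕ} (M : Tm δ n) (s : Fin δ → Cred δ') :
    M.weaken.csubst s = (M.csubst s).weaken :=
  csubst_rename M _ s

theorem lift_csubst {δ δ' n m : ℕ} (t : Fin n → Tm δ m) (s : Fin δ → Cred δ') :
    (fun i => (lift t i).csubst s) = lift (fun i => (t i).csubst s) := by
  funext i
  induction i using Fin.lastCases <;> simp [weaken_csubst, csubst]

theorem csubst_subst {δ n : ℕ} (M : Tm δ n) :
    ∀ {δ' m : ℕ} (t : Fin n → Tm δ m) (s : Fin δ → Cred δ'),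
      (M.subst t).csubst s = (M.csubst s).subst (fun i => (t i).csubst s) := by
  induction M <;> intro δ' m t s <;>
    simp only [csubst, subst, lift_csubst, cweaken_csubst_lift, *]

theorem weaken_subst_lift {δ n m : ℕ} (M : Tm δ n) (t : Fin n → Tm δ m) :
    M.weaken.subst (lift t) = (M.subst t).weaken := by
  simp [weaken, subst_rename, rename_subst]

theorem lift_subst {δ n m l : ℕ} (t : Fin n → Tm δ m) (u : Fin m → Tm δ l) :
    (fun i => (lift t i).subst (lift u)) = lift (fun i => (t i).subst u) := by
  funext i
  induction i using Fin.lastCases <;> simp [weaken_subst_lift, subst]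

theorem cweaken_subst {δ n m : ℕ} (M : Tm δ n) (t : Fin n → Tm δ m) :
    M.cweaken.subst (fun i => (t i).cweaken) = (M.subst t).cweaken :=
  (csubst_subst M t _).symm

theorem subst_subst {δ n : ℕ} (M : Tm δ n) :
    ∀ {m l : ℕ} (t : Fin n → Tm δ m) (u : Fin m → Tm δ l),
      (M.subst t).subst u = M.subst (fun i => (t i).subst u) := by
  induction M <;> intro m l t u <;> simp only [subst, lift_subst, cweaken_subst, *]

theorem lift_var {δ n : ℕ} : lift (var : Fin n → Tm δ n) = var := by
  funext i
  induction i using Fin.lastCases <;> simp [weaken, rename]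

@[simp] theorem subst_var {δ n : ℕ} (M : Tm δ n) : M.subst var = M := by
  induction M <;> simp only [subst, lift_var, cweaken_var, *]

@[simp] theorem weaken_inst {δ n : ℕ} (M N : Tm δ n) : M.weaken.inst N = M := by
  simp [weaken, inst, subst_rename]

theorem weaken_subst_extend {δ n m : ℕ} (M : Tm δ n) (t : Fin n → Tm δ m) (N : Tm δ m) :
    M.weaken.subst (extend t N) = M.subst t := by
  simp [weaken, subst_rename]

theorem lift_subst_extend {δ n m l : ℕ} (t : Fin n → Tm δ m) (u : Fin m → Tm δ l) (N : Tm δ l) :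
    (fun i => (lift t i).subst (extend u N)) = extend (fun i => (t i).subst u) N := by
  funext i
  induction i using Fin.lastCases <;> simp [weaken_subst_extend, subst]

theorem inst_subst_lift {δ n m : ℕ} (M : Tm δ (n + 1)) (t : Fin n → Tm δ m) (N : Tm δ m) :
    (M.subst (lift t)).inst N = M.subst (extend t N) := by
  rw [inst, subst_subst, lift_subst_extend]
  simp

theorem inst₂_subst_lift {δ n m : ℕ} (M : Tm δ (n + 2)) (t : Fin n → Tm δ m) (N₁ N₂ : Tm δ m) :
    (M.subst (lift (lift t))).inst₂ N₁ N₂ = M.subst (extend (extend t N₁) N₂) := by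
  rw [inst₂, subst_subst, lift_subst_extend, lift_subst_extend]
  simp

/-- Shapes the reduct of `unpack`: closing the body under its two binders and then instantiating
them is closing it once by extended substitutions. The entries of `t` do not mention the new credit
variable, hence survive its instantiation. -/
theorem cinst_subst_lift {δ δ' n m : ℕ} (M : Tm (δ + 1) (n + 1)) (s : Fin δ → Cred δ')
    (t : Fin n → Tm δ' m) (c : Cred δ') (N : Tm δ' m) :
    (((M.csubst (Cred.lift s)).subst (lift fun i => (t i).cweaken)).cinst c).inst N =
      (M.csubst (extend s c)).subst (extend t N) := by
  have h (i : Fin n) : (t i).cweaken.csubst (extend Cred.var c) = t i := by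
    simp [cweaken, csubst_csubst]
  rw [cinst, csubst_subst, csubst_csubst, Cred.lift_subst_extend, lift_csubst, inst_subst_lift]
  simp [h]

end Tm

/-! ## Resource terms -/

namespace Res

variable {δ n : ℕ}

@[simp] theorem add_var (f g : Res δ n) (j : Fin n) : (f + g).var j = f.var j + g.var j := rfl
@[simp] theorem add_cvar (f g : Res δ n) (i : Fin δ) : (f + g).cvar i = f.cvar i + g.cvar i := rfl
@[simp] theorem add_const (f g : Res δ n) : (f + g).const = f.const + g.const := rfl

theorem add_assoc' (f g h : Res δ n) : f + g + h = f + (g + h) := by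
  ext <;> simp [add_assoc]

theorem add_right_comm' (f g h : Res δ n) : f + g + h = f + h + g := by
  ext <;> simp [add_right_comm]

theorem le_refl' (f : Res δ n) : f ≤ f := ⟨fun _ => le_rfl, fun _ => le_rfl, le_rfl⟩

theorem le_trans' {f g h : Res δ n} (h₁ : f ≤ g) (h₂ : g ≤ h) : f ≤ h :=
  ⟨fun j => (h₁.1 j).trans (h₂.1 j), fun i => (h₁.2.1 i).trans (h₂.2.1 i), h₁.2.2.trans h₂.2.2⟩

theorem le_add (f g : Res δ n) : f ≤ f + g :=
  ⟨fun _ => le_self_add, fun _ => le_self_add, le_self_add⟩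

theorem exists_add_of_le {f g : Res δ n} (h : f ≤ g) : ∃ f', g = f + f' := by
  choose v hv using fun j => le_iff_exists_add.1 (h.1 j)
  choose c hc using fun i => le_iff_exists_add.1 (h.2.1 i)
  obtain ⟨b, hb⟩ := le_iff_exists_add.1 h.2.2
  exact ⟨⟨v, c, b⟩, by ext <;> simp [hv, hc, hb]⟩

theorem add_mono {f f' g g' : Res δ n} (h : f ≤ f') (h' : g ≤ g') : f + g ≤ f' + g' :=
  ⟨fun j => add_le_add (h.1 j) (h'.1 j), fun i => add_le_add (h.2.1 i) (h'.2.1 i),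
    add_le_add h.2.2 h'.2.2⟩

theorem push_mono {f f' : Res δ n} (h : f ≤ f') (k : ℕ∞) : f.push k ≤ f'.push k :=
  ⟨fun j => by induction j using Fin.lastCases <;> simp [push, h.1], h.2.1, h.2.2⟩

theorem cweaken_mono {f f' : Res δ n} (h : f ≤ f') : f.cweaken ≤ f'.cweaken :=
  ⟨h.1, fun i => by induction i using Fin.lastCases <;> simp [cweaken, h.2.1], h.2.2⟩

/-- Substitution of credit terms for the credit variables of a resource term. -/
noncomputable def csubst {δ' : ℕ} (s : Fin δ → Cred δ') (f : Res δ n) : Res δ' n :=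
  ⟨f.var, fun j => ∑ i, f.cvar i * ((s i).coef j : ℕ∞),
    f.const + ∑ i, f.cvar i * ((s i).const : ℕ∞)⟩

section csubst

variable {δ' : ℕ} (s : Fin δ → Cred δ')

theorem csubst_mono {f g : Res δ n} (h : f ≤ g) : f.csubst s ≤ g.csubst s :=
  ⟨h.1, fun j => by simp only [csubst]; gcongr; exact h.2.1 _,
    add_le_add h.2.2 (Finset.sum_le_sum fun i _ => mul_le_mul_left (h.2.1 i) _)⟩

@[simp] theorem csubst_add (f g : Res δ n) : (f + g).csubst s = f.csubst s + g.csubst s := by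
  ext <;> simp [csubst, add_mul, Finset.sum_add_distrib, add_add_add_comm]

@[simp] theorem csubst_scale (k : ℕ∞) (f : Res δ n) :
    (f.scale k).csubst s = (f.csubst s).scale k := by
  ext <;> simp [csubst, scale, mul_add, Finset.mul_sum, mul_assoc]

@[simp] theorem csubst_push (f : Res δ n) (k : ℕ∞) : (f.push k).csubst s = (f.csubst s).push k := rfl

@[simp] theorem csubst_ofVar (j : Fin n) : (ofVar j : Res δ n).csubst s = ofVar j := by
  ext <;> simp [csubst, ofVar]

@[simp] theorem csubst_ofCred (c : Cred δ) :
    (ofCred c : Res δ n).csubst s = ofCred (c.subst s) := by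
  ext <;> simp [csubst, ofCred, Cred.subst]

@[simp] theorem csubst_cweaken (f : Res δ n) :
    f.cweaken.csubst (Cred.lift s) = (f.csubst s).cweaken := by
  ext i
  · rfl
  · induction i using Fin.lastCases <;>
      simp [csubst, cweaken, Fin.sum_univ_castSucc, Cred.weaken, Cred.var]
  · simp [csubst, cweaken, Fin.sum_univ_castSucc, Cred.weaken, Cred.var]

theorem cweaken_eq_csubst (f : Res δ n) : f.cweaken = f.csubst (fun i => Cred.var i.castSucc) := by
  ext i
  · rfl
  · induction i using Fin.lastCases with
    | cast j => simp [csubst, cweaken, Cred.var, Pi.single_apply]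
    | last => simp [csubst, cweaken, Cred.var, Pi.single_apply, Fin.ext_iff, fun i : Fin δ => i.2.ne']
  · simp [csubst, cweaken, Cred.var]

end csubst

/-- Substitution of resource terms for the term variables of a resource term. -/
noncomputable def subst {m : ℕ} (g : Fin n → Res δ m) (f : Res δ n) : Res δ m :=
  ⟨fun i => ∑ j, f.var j * (g j).var i, fun i => ∑ j, f.var j * (g j).cvar i + f.cvar i,
    ∑ j, f.var j * (g j).const + f.const⟩

/-- Lift a substitution of resource terms under a binder of a term variable. -/
noncomputable def lift {m : ℕ} (g : Fin n → Res δ m) : Fin (n + 1) → Res δ (m + 1) :=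
  extend (fun j => (g j).push 0) (ofVar (Fin.last m))

section subst

variable {m : ℕ} (g : Fin n → Res δ m)

theorem subst_mono {f f' : Res δ n} (h : f ≤ f') : f.subst g ≤ f'.subst g :=
  ⟨fun i => by simp only [subst]; gcongr; exact h.1 _,
    fun i => add_le_add (Finset.sum_le_sum fun i _ => mul_le_mul_left (h.1 i) _) (h.2.1 i),
    add_le_add (Finset.sum_le_sum fun i _ => mul_le_mul_left (h.1 i) _) h.2.2⟩

@[simp] theorem subst_add (f f' : Res δ n) : (f + f').subst g = f.subst g + f'.subst g := by
  ext <;> simp [subst, add_mul, Finset.sum_add_distrib, add_add_add_comm]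

@[simp] theorem subst_scale (k : ℕ∞) (f : Res δ n) :
    (f.scale k).subst g = (f.subst g).scale k := by
  ext <;> simp [subst, scale, mul_add, Finset.mul_sum, mul_assoc]

@[simp] theorem subst_push (f : Res δ n) (k : ℕ∞) :
    (f.push k).subst (lift g) = (f.subst g).push k := by
  ext i
  · induction i using Fin.lastCases <;>
      simp [subst, push, lift, Fin.sum_univ_castSucc, ofVar, Pi.single_apply]
  · simp [subst, push, lift, Fin.sum_univ_castSucc, ofVar]
  · simp [subst, push, lift, Fin.sum_univ_castSucc, ofVar]

@[simp] theorem subst_ofVar (j : Fin n) : (ofVar j : Res δ n).subst g = g j := by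
  ext <;> simp [subst, ofVar, Pi.single_apply]

@[simp] theorem subst_ofCred (c : Cred δ) : (ofCred c : Res δ n).subst g = ofCred c := by
  ext <;> simp [subst, ofCred]

@[simp] theorem subst_cweaken (f : Res δ n) :
    f.cweaken.subst (fun j => (g j).cweaken) = (f.subst g).cweaken := by
  ext i
  · rfl
  · induction i using Fin.lastCases <;> simp [subst, cweaken]
  · rfl

end subst

/-- Closing a resource term by numerals and constant banks leaves the single bank `f.eval w s`. The
general substitution lemma for typing thereby yields the closed typings required inside the bounding
relation. -/
theorem subst_bank {δ n : ℕ} (f : Res δ n) (w : Fin δ → ℕ) (s : Fin n → ℕ∞) :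
    (f.csubst (closeCred w)).subst (fun j => bank (s j)) = (bank (f.eval w s) : Res 0 0) := by
  ext i
  · exact i.elim0
  · exact i.elim0
  · simp [subst, csubst, bank, eval, closeCred, Cred.lit, add_comm, add_assoc]

end Res

/-! ## Structural properties of the typing judgment -/

/-- In a rule that splits resources, the surplus goes to the continuation or to the last argument,
possibly to both branches of a case. Its bank enters the conclusion unscaled, so no division by a
multiplicity arises. -/
theorem HasTy.mono {δ n : ℕ} {Γ : Fin n → Ty δ} {f : Res δ n} {M : Tm δ n} {A : Ty δ}
    (h : HasTy Γ f M A) : ∀ {g : Res δ n}, f ≤ g → HasTy Γ g M A := by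
  induction h with
  | var j h => exact fun h' => .var j (Res.le_trans' h h')
  | unit => exact fun _ => .unit
  | zero => exact fun _ => .zero
  | nil => exact fun _ => .nil
  | pair h _ _ ih =>
    intro g' hg
    obtain ⟨f', rfl⟩ := Res.exists_add_of_le hg
    rw [Res.add_assoc']
    exact .pair h (ih (Res.le_add _ _))
  | cons h _ _ ih =>
    intro g' hg
    obtain ⟨f', rfl⟩ := Res.exists_add_of_le hg
    rw [Res.add_assoc']
    exact .cons h (ih (Res.le_add _ _))
  | app h _ _ ih =>
    intro g' hg
    obtain ⟨f', rfl⟩ := Res.exists_add_of_le hg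
    rw [Res.add_assoc']
    exact .app h (ih (Res.le_add _ _))
  | nrec h h₁ _ _ _ ih =>
    intro g' hg
    obtain ⟨f', rfl⟩ := Res.exists_add_of_le hg
    rw [Res.add_assoc']
    exact .nrec h h₁ (ih (Res.le_add _ _))
  | lrec h h₁ _ _ _ ih =>
    intro g' hg
    obtain ⟨f', rfl⟩ := Res.exists_add_of_le hg
    rw [Res.add_assoc']
    exact .lrec h h₁ (ih (Res.le_add _ _))
  | split h _ _ ih =>
    intro g' hg
    obtain ⟨f', rfl⟩ := Res.exists_add_of_le hg
    rw [Res.add_assoc']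
    exact .split h (ih (Res.push_mono (Res.push_mono (Res.le_add _ _) _) _))
  | caseOf h _ _ _ ih₁ ih₂ =>
    intro g' hg
    obtain ⟨f', rfl⟩ := Res.exists_add_of_le hg
    rw [Res.add_assoc']
    exact .caseOf h (ih₁ (Res.push_mono (Res.le_add _ _) _)) (ih₂ (Res.push_mono (Res.le_add _ _) _))
  | transfer h _ _ ih =>
    intro g' hg
    obtain ⟨f', rfl⟩ := Res.exists_add_of_le hg
    rw [Res.add_assoc']
    exact .transfer h (ih (Res.push_mono (Res.add_mono (Res.le_add _ _) (Res.le_refl' _)) _))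
  | unpack h _ _ ih =>
    intro g' hg
    obtain ⟨f', rfl⟩ := Res.exists_add_of_le hg
    rw [Res.add_assoc']
    exact .unpack h (ih (Res.push_mono (Res.cweaken_mono (Res.le_add _ _)) _))
  | spend _ ih =>
    intro g' hg
    obtain ⟨f', rfl⟩ := Res.exists_add_of_le hg
    rw [Res.add_right_comm']
    exact .spend (ih (Res.le_add _ _))
  | create _ ih => exact fun hg => .create (ih (Res.add_mono hg (Res.le_refl' _)))
  | save h h' => exact fun hg => .save h (Res.le_trans' h' hg)
  | lam _ ih => exact fun hg => .lam (ih (Res.push_mono hg _))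
  | lazyPair _ _ ih ih' => exact fun hg => .lazyPair (ih hg) (ih' hg)
  | inl _ ih => exact fun hg => .inl (ih hg)
  | inr _ ih => exact fun hg => .inr (ih hg)
  | fst _ ih => exact fun hg => .fst (ih hg)
  | snd _ ih => exact fun hg => .snd (ih hg)
  | succ _ ih => exact fun hg => .succ (ih hg)
  | tick _ ih => exact fun hg => .tick (ih hg)
  | pack _ ih => exact fun hg => .pack (ih hg)

theorem HasTy.csubst {δ n : ℕ} {Γ : Fin n → Ty δ} {f : Res δ n} {M : Tm δ n} {A : Ty δ}
    (h : HasTy Γ f M A) : ∀ {δ' : ℕ} (s : Fin δ → Cred δ'),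
      HasTy (fun j => (Γ j).subst s) (f.csubst s) (M.csubst s) (A.subst s) := by
  have key {δ δ' n : ℕ} (Γ : Fin n → Ty δ) (A : Ty δ) (s : Fin δ → Cred δ') :
      (fun j => (extend Γ A j).subst s) = extend (fun j => (Γ j).subst s) (A.subst s) :=
    comp_extend (fun A => A.subst s) Γ A
  induction h with
  | var j h => exact fun s => .var j (by simpa using Res.csubst_mono s h)
  | unit => exact fun s => .unit
  | zero => exact fun s => .zero
  | nil => exact fun s => .nil
  | pair _ _ ih ih' => intro _ s; rw [Res.csubst_add]; exact .pair (ih s) (ih' s)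
  | cons _ _ ih ih' => intro _ s; rw [Res.csubst_add]; exact .cons (ih s) (ih' s)
  | app _ _ ih ih' => intro _ s; rw [Res.csubst_add]; exact .app (ih s) (ih' s)
  | nrec _ _ _ ih ih₁ ih₂ =>
    intro _ s
    rw [Res.csubst_add, Res.csubst_add]
    refine .nrec (ih s) (ih₁ s) ?_
    simpa only [Ty.subst, Cred.lit_subst] using ih₂ s
  | lrec _ _ _ ih ih₁ ih₂ =>
    intro _ s
    rw [Res.csubst_add, Res.csubst_add]
    refine .lrec (ih s) (ih₁ s) ?_
    simpa only [Ty.subst, Cred.lit_subst] using ih₂ s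
  | split _ _ ih ih' =>
    intro _ s
    rw [Res.csubst_add, Res.csubst_scale]
    exact .split (ih s) (by simpa only [key, Res.csubst_push] using ih' s)
  | caseOf _ _ _ ih ih₁ ih₂ =>
    intro _ s
    rw [Res.csubst_add, Res.csubst_scale]
    exact .caseOf (ih s) (by simpa only [key, Res.csubst_push] using ih₁ s)
      (by simpa only [key, Res.csubst_push] using ih₂ s)
  | transfer _ _ ih ih' =>
    intro _ s
    rw [Res.csubst_add, Res.csubst_scale]
    refine .transfer (ih s) ?_
    simpa only [key, Res.csubst_push, Res.csubst_add, Res.csubst_scale, Res.csubst_ofCred] using ih' s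
  | unpack _ _ ih ih' =>
    intro _ s
    rw [Res.csubst_add, Res.csubst_scale]
    refine .unpack (ih s) ?_
    simpa only [key, Res.csubst_push, Res.csubst_cweaken, Ty.weaken_subst_lift] using ih' (Cred.lift s)
  | spend _ ih => intro _ s; rw [Res.csubst_add, Res.csubst_ofCred]; exact .spend (ih s)
  | create _ ih => intro _ s; exact .create (by simpa using ih s)
  | save _ h' ih => intro _ s; exact .save (ih s) (by simpa using Res.csubst_mono s h')
  | lam _ ih => intro _ s; exact .lam (by simpa only [key, Res.csubst_push] using ih s)
  | lazyPair _ _ ih ih' => intro _ s; exact .lazyPair (ih s) (ih' s)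
  | inl _ ih => intro _ s; exact .inl (ih s)
  | inr _ ih => intro _ s; exact .inr (ih s)
  | fst _ ih => intro _ s; exact .fst (ih s)
  | snd _ ih => intro _ s; exact .snd (ih s)
  | succ _ ih => intro _ s; exact .succ (ih s)
  | tick _ ih => intro _ s; exact .tick (ih s)
  | pack _ ih =>
    intro _ s
    exact .pack (by simpa only [Ty.inst_subst_lift, Ty.subst_inst] using ih s)

theorem HasTy.cweaken {δ n : ℕ} {Γ : Fin n → Ty δ} {f : Res δ n} {M : Tm δ n} {A : Ty δ}
    (h : HasTy Γ f M A) : HasTy (fun j => (Γ j).weaken) f.cweaken M.cweaken A.weaken := by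
  rw [Res.cweaken_eq_csubst]
  exact h.csubst _

/-- Substitution preserves typing, provided that it can be lifted under binders. -/
theorem HasTy.subst_of_lift
    (P : ∀ {δ n m : ℕ}, (Fin n → Ty δ) → (Fin m → Ty δ) → (Fin n → Res δ m) → (Fin n → Tm δ m) → Prop)
    (typed : ∀ {δ n m : ℕ} {Γ : Fin n → Ty δ} {Γ' : Fin m → Ty δ} {g : Fin n → Res δ m}
      {t : Fin n → Tm δ m}, P Γ Γ' g t → ∀ j, HasTy Γ' (g j) (t j) (Γ j))
    (lift : ∀ {δ n m : ℕ} {Γ : Fin n → Ty δ} {Γ' : Fin m → Ty δ} {g : Fin n → Res δ m}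
      {t : Fin n → Tm δ m} (A : Ty δ), P Γ Γ' g t →
        P (extend Γ A) (extend Γ' A) (Res.lift g) (Tm.lift t))
    (cweaken : ∀ {δ n m : ℕ} {Γ : Fin n → Ty δ} {Γ' : Fin m → Ty δ} {g : Fin n → Res δ m}
      {t : Fin n → Tm δ m}, P Γ Γ' g t →
        P (fun j => (Γ j).weaken) (fun j => (Γ' j).weaken) (fun j => (g j).cweaken)
          (fun j => (t j).cweaken))
    {δ n : ℕ} {Γ : Fin n → Ty δ} {f : Res δ n} {M : Tm δ n} {A : Ty δ} (h : HasTy Γ f M A) :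
    ∀ {m : ℕ} {Γ' : Fin m → Ty δ} {g : Fin n → Res δ m} {t : Fin n → Tm δ m}, P Γ Γ' g t →
      HasTy Γ' (f.subst g) (M.subst t) A := by
  induction h with
  | var j h => exact fun p => (typed p j).mono (by simpa using Res.subst_mono _ h)
  | unit => exact fun p => .unit
  | zero => exact fun p => .zero
  | nil => exact fun p => .nil
  | pair _ _ ih ih' => intro _ _ _ _ p; rw [Res.subst_add]; exact .pair (ih p) (ih' p)
  | cons _ _ ih ih' => intro _ _ _ _ p; rw [Res.subst_add]; exact .cons (ih p) (ih' p)
  | app _ _ ih ih' => intro _ _ _ _ p; rw [Res.subst_add]; exact .app (ih p) (ih' p)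
  | nrec _ _ _ ih ih₁ ih₂ =>
    intro _ _ _ _ p; rw [Res.subst_add, Res.subst_add]; exact .nrec (ih p) (ih₁ p) (ih₂ p)
  | lrec _ _ _ ih ih₁ ih₂ =>
    intro _ _ _ _ p; rw [Res.subst_add, Res.subst_add]; exact .lrec (ih p) (ih₁ p) (ih₂ p)
  | split _ _ ih ih' =>
    intro _ _ _ _ p
    rw [Res.subst_add, Res.subst_scale]
    exact .split (ih p) (by simpa only [Res.subst_push] using ih' (lift _ (lift _ p)))
  | caseOf _ _ _ ih ih₁ ih₂ =>
    intro _ _ _ _ p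
    rw [Res.subst_add, Res.subst_scale]
    exact .caseOf (ih p) (by simpa only [Res.subst_push] using ih₁ (lift _ p))
      (by simpa only [Res.subst_push] using ih₂ (lift _ p))
  | transfer _ _ ih ih' =>
    intro _ _ _ _ p
    rw [Res.subst_add, Res.subst_scale]
    refine .transfer (ih p) ?_
    simpa only [Res.subst_push, Res.subst_add, Res.subst_scale, Res.subst_ofCred] using ih' (lift _ p)
  | unpack _ _ ih ih' =>
    intro _ _ _ _ p
    rw [Res.subst_add, Res.subst_scale]
    refine .unpack (ih p) ?_
    simpa only [Res.subst_push, Res.subst_cweaken] using ih' (lift _ (cweaken p))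
  | spend _ ih => intro _ _ _ _ p; rw [Res.subst_add, Res.subst_ofCred]; exact .spend (ih p)
  | create _ ih => intro _ _ _ _ p; exact .create (by simpa using ih p)
  | save _ h' ih => intro _ _ _ _ p; exact .save (ih p) (by simpa using Res.subst_mono _ h')
  | lam _ ih => intro _ _ _ _ p; exact .lam (by simpa only [Res.subst_push] using ih (lift _ p))
  | lazyPair _ _ ih ih' => intro _ _ _ _ p; exact .lazyPair (ih p) (ih' p)
  | inl _ ih => intro _ _ _ _ p; exact .inl (ih p)
  | inr _ ih => intro _ _ _ _ p; exact .inr (ih p)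
  | fst _ ih => intro _ _ _ _ p; exact .fst (ih p)
  | snd _ ih => intro _ _ _ _ p; exact .snd (ih p)
  | succ _ ih => intro _ _ _ _ p; exact .succ (ih p)
  | tick _ ih => intro _ _ _ _ p; exact .tick (ih p)
  | pack _ ih => intro _ _ _ _ p; exact .pack (ih p)

theorem Res.ofVar_castSucc {δ n : ℕ} (j : Fin n) :
    (Res.ofVar j.castSucc : Res δ (n + 1)) = (Res.ofVar j).push 0 := by
  ext i
  · induction i using Fin.lastCases <;> simp [ofVar, push, Pi.single_apply, Fin.ext_iff, j.2.ne']
  · rfl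
  · rfl

theorem Res.ofVar_cweaken {δ n : ℕ} (j : Fin n) :
    (Res.ofVar j : Res δ n).cweaken = Res.ofVar j := by
  ext i
  · rfl
  · induction i using Fin.lastCases <;> simp [ofVar, cweaken]
  · rfl

/-- First use of `HasTy.subst_of_lift`: a substitution by variables lifts under binders without
knowing that weakening preserves typing. Weakening follows, and with it the lifting hypothesis for
the second use, `HasTy.subst`. -/
theorem HasTy.rename {δ n m : ℕ} {Γ : Fin n → Ty δ} {Γ' : Fin m → Ty δ} {f : Res δ n} {M : Tm δ n}
    {A : Ty δ} (h : HasTy Γ f M A) (r : Fin n → Fin m) (hr : ∀ j, Γ' (r j) = Γ j) :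
    HasTy Γ' (f.subst fun j => Res.ofVar (r j)) (M.rename r) A := by
  rw [Tm.rename_eq_subst]
  refine h.subst_of_lift (fun Γ Γ' g t => ∃ r : Fin _ → Fin _, (∀ j, Γ' (r j) = Γ j) ∧
    (∀ j, g j = Res.ofVar (r j)) ∧ ∀ j, t j = .var (r j)) ?_ ?_ ?_ ⟨r, hr, fun _ => rfl, fun _ => rfl⟩
  · rintro _ _ _ Γ Γ' g t ⟨r, hr, hg, ht⟩ j
    rw [hg, ht, ← hr]
    exact .var _ (Res.le_refl' _)
  · rintro _ _ _ Γ Γ' g t A ⟨r, hr, hg, ht⟩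
    refine ⟨Tm.liftRen r, fun j => ?_, fun j => ?_, fun j => ?_⟩ <;>
      induction j using Fin.lastCases <;>
      simp [hr, hg, ht, Res.lift, Res.ofVar_castSucc, Tm.weaken, Tm.rename]
  · rintro _ _ _ Γ Γ' g t ⟨r, hr, hg, ht⟩
    exact ⟨r, fun j => by simp [hr], fun j => by simp [hg, Res.ofVar_cweaken],
      fun j => by simp [ht, Tm.cweaken_var]⟩

theorem HasTy.weaken {δ n : ℕ} {Γ : Fin n → Ty δ} {f : Res δ n} {M : Tm δ n} {A B : Ty δ}
    (h : HasTy Γ f M A) : HasTy (extend Γ B) (f.push 0) M.weaken A := by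
  have hf : f.subst (fun j => Res.ofVar j.castSucc) = f.push 0 := by
    ext i
    · induction i using Fin.lastCases with
      | cast i => simp [Res.subst, Res.ofVar, Res.push, Pi.single_apply]
      | last =>
        simp [Res.subst, Res.ofVar, Res.push, Pi.single_apply, Fin.ext_iff, fun i : Fin n => i.2.ne']
    · simp [Res.subst, Res.ofVar, Res.push]
    · simp [Res.subst, Res.ofVar, Res.push]
  rw [← hf]
  exact h.rename _ fun j => by simp

theorem HasTy.subst {δ n m : ℕ} {Γ : Fin n → Ty δ} {Γ' : Fin m → Ty δ} {f : Res δ n} {M : Tm δ n}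
    {A : Ty δ} (h : HasTy Γ f M A) {g : Fin n → Res δ m} {t : Fin n → Tm δ m}
    (ht : ∀ j, HasTy Γ' (g j) (t j) (Γ j)) : HasTy Γ' (f.subst g) (M.subst t) A := by
  refine h.subst_of_lift (fun Γ Γ' g t => ∀ j, HasTy Γ' (g j) (t j) (Γ j)) id ?_
    (fun ht j => (ht j).cweaken) ht
  intro δ n m Γ Γ' g t A ht j
  induction j using Fin.lastCases with
  | cast j => simpa [Res.lift] using (ht j).weaken
  | last =>
    simpa [Res.lift] using HasTy.var (Γ := extend Γ' A) (Fin.last m) (Res.le_refl' _)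

theorem HasTy.close {δ n : ℕ} {Γ : Fin n → Ty δ} {f : Res δ n} {M : Tm δ n} {A : Ty δ}
    (h : HasTy Γ f M A) (w : Fin δ → ℕ) {s : Fin n → ℕ∞} {t : Fin n → Tm 0 0}
    (ht : ∀ j, Typed (s j) (t j) ((Γ j).subst (closeCred w))) :
    Typed (f.eval w s) ((M.csubst (closeCred w)).subst t) (A.subst (closeCred w)) := by
  rw [Typed, ← Res.subst_bank]
  exact (h.csubst _).subst ht

/-! ## Typing of extracted recurrences -/

/-- The recurrence context of a term: the credit variables, followed by the potentials of the term
variables. -/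
def potCtx {δ n : ℕ} (Γ : Fin n → Ty δ) : Fin (δ + n) → CTy :=
  Fin.append (fun _ : Fin δ => CTy.cred) (fun j => pot (Γ j))

theorem potCtx_extend {δ n : ℕ} (Γ : Fin n → Ty δ) (A : Ty δ) :
    potCtx (extend Γ A) = extend (n := δ + n) (potCtx Γ) (pot A) := by
  rw [potCtx, potCtx, comp_extend, append_extend]

@[simp] theorem potCtx_castAdd {δ n : ℕ} (Γ : Fin n → Ty δ) (i : Fin δ) :
    potCtx Γ (Fin.castAdd n i) = .cred := by simp [potCtx]

@[simp] theorem potCtx_natAdd {δ n : ℕ} (Γ : Fin n → Ty δ) (j : Fin n) :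
    potCtx Γ (Fin.natAdd δ j) = pot (Γ j) := by simp [potCtx]

theorem CTm.credTm_typed {δ n : ℕ} {Γ : Fin n → Ty δ} (c : Cred δ) :
    CHasTy (potCtx Γ) (credTm n c) .cred := by
  unfold credTm
  induction List.finRange δ with
  | nil => exact .credLit _
  | cons i l ih =>
    refine .credAdd (.credMul ?_ _) ih
    simpa using CHasTy.var (Γ := potCtx Γ) (Fin.castAdd n i)

theorem HasTy.extract_typed {δ n : ℕ} {Γ : Fin n → Ty δ} {f : Res δ n} {M : Tm δ n} {A : Ty δ}
    (h : HasTy Γ f M A) : CHasTy (potCtx Γ) (extract M) (cpx A) := by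
  have last {n : ℕ} {Γ : Fin n → CTy} (S : CTy) : CHasTy (extend Γ S) (.var (Fin.last n)) S := by
    simpa using CHasTy.var (Γ := extend Γ S) (Fin.last n)
  induction h with
  | @var δ n Γ f j _ =>
    refine .pair (.const 0) ?_
    simpa using CHasTy.var (Γ := potCtx Γ) (Fin.natAdd δ j)
  | unit => exact .pair (.const 0) .unit
  | zero => exact .pair (.const 0) .zero
  | nil => exact .pair (.const 0) .nil
  | pair _ _ ih ih' => exact .pair (.add ih.fst ih'.fst) (.pair ih.snd ih'.snd)
  | cons _ _ ih ih' => exact .pair (.add ih.fst ih'.fst) (.cons ih.snd ih'.snd)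
  | app _ _ ih ih' => exact .addCost (.add ih.fst ih'.fst) (.app ih.snd ih'.snd)
  | nrec _ _ _ ih ih₁ ih₂ =>
    refine .addCost (.add (.add ih.fst ih₁.fst) ih₂.fst) (.nrec ih.snd ih₁.snd (.lam ?_))
    exact .app ih₂.snd.weaken (.pair (last _).fst (.lam (last _).snd.weaken))
  | lrec _ _ _ ih ih₁ ih₂ =>
    refine .addCost (.add (.add ih.fst ih₁.fst) ih₂.fst) (.lrec ih.snd ih₁.snd (.lam ?_))
    exact .app ih₂.snd.weaken (.pair (last _).fst (.pair (.pair (.const 0) (last _).snd.fst)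
      (last _).snd.snd))
  | split _ _ ih ih' =>
    rw [potCtx_extend, potCtx_extend] at ih'
    exact .addCost (.scale _ ih.fst) (CHasTy.subst ih' _
      (CHasTy.extend (CHasTy.extend CHasTy.var ih.snd.fst) ih.snd.snd))
  | caseOf _ _ _ ih ih₁ ih₂ =>
    rw [potCtx_extend] at ih₁ ih₂
    exact .addCost (.scale _ ih.fst) (.caseOf ih.snd ih₁ ih₂)
  | transfer _ _ ih ih' =>
    rw [potCtx_extend] at ih'
    exact .addCost (.scale _ ih.fst) (CHasTy.inst ih' ih.snd)
  | @unpack δ n Γ _ _ k M N A C _ _ ih ih' =>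
    refine .addCost (.scale _ ih.fst) ?_
    rw [Ty.weaken, cpx_subst] at ih'
    refine ih'.subst _ fun i => ?_
    induction i using Fin.addCases with
    | left i =>
      rw [Fin.append_left, potCtx_castAdd]
      induction i using Fin.lastCases with
      | cast i => simpa using CHasTy.var (Γ := potCtx Γ) (Fin.castAdd n i)
      | last => simpa using ih.snd.fst
    | right j =>
      rw [Fin.append_right, potCtx_natAdd]
      induction j using Fin.lastCases with
      | cast j => simpa [Ty.weaken] using CHasTy.var (Γ := potCtx Γ) (Fin.natAdd δ j)
      | last => simpa using ih.snd.snd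
  | spend _ ih => exact .addCost (.neg (.toCost (CTm.credTm_typed _))) ih
  | create _ ih => exact .addCost (.toCost (CTm.credTm_typed _)) ih
  | tick _ ih => exact .addCost (.const _) ih
  | save _ _ ih => exact .pair (.scale _ ih.fst) ih.snd
  | lam _ ih =>
    rw [potCtx_extend] at ih
    exact .pair (.const 0) (.lam ih)
  | lazyPair _ _ ih ih' => exact .pair (.const 0) (.pair ih ih')
  | inl _ ih => exact .pair ih.fst (.inl ih.snd)
  | inr _ ih => exact .pair ih.fst (.inr ih.snd)
  | fst _ ih => exact .addCost ih.fst ih.snd.fst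
  | snd _ ih => exact .addCost ih.fst ih.snd.snd
  | succ _ ih => exact .pair ih.fst (.succ ih.snd)
  | pack _ ih =>
    rw [Ty.inst, cpx_subst] at ih
    exact .pair ih.fst (.pair (CTm.credTm_typed _) ih.snd)

/-! ## Inequalities between closed costs and credits -/

namespace CLeClosed

/-- Only one direction of associativity is primitive; the other is obtained by rotating the summands
with commutativity. -/
theorem add_assoc_ge {E F G : CTm 0} (hE : CTyped E .cost) (hF : CTyped F .cost)
    (hG : CTyped G .cost) : CLeClosed (.add E (.add F G)) (.add (.add E F) G) .cost :=
  ((CLe.addComm hE (.add hF hG)).trans (.addAssoc hF hG hE)).trans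
    (((CLe.addComm hF (.add hG hE)).trans (.addAssoc hG hE hF)).trans (.addComm hG (.add hE hF)))

theorem add_add_add_comm {E F G H : CTm 0} (hE : CTyped E .cost) (hF : CTyped F .cost)
    (hG : CTyped G .cost) (hH : CTyped H .cost) :
    CLeClosed (.add (.add E F) (.add G H)) (.add (.add E G) (.add F H)) .cost := by
  refine (CLe.addAssoc hE hF (.add hG hH)).trans ?_
  refine CLe.trans (.add (.refl hE) ?_) (add_assoc_ge hE hG (.add hF hH))
  refine (add_assoc_ge hF hG hH).trans ?_
  exact (CLe.add (.addComm hF hG) (.refl hH)).trans (.addAssoc hG hF hH)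

/-- If neither net credit is `∞`, negation distributes and the summands are regrouped. Otherwise the
cost on the `∞` side is itself at least `∞`, by canonicity, and dominates the whole sum. -/
theorem cost_add {E F : CTm 0} {m m' : ℕ} {r r' : ExtInt}
    (h : CLeClosed (.const (ExtInt.ofInt m)) (.add E (.const r.neg)) .cost)
    (h' : CLeClosed (.const (ExtInt.ofInt m')) (.add F (.const r'.neg)) .cost) :
    CLeClosed (.const (ExtInt.ofInt (m + m' : ℕ))) (.add (.add E F) (.const (r + r').neg)) .cost := by
  have hE : CTyped E .cost := by cases h.typed.2 with | add h _ => exact h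
  have hF : CTyped F .cost := by cases h'.typed.2 with | add h _ => exact h
  by_cases hr : r = ⊤
  -- The hypothesis `h` now reads `m ≤ E + (-∞)`, so `∞ ≤ E`. The value of the combined negated
  -- credit no longer matters and is abstracted as `q`.
  · subst hr
    generalize (⊤ + r').neg = q
    refine (CLe.constLe le_top).trans ((CLe.topAdd (.add hF (.const q))).trans ?_)
    exact CLe.trans (.add (h.top_le (by simp)) (.refl (.add hF (.const q))))
      (add_assoc_ge hE hF (.const q))
  by_cases hr' : r' = ⊤
  · subst hr'
    generalize (r + ⊤).neg = q
    refine (CLe.constLe le_top).trans ((CLe.topAdd (.add hE (.const q))).trans ?_)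
    refine CLe.trans (.add (h'.top_le (by simp)) (.refl (.add hE (.const q)))) ?_
    exact (add_assoc_ge hF hE (.const q)).trans (.add (.addComm hF hE) (.refl (.const q)))
  rw [ExtInt.neg_add_of_ne_top hr hr', Nat.cast_add, ← ExtInt.ofInt_add]
  refine (CLe.constAdd _ _).trans ((CLe.add h h').trans ?_)
  exact (add_add_add_comm hE (.const _) hF (.const _)).trans
    (.add (.refl (.add hE hF)) (.addConst _ _))

/-- The ticks of a scrutinee are counted once although its credits are multiplied. Positivity of
multiplicities gives `m ≤ k m`, and `k (E - r) ≤ k E - k r` by subdistributivity. -/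
theorem cost_scale {E : CTm 0} {m : ℕ} {r : ExtInt} (k : Mult)
    (h : CLeClosed (.const (ExtInt.ofInt m)) (.add E (.const r.neg)) .cost) :
    CLeClosed (.const (ExtInt.ofInt m)) (.add (.scale k E) (.const (ExtInt.scale k.1 r).neg))
      .cost := by
  have hE : CTyped E .cost := by cases h.typed.2 with | add h _ => exact h
  have hk : ExtInt.ofInt m ≤ ExtInt.scale k.1 (ExtInt.ofInt m) := by
    rw [← ExtInt.ofENat_natCast, ExtInt.scale_ofENat, ExtInt.ofENat_le]
    exact le_mul_of_one_le_left' (Order.one_le_iff_pos.2 k.2)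
  rw [ExtInt.neg_scale]
  refine (CLe.constLe hk).trans ((CLe.constScale _ _).trans ((CLe.scale k h).trans ?_))
  exact (CLe.scaleAdd k hE (.const _)).trans (.add (.refl (.scale k hE)) (.scaleConst _ _))

theorem cost_const (m : ℕ) (q : ExtInt) (h : ExtInt.ofInt m ≤ q + ExtInt.neg 0) :
    CLeClosed (.const (ExtInt.ofInt m)) (.add (.const q) (.const (ExtInt.neg 0))) .cost :=
  (CLe.constLe h).trans (.constAdd _ _)

theorem cost_zero : CLeClosed (.const (ExtInt.ofInt (0 : ℕ))) (.add (.const 0) (.const (ExtInt.neg 0))) .cost :=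
  cost_const 0 0 (by simp [ExtInt.ofInt_zero])

theorem cost_mono {E F : CTm 0} {m : ℕ} {r : ExtInt}
    (h : CLeClosed (.const (ExtInt.ofInt m)) (.add E (.const r)) .cost) (hE : CLeClosed E F .cost) :
    CLeClosed (.const (ExtInt.ofInt m)) (.add F (.const r)) .cost :=
  h.trans (.add hE (.refl (.const _)))

theorem credMul {E : CTm 0} {m : ℕ} (h : CLeClosed (.credLit m) E .cred) (k : ℕ) :
    CLeClosed (.credLit (k * m)) (CTm.credMul k E) .cred := by
  induction k with
  | zero => rw [zero_mul]; exact .refl (.credLit 0)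
  | succ k ih =>
    rw [add_mul, one_mul, add_comm]
    exact (CLe.credAddLit m (k * m)).credSymm.trans (.credAdd h ih)

theorem credTm {δ n : ℕ} {w : Fin δ → ℕ} {W : Fin δ → CTm 0} (h : CredBdd w W) (c : Cred δ)
    (T : Fin n → CTm 0) :
    CLeClosed (.credLit (c.subst (closeCred w)).const)
      ((Amortized.credTm n c).subst (Fin.append W T)) .cred := by
  -- The numeral is rewritten as a sum over the list of variables that `credTm` folds over, so that
  -- one induction on that list treats both sides.
  have hc : (c.subst (closeCred w)).const =
      ((List.finRange δ).map fun i => c.coef i * w i).sum + c.const := by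
    rw [← Fin.sum_univ_def, add_comm]
    rfl
  rw [hc, Amortized.credTm]
  induction List.finRange δ with
  | nil =>
    simp only [List.map_nil, List.sum_nil, zero_add]
    exact CLe.refl (.credLit _)
  | cons i l ih =>
    rw [List.map_cons, List.sum_cons, add_assoc]
    refine (CLe.credAddLit _ _).credSymm.trans (.credAdd ?_ ih)
    rw [CTm.subst_credMul]
    refine credMul ?_ _
    simpa [CTm.subst] using h i

end CLeClosed

/-! ## Values -/

/-- Closed values. -/
inductive IsValue : Tm 0 0 → Prop
  | unit : IsValue .unit
  | pair {v w : Tm 0 0} : IsValue v → IsValue w → IsValue (.pair v w)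
  | inl {v : Tm 0 0} : IsValue v → IsValue (.inl v)
  | inr {v : Tm 0 0} : IsValue v → IsValue (.inr v)
  | lazyPair {M N : Tm 0 0} : IsValue (.lazyPair M N)
  | lam {M : Tm 0 1} : IsValue (.lam M)
  | save {k : Mult} {c : Cred 0} {v : Tm 0 0} : IsValue v → IsValue (.save k c v)
  | zero : IsValue .zero
  | succ {v : Tm 0 0} : IsValue v → IsValue (.succ v)
  | nil : IsValue .nil
  | cons {v w : Tm 0 0} : IsValue v → IsValue w → IsValue (.cons v w)
  | pack {c : Cred 0} {v : Tm 0 0} : IsValue v → IsValue (.pack c v)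

theorem IsValue.eval_self {v : Tm 0 0} (h : IsValue v) : Eval v 0 0 v := by
  induction h with
  | unit => exact .unit
  | pair _ _ ih ih' => simpa using Eval.pair ih ih'
  | inl _ ih => exact .inl ih
  | inr _ ih => exact .inr ih
  | lazyPair => exact .lazyPair
  | lam => exact .lam
  | save _ ih => simpa using Eval.save ih
  | zero => exact .zero
  | succ _ ih => exact .succ ih
  | nil => exact .nil
  | cons _ _ ih ih' => simpa using Eval.cons ih ih'
  | pack _ ih => exact .pack ih

/-- Makes the expression relation at a value collapse to the value relation. It is needed when a
substituted variable is evaluated and when a recursor re-evaluates its already computed arguments.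
-/
theorem IsValue.eval_eq {v : Tm 0 0} (h : IsValue v) :
    ∀ {m : ℕ} {r : ExtInt} {w : Tm 0 0}, Eval v m r w → m = 0 ∧ r = 0 ∧ w = v := by
  induction h with
  | unit | lazyPair | lam | zero | nil => intro m r w h; cases h; exact ⟨rfl, rfl, rfl⟩
  | pair _ _ ih ih' =>
    intro m r w h
    cases h with | pair h h' =>
    obtain ⟨rfl, rfl, rfl⟩ := ih h
    obtain ⟨rfl, rfl, rfl⟩ := ih' h'
    simp
  | cons _ _ ih ih' =>
    intro m r w h
    cases h with | cons h h' =>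
    obtain ⟨rfl, rfl, rfl⟩ := ih h
    obtain ⟨rfl, rfl, rfl⟩ := ih' h'
    simp
  | inl _ ih =>
    intro m r w h
    cases h with | inl h =>
    obtain ⟨rfl, rfl, rfl⟩ := ih h
    simp
  | inr _ ih =>
    intro m r w h
    cases h with | inr h =>
    obtain ⟨rfl, rfl, rfl⟩ := ih h
    simp
  | succ _ ih =>
    intro m r w h
    cases h with | succ h =>
    obtain ⟨rfl, rfl, rfl⟩ := ih h
    simp
  | pack _ ih =>
    intro m r w h
    cases h with | pack h =>
    obtain ⟨rfl, rfl, rfl⟩ := ih h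
    simp
  | save _ ih =>
    intro m r w h
    cases h with | save h =>
    obtain ⟨rfl, rfl, rfl⟩ := ih h
    simp

theorem NatBdd.isValue {v : Tm 0 0} {E : CTm 0} (h : NatBdd v E) : IsValue v := by
  induction h with
  | zero => exact .zero
  | succ _ _ ih => exact .succ ih

theorem ListBdd.isValue {T : CTy} {V : ℕ∞ → Tm 0 0 → CTm 0 → Prop} {a : ℕ∞} {v : Tm 0 0} {E : CTm 0}
    (hV : ∀ a v E, V a v E → IsValue v) (h : ListBdd T V a v E) : IsValue v := by
  induction h with
  | nil => exact .nil
  | cons _ h _ ih => exact .cons (hV _ _ _ h) ih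

/-- Structural induction does not apply: the witness of an existential has type `B.inst c`, which is
not a subterm of `.ex B` but has smaller size. -/
theorem Ty.size_induction {P : Ty 0 → Prop} (h : ∀ A, (∀ B : Ty 0, B.size < A.size → P B) → P A)
    (A : Ty 0) : P A :=
  (measure Ty.size).wf.induction A h

theorem ValBdd.isValue {A : Ty 0} {a : ℕ∞} {v : Tm 0 0} {E : CTm 0} (h : ValBdd A a v E) :
    IsValue v := by
  induction A using Ty.size_induction generalizing a v E with | _ A ih
  rw [ValBdd.eq_def] at h
  cases A with
  | unit => exact h.2.2.1 ▸ .unit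
  | tensor B C =>
    obtain ⟨_, _, _, _, _, _, rfl, _, h₁, h₂⟩ := h
    exact .pair (ih B (by simp only [Ty.size]; omega) h₁) (ih C (by simp only [Ty.size]; omega) h₂)
  | plus B C =>
    obtain ⟨_, _, ⟨_, _, rfl, _, h⟩ | ⟨_, _, rfl, _, h⟩⟩ := h
    exacts [.inl (ih B (by simp only [Ty.size]; omega) h), .inr (ih C (by simp only [Ty.size]; omega) h)]
  | amp B C =>
    obtain ⟨_, _, _, _, rfl, _⟩ := h
    exact .lazyPair
  | lolli B C =>
    obtain ⟨_, _, _, rfl, _⟩ := h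
    exact .lam
  | bang k c B =>
    obtain ⟨_, _, _, _, rfl, _, h⟩ := h
    exact .save (ih B (by simp only [Ty.size]; omega) h)
  | nat => exact h.2.2.isValue
  | list B => exact h.2.2.isValue fun _ _ _ => ih B (by simp only [Ty.size]; omega)
  | ex B =>
    obtain ⟨_, _, c, _, rfl, _, h⟩ := h
    exact .pack (ih (B.inst c) (by simp only [Ty.size, Ty.size_inst]; omega) h)

theorem Typed.mono {a b : ℕ∞} {M : Tm 0 0} {A : Ty 0} (h : Typed a M A) (hab : a ≤ b) :
    Typed b M A :=
  HasTy.mono h ⟨fun i => i.elim0, fun i => i.elim0, hab⟩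

/-- Monotonicity of `V` is a hypothesis so that the lemma can be applied to the induction hypothesis
within the proof of `ValBdd.mono`. -/
theorem ExpBdd.mono {A : Ty 0} {V : ℕ∞ → Tm 0 0 → CTm 0 → Prop} {a b : ℕ∞} {M : Tm 0 0} {E F : CTm 0}
    (hV : ∀ {a b v E F}, V a v E → a ≤ b → CLeClosed E F (pot A) → V b v F)
    (h : ExpBdd A V a M E) (hab : a ≤ b) (hEF : CLeClosed E F (cpx A)) : ExpBdd A V b M F := by
  obtain ⟨h₁, h₂, h₃⟩ := h
  refine ⟨h₁.mono hab, hEF.typed.2, fun m r v hv => ?_⟩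
  obtain ⟨hm, c, hc, hcV⟩ := h₃ m r v hv
  refine ⟨CLeClosed.cost_mono hm hEF.fst, ?_⟩
  obtain ⟨d, hd, hcd⟩ := ExtInt.exists_ofENat_of_le
    (hc.le.trans (add_le_add_left (ExtInt.ofENat_le.2 hab) r))
  exact ⟨d, hd, hV hcV hcd hEF.snd⟩

theorem NatBdd.mono {v : Tm 0 0} {E F : CTm 0} (h : NatBdd v E) (hEF : CLeClosed E F .nat) :
    NatBdd v F := by
  cases h with
  | zero h => exact .zero (h.trans hEF)
  | succ h h' => exact .succ (h.trans hEF) h'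

theorem ListBdd.mono {T : CTy} {V : ℕ∞ → Tm 0 0 → CTm 0 → Prop} {a b : ℕ∞} {v : Tm 0 0} {E F : CTm 0}
    (h : ListBdd T V a v E) :
    a ≤ b → CLeClosed E F (.list T) → ListBdd T V b v F := by
  induction h generalizing b F with
  | nil h => exact fun _ hEF => .nil (h.trans hEF)
  | cons h h₁ h₂ ih =>
    intro hab hEF
    obtain ⟨c, rfl⟩ := le_iff_exists_add.1 hab
    rw [add_assoc]
    exact .cons (h.trans hEF) h₁ (ih le_self_add (.refl (by
      cases h.typed.1 with | cons _ h => exact h)))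

/-- The surplus bank goes to the second component of a tensor and to the tail of a list, is passed
to both sides of a lazy pair and to the result of a function, and is mere slack at `!`. Enlarging
the potential uses transitivity or congruence of the eliminators. -/
theorem ValBdd.mono {A : Ty 0} {a b : ℕ∞} {v : Tm 0 0} {E F : CTm 0} (h : ValBdd A a v E)
    (hab : a ≤ b) (hEF : CLeClosed E F (pot A)) : ValBdd A b v F := by
  induction A using Ty.size_induction generalizing a b v E F with | _ A ih
  rw [ValBdd.eq_def] at h ⊢
  obtain ⟨h₁, _, h⟩ := h
  refine ⟨h₁.mono hab, hEF.typed.2, ?_⟩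
  cases A with
  | unit => exact ⟨h.1, h.2.trans hEF⟩
  | tensor B C =>
    obtain ⟨v₁, v₂, a₁, a₂, h, h', h₁, h₂⟩ := h
    obtain ⟨c, rfl⟩ := le_iff_exists_add.1 hab
    exact ⟨v₁, v₂, a₁, a₂ + c, h, by rw [← h', add_assoc], ih B (by simp only [Ty.size]; omega) h₁ le_rfl hEF.fst,
      ih C (by simp only [Ty.size]; omega) h₂ le_self_add hEF.snd⟩
  | plus B C =>
    obtain ⟨v', E', h, h', h₁⟩ | ⟨v', E', h, h', h₁⟩ := h
    · exact .inl ⟨v', E', h, h'.trans hEF, ih B (by simp only [Ty.size]; omega) h₁ hab (.refl (by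
        cases h'.typed.1 with | inl h => exact h))⟩
    · exact .inr ⟨v', E', h, h'.trans hEF, ih C (by simp only [Ty.size]; omega) h₁ hab (.refl (by
        cases h'.typed.1 with | inr h => exact h))⟩
  | amp B C =>
    obtain ⟨M, N, h, h₁, h₂⟩ := h
    exact ⟨M, N, h, ExpBdd.mono (ih B (by simp only [Ty.size]; omega)) h₁ hab hEF.fst,
      ExpBdd.mono (ih C (by simp only [Ty.size]; omega)) h₂ hab hEF.snd⟩
  | lolli B C =>
    obtain ⟨M, h, h'⟩ := h
    refine ⟨M, h, fun d w E' hw => ExpBdd.mono (ih C (by simp only [Ty.size]; omega)) (h' d w E' hw) (by gcongr) ?_⟩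
    rw [ValBdd.eq_def] at hw
    exact .app hEF hw.2.1
  | bang k c B =>
    obtain ⟨v', d, h, hd, h'⟩ := h
    exact ⟨v', d, h, hd.trans hab, ih B (by simp only [Ty.size]; omega) h' le_rfl hEF⟩
  | nat => exact NatBdd.mono h hEF
  | list B => exact ListBdd.mono h hab hEF
  | ex B =>
    obtain ⟨c, v', h, h', h₁⟩ := h
    exact ⟨c, v', h, h'.trans hEF.fst, ih (B.inst c) (by simp only [Ty.size, Ty.size_inst]; omega) h₁ hab (by
      rw [Ty.inst, pot_subst]; exact hEF.snd)⟩

/-! ## Values of resource terms -/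

namespace Res

variable {δ n : ℕ} (w : Fin δ → ℕ) (s : Fin n → ℕ∞)

@[simp] theorem eval_add (f g : Res δ n) : (f + g).eval w s = f.eval w s + g.eval w s := by
  simp only [eval, add_var, add_cvar, add_const, add_mul, Finset.sum_add_distrib]
  ac_rfl

@[simp] theorem eval_scale (k : ℕ∞) (f : Res δ n) : (f.scale k).eval w s = k * f.eval w s := by
  simp only [eval, scale, mul_add, Finset.mul_sum, mul_assoc]

@[simp] theorem eval_push (f : Res δ n) (k a : ℕ∞) :
    (f.push k).eval w (extend s a) = f.eval w s + k * a := by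
  simp only [eval, push, Fin.sum_univ_castSucc, extend_castSucc, extend_last]
  ac_rfl

@[simp] theorem eval_ofCred (c : Cred δ) :
    (ofCred c : Res δ n).eval w s = ((c.subst (closeCred w)).const : ℕ∞) := by
  simp [eval, ofCred, Cred.subst, closeCred, Cred.lit, add_comm]

@[simp] theorem eval_cweaken (f : Res δ n) (l : ℕ) :
    f.cweaken.eval (extend w l) s = f.eval w s := by
  simp [eval, cweaken, Fin.sum_univ_castSucc]

@[simp] theorem eval_ofVar (j : Fin n) : (ofVar j : Res δ n).eval w s = s j := by
  simp [eval, ofVar, Pi.single_apply]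

theorem eval_mono {f g : Res δ n} (h : f ≤ g) : f.eval w s ≤ g.eval w s := by
  unfold eval
  gcongr
  exacts [h.1 _, h.2.1 _, h.2.2]

theorem push_mono_right (f : Res δ n) {k l : ℕ∞} (h : k ≤ l) : f.push k ≤ f.push l :=
  ⟨fun j => by induction j using Fin.lastCases <;> simp [push, h], fun _ => le_rfl, le_rfl⟩

theorem bank_add (a b : ℕ∞) : (bank a + bank b : Res δ n) = bank (a + b) := by
  ext <;> simp [bank]

end Res

theorem Typed.pair {a b : ℕ∞} {M N : Tm 0 0} {A B : Ty 0} (h : Typed a M A) (h' : Typed b N B) :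
    Typed (a + b) (.pair M N) (.tensor A B) := by
  rw [Typed, ← Res.bank_add]
  exact HasTy.pair h h'

theorem Typed.cons {a b : ℕ∞} {M N : Tm 0 0} {A : Ty 0} (h : Typed a M A)
    (h' : Typed b N (.list A)) : Typed (a + b) (.cons M N) (.list A) := by
  rw [Typed, ← Res.bank_add]
  exact HasTy.cons h h'

theorem Typed.nrec {a b c : ℕ∞} {M N₁ N₂ : Tm 0 0} {C : Ty 0} (h : Typed a M .nat)
    (h₁ : Typed b N₁ (.lolli .unit C))
    (h₂ : Typed c N₂ (.bang .inf (.lit 0) (.lolli (.tensor .nat (.lolli .unit C)) C))) :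
    Typed (a + b + c) (.nrec M N₁ N₂) C := by
  rw [Typed, ← Res.bank_add, ← Res.bank_add]
  exact HasTy.nrec h h₁ h₂

theorem Typed.lrec {a b c : ℕ∞} {M N₁ N₂ : Tm 0 0} {A C : Ty 0} (h : Typed a M (.list A))
    (h₁ : Typed b N₁ (.lolli .unit C))
    (h₂ : Typed c N₂ (.bang .inf (.lit 0) (.lolli (.tensor A (.amp (.list A) C)) C))) :
    Typed (a + b + c) (.lrec M N₁ N₂) C := by
  rw [Typed, ← Res.bank_add, ← Res.bank_add]
  exact HasTy.lrec h h₁ h₂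

theorem Typed.save {a d : ℕ∞} {k : Mult} {c : Cred 0} {M : Tm 0 0} {A : Ty 0} (h : Typed d M A)
    (ha : k.1 * d + (c.const : ℕ∞) ≤ a) : Typed a (.save k c M) (.bang k c A) :=
  HasTy.save h ⟨fun i => i.elim0, fun i => i.elim0, ha⟩

/-! ## Basic facts on the bounding relations -/

theorem ValBdd.typed {A : Ty 0} {a : ℕ∞} {v : Tm 0 0} {E : CTm 0} (h : ValBdd A a v E) :
    Typed a v A := by
  rw [ValBdd.eq_def] at h
  exact h.1

theorem ValBdd.ctyped {A : Ty 0} {a : ℕ∞} {v : Tm 0 0} {E : CTm 0} (h : ValBdd A a v E) :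
    CTyped E (pot A) := by
  rw [ValBdd.eq_def] at h
  exact h.2.1

/-- The conclusion that the expression bounding relation draws from an evaluation. -/
def Outcome (A : Ty 0) (a : ℕ∞) (m : ℕ) (r : ExtInt) (v : Tm 0 0) (E : CTm 0) : Prop :=
  CLeClosed (.const (ExtInt.ofInt m)) (.add (.fst E) (.const r.neg)) .cost ∧
    ∃ b : ℕ∞, ExtInt.ofENat b = ExtInt.ofENat a + r ∧ ValBdd A b v (.snd E)

/-- Bounding of a closed expression, with the value bounding relation of its type. -/
abbrev Bdd (A : Ty 0) (a : ℕ∞) (M : Tm 0 0) (E : CTm 0) : Prop := ExpBdd A (ValBdd A) a M E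

theorem ExpBdd.outcome {A : Ty 0} {a : ℕ∞} {M : Tm 0 0} {E : CTm 0} (h : Bdd A a M E) {m : ℕ}
    {r : ExtInt} {v : Tm 0 0} (hv : Eval M m r v) : Outcome A a m r v E :=
  h.2.2 m r v hv

theorem ExpBdd.le {A : Ty 0} {a b : ℕ∞} {M : Tm 0 0} {E F : CTm 0} (h : Bdd A a M E) (hab : a ≤ b)
    (hEF : CLeClosed E F (cpx A)) : Bdd A b M F :=
  ExpBdd.mono (fun h => h.mono) h hab hEF

/-- Extraction yields literal pairs whereas the relation inspects projections; each component lies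
below the projection of the pair. -/
theorem Outcome.of_pair {A : Ty 0} {a b : ℕ∞} {m : ℕ} {r : ExtInt} {v : Tm 0 0} {E F : CTm 0}
    (hm : CLeClosed (.const (ExtInt.ofInt m)) (.add E (.const r.neg)) .cost)
    (hb : ExtInt.ofENat b = ExtInt.ofENat a + r) (hv : ValBdd A b v F) :
    Outcome A a m r v (.pair E F) := by
  have hE : CTyped E .cost := by cases hm.typed.2 with | add h _ => exact h
  exact ⟨CLeClosed.cost_mono hm (.betaFst hE hv.ctyped), b, hb,
    hv.mono le_rfl (.betaSnd hE hv.ctyped)⟩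

/-- A value is bounded by its potential, paired with the cost `0`. -/
theorem ValBdd.outcome {A : Ty 0} {a : ℕ∞} {v : Tm 0 0} {E : CTm 0} (hv : ValBdd A a v E) :
    Outcome A a 0 0 v (.pair (.const 0) E) :=
  .of_pair CLeClosed.cost_zero (by simp) hv

theorem ValBdd.bdd {A : Ty 0} {a : ℕ∞} {v : Tm 0 0} {E : CTm 0} (hv : ValBdd A a v E) :
    Bdd A a v (.pair (.const 0) E) := by
  refine ⟨hv.typed, .pair (.const 0) hv.ctyped, fun m r w h => ?_⟩
  obtain ⟨rfl, rfl, rfl⟩ := hv.isValue.eval_eq h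
  exact hv.outcome

/-- Composition of two stages, the second run from bank `a'`. The link `ha` is only an inequality
because scaled banks satisfy no better; the excess is absorbed by monotonicity in the bank of the
final value. -/
theorem Outcome.seq {A : Ty 0} {a a' : ℕ∞} {m m' : ℕ} {r r' : ExtInt} {v : Tm 0 0} {E F : CTm 0}
    (hm : CLeClosed (.const (ExtInt.ofInt m)) (.add E (.const r.neg)) .cost)
    (ha : ExtInt.ofENat a' ≤ ExtInt.ofENat a + r) (h : Outcome A a' m' r' v F) :
    Outcome A a (m + m') (r + r') v (.addCost E F) := by
  obtain ⟨hm', b, hb, hv⟩ := h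
  obtain ⟨b', hb', hbb'⟩ := ExtInt.exists_ofENat_of_le
    (hb.le.trans (add_le_add_left ha r'))
  exact .of_pair (CLeClosed.cost_add hm hm') (by rw [hb', add_assoc]) (hv.mono hbb' (.refl hv.ctyped))

theorem Outcome.le {A : Ty 0} {a : ℕ∞} {m : ℕ} {r : ExtInt} {v : Tm 0 0}
    {E F : CTm 0} (h : Outcome A a m r v E) (hEF : CLeClosed E F (cpx A)) : Outcome A a m r v F := by
  obtain ⟨hm, b, hb, hv⟩ := h
  exact ⟨CLeClosed.cost_mono hm hEF.fst, b, hb, hv.mono le_rfl hEF.snd⟩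

/-- A scrutinee used with multiplicity `k` hands over `k b` and is paid from `k a` with net credit
`k r`, while `g` is the continuation's own bank. Subdistributivity of scaling turns the equation
into an inequality. -/
theorem ExtInt.scale_resource_le (k : Mult) {a b : ℕ∞} (g : ℕ∞) {r : ExtInt}
    (h : ofENat b = ofENat a + r) :
    ofENat (k.1 * b + g) ≤ ofENat (k.1 * a + g) + scale k.1 r := by
  rw [ofENat_add, ofENat_add, ← scale_ofENat, ← scale_ofENat, h, add_right_comm]
  exact add_le_add_left (scale_add_le k _ _) _

/-! ## Recursors -/

theorem NatBdd.typed {v : Tm 0 0} {E : CTm 0} (h : NatBdd v E) : Typed 0 v .nat := by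
  induction h with
  | zero => exact HasTy.zero
  | succ _ _ ih => exact HasTy.succ ih

theorem NatBdd.ctyped {v : Tm 0 0} {E : CTm 0} (h : NatBdd v E) : CTyped E .nat := by
  cases h with
  | zero h => exact h.typed.2
  | succ h _ => exact h.typed.2

theorem NatBdd.valBdd {v : Tm 0 0} {E : CTm 0} (h : NatBdd v E) : ValBdd .nat 0 v E := by
  rw [ValBdd.eq_def]
  exact ⟨h.typed, h.ctyped, h⟩

theorem ListBdd.typed {A : Ty 0} {a : ℕ∞} {v : Tm 0 0} {E : CTm 0}
    (h : ListBdd (pot A) (ValBdd A) a v E) : Typed a v (.list A) := by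
  induction h with
  | nil => exact HasTy.nil
  | cons _ h _ ih => exact h.typed.cons ih

theorem ListBdd.ctyped {T : CTy} {V : ℕ∞ → Tm 0 0 → CTm 0 → Prop} {a : ℕ∞} {v : Tm 0 0} {E : CTm 0}
    (h : ListBdd T V a v E) : CTyped E (.list T) := by
  cases h with
  | nil h => exact h.typed.2
  | cons h _ => exact h.typed.2

theorem ListBdd.valBdd {A : Ty 0} {a : ℕ∞} {v : Tm 0 0} {E : CTm 0}
    (h : ListBdd (pot A) (ValBdd A) a v E) : ValBdd (.list A) a v E := by
  rw [ValBdd.eq_def]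
  exact ⟨h.typed, h.ctyped, h⟩

theorem ValBdd.unit : ValBdd .unit 0 .unit .unit := by
  rw [ValBdd.eq_def]
  exact ⟨HasTy.unit, .unit, rfl, CLe.refl .unit⟩

theorem ValBdd.lam_app {B C : Ty 0} {a d : ℕ∞} {M : Tm 0 1} {w : Tm 0 0} {E F : CTm 0}
    (h : ValBdd (.lolli B C) a (.lam M) E) (hw : ValBdd B d w F) :
    Bdd C (a + d) (M.inst w) (.app E F) := by
  rw [ValBdd.eq_def] at h
  obtain ⟨_, _, _, h, h'⟩ := h
  cases h
  exact h' d w F hw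

theorem ValBdd.pair {B C : Ty 0} {a b : ℕ∞} {v w : Tm 0 0} {E : CTm 0} (h : ValBdd B a v (.fst E))
    (h' : ValBdd C b w (.snd E)) (hE : CTyped E (.prod (pot B) (pot C))) :
    ValBdd (.tensor B C) (a + b) (.pair v w) E := by
  rw [ValBdd.eq_def]
  exact ⟨h.typed.pair h'.typed, hE, v, w, a, b, rfl, rfl, h, h'⟩

/-- A bank saved with multiplicity `∞` is not diminished by taking out one copy. -/
theorem ENat.top_mul_add_self (d : ℕ∞) : d + ⊤ * d = ⊤ * d := by
  rcases eq_or_ne d 0 with rfl | hd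
  · simp
  · simp [ENat.top_mul hd]

/-- The step function of the recurrence extracted from a recursor on natural numbers. -/
def CTm.nrecStep {n : ℕ} (E : CTm n) : CTm n :=
  .lam (.app E.weaken (.pair (.fst (.var (Fin.last n)))
    (.lam (CTm.weaken (.snd (.var (Fin.last n)))))))

/-- The step function of the recurrence extracted from a recursor on lists. -/
def CTm.lrecStep {n : ℕ} (E : CTm n) : CTm n :=
  .lam (.app E.weaken (.pair (.fst (.var (Fin.last n)))
    (.pair (.pair (.const 0) (.fst (.snd (.var (Fin.last n)))))
      (.snd (.snd (.var (Fin.last n)))))))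

theorem CTm.subst_nrecStep {n m : ℕ} (E : CTm n) (t : Fin n → CTm m) :
    (nrecStep E).subst t = nrecStep (E.subst t) := by
  simp only [nrecStep, subst, weaken_subst_lift, lift_last]

theorem CTm.subst_lrecStep {n m : ℕ} (E : CTm n) (t : Fin n → CTm m) :
    (lrecStep E).subst t = lrecStep (E.subst t) := by
  simp only [lrecStep, subst, weaken_subst_lift, lift_last]

theorem CHasTy.var_last {n : ℕ} {Γ : Fin n → CTy} (S : CTy) :
    CHasTy (Amortized.extend Γ S) (.var (Fin.last n)) S := by
  simpa using CHasTy.var (Γ := Amortized.extend Γ S) (Fin.last n)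

theorem CHasTy.nrecStep {n : ℕ} {Γ : Fin n → CTy} {E : CTm n} {T : CTy}
    (h : CHasTy Γ E (.arr (.prod .nat (.arr .unit T)) T)) :
    CHasTy Γ E.nrecStep (.arr (.prod .nat T) T) :=
  .lam (.app h.weaken (.pair (var_last _).fst (.lam (var_last _).snd.weaken)))

theorem CHasTy.lrecStep {n : ℕ} {Γ : Fin n → CTy} {E : CTm n} {S T : CTy}
    (h : CHasTy Γ E (.arr (.prod S (.prod (.prod .cost (.list S)) T)) T)) :
    CHasTy Γ E.lrecStep (.arr (.prod S (.prod (.list S) T)) T) :=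
  .lam (.app h.weaken (.pair (var_last _).fst
    (.pair (.pair (.const 0) (var_last _).snd.fst) (var_last _).snd.snd)))

theorem CLeClosed.nrecStep {E F : CTm 0} {T : CTy}
    (hE : CTyped E (.arr (.prod .nat (.arr .unit T)) T)) (hF : CTyped F (.prod .nat T)) :
    CLeClosed (.app E (.pair (.fst F) (.lam (CTm.weaken (.snd F))))) (.app E.nrecStep F) T := by
  have h := CLe.betaLam (E := .app E.weaken (.pair (.fst (.var (Fin.last 0)))
    (.lam (CTm.weaken (.snd (.var (Fin.last 0)))))))
    (.app hE.weaken (.pair (CHasTy.var_last _).fst (.lam (CHasTy.var_last _).snd.weaken))) hF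
  simp only [CTm.inst, CTm.subst, CTm.weaken_subst_extend, CTm.weaken_subst_lift, extend_last,
    CTm.subst_var] at h
  exact h

theorem CLeClosed.lrecStep {E F : CTm 0} {S T : CTy}
    (hE : CTyped E (.arr (.prod S (.prod (.prod .cost (.list S)) T)) T))
    (hF : CTyped F (.prod S (.prod (.list S) T))) :
    CLeClosed (.app E (.pair (.fst F) (.pair (.pair (.const 0) (.fst (.snd F))) (.snd (.snd F)))))
      (.app E.lrecStep F) T := by
  have h := CLe.betaLam (E := .app E.weaken (.pair (.fst (.var (Fin.last 0)))
    (.pair (.pair (.const 0) (.fst (.snd (.var (Fin.last 0)))))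
      (.snd (.snd (.var (Fin.last 0)))))))
    (.app hE.weaken (.pair (CHasTy.var_last _).fst
    (.pair (.pair (.const 0) (CHasTy.var_last _).snd.fst) (CHasTy.var_last _).snd.snd))) hF
  simp only [CTm.inst, CTm.subst, CTm.weaken_subst_extend, extend_last, CTm.subst_var] at h
  exact h

section Recursors

variable {A C : Ty 0} {b d : ℕ∞} {N₁ N₂ : Tm 0 1} {E₁ E₂ : CTm 0}

/-- Induction on the numeral with the fixed bank `b + ⊤ * d`. At a successor the step function
consumes `d` and its thunk argument needs the whole bank again; both fit because `d + ⊤ * d = ⊤ *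
d`. Numerals themselves need no credits. -/
theorem NatBdd.nrec_bdd (h₁ : ValBdd (.lolli .unit C) b (.lam N₁) E₁)
    (h₂ : ValBdd (.lolli (.tensor .nat (.lolli .unit C)) C) d (.lam N₂) E₂) {v : Tm 0 0} {E : CTm 0}
    (hv : NatBdd v E) :
    Bdd C (b + ⊤ * d) (.nrec v (.lam N₁) (.save .inf (.lit 0) (.lam N₂)))
      (.nrec E E₁ E₂.nrecStep) := by
  have c₁ := h₁.ctyped
  have c₂ := h₂.ctyped
  have hs : IsValue (.save .inf (.lit 0) (.lam N₂)) := .save .lam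
  have typed {v : Tm 0 0} (hv : Typed 0 v .nat) :
      Typed (b + ⊤ * d) (.nrec v (.lam N₁) (.save .inf (.lit 0) (.lam N₂))) C := by
    have := hv.nrec h₁.typed (h₂.typed.save (a := ⊤ * d) (k := .inf) (c := .lit 0)
      (by simp [Mult.inf, Cred.lit]))
    rwa [zero_add] at this
  induction hv with
  | @zero E hE =>
    refine ⟨typed HasTy.zero, CHasTy.nrec hE.typed.2 c₁ c₂.nrecStep, fun m r v h => ?_⟩
    cases h with
    | nrecSucc h => cases (IsValue.zero.eval_eq h).2.2
    | nrecZero e₁ e₂ e₃ e₄ =>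
      obtain ⟨rfl, rfl, -⟩ := IsValue.zero.eval_eq e₁
      obtain ⟨rfl, rfl, h⟩ := IsValue.lam.eval_eq e₂
      cases h
      obtain ⟨rfl, rfl, -⟩ := hs.eval_eq e₃
      simp only [zero_add]
      exact ((h₁.lam_app .unit).le (by simp) ((CLe.betaZero c₁ c₂.nrecStep).trans
        (.nrec hE c₁ c₂.nrecStep))).outcome e₄
  | @succ v E E' hE hv ih =>
    refine ⟨typed (HasTy.succ hv.typed), CHasTy.nrec hE.typed.2 c₁ c₂.nrecStep,
      fun m r u h => ?_⟩
    cases h with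
    | nrecZero h => cases ((IsValue.succ hv.isValue).eval_eq h).2.2
    | nrecSucc e₁ e₂ e₃ e₄ =>
      obtain ⟨rfl, rfl, h⟩ := (IsValue.succ hv.isValue).eval_eq e₁
      cases h
      obtain ⟨rfl, rfl, h⟩ := IsValue.lam.eval_eq e₂
      cases h
      obtain ⟨rfl, rfl, h⟩ := hs.eval_eq e₃
      cases h
      simp only [zero_add]
      have cE := hv.ctyped
      have cR : CTyped (.nrec E' E₁ E₂.nrecStep) (cpx C) := .nrec cE c₁ c₂.nrecStep
      -- `P` is what the recurrence recursor passes to its step function. `Q` is the form in which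
      -- `nrecStep` hands it to the extracted one, with the recursive result as a thunk.
      set P : CTm 0 := .pair E' (.nrec E' E₁ E₂.nrecStep) with hP
      have cP : CTyped P (.prod .nat (cpx C)) := .pair cE cR
      have cL : CTyped (.lam (CTm.weaken (.snd P))) (.arr .unit (cpx C)) := .lam cP.snd.weaken
      set Q : CTm 0 := .pair (.fst P) (.lam (CTm.weaken (.snd P))) with hQ
      have hQ₁ : CLeClosed E' (.fst Q) .nat := (CLe.betaFst cE cR).trans (.betaFst cP.fst cL)
      have hV : ValBdd (.tensor .nat (.lolli .unit C)) (0 + (b + ⊤ * d))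
          (.pair v (.lam (Tm.weaken (.nrec v (.lam N₁) (.save .inf (.lit 0) (.lam N₂)))))) Q := by
        refine .pair (hv.valBdd.mono le_rfl hQ₁) ?_ (.pair cP.fst cL)
        rw [ValBdd.eq_def]
        refine ⟨HasTy.lam ((HasTy.weaken (typed hv.typed)).mono ?_),
          CHasTy.snd (.pair cP.fst cL), _, rfl, fun d' w F hw => ?_⟩
        -- The thunk ignores its unit argument: weakening types the body with coefficient `0`, which
        -- is raised to the `1` that abstraction requires.
        · exact Res.push_mono_right _ zero_le
        · rw [Tm.weaken_inst]
          refine ih.le le_self_add ?_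
          refine (CLe.betaSnd cE cR).trans ?_
          have := CLe.betaLam (F := F) cP.snd.weaken hw.ctyped
          rw [CTm.weaken_inst] at this
          exact this.trans (.app (.betaSnd cP.fst cL) hw.ctyped)
      refine ((h₂.lam_app hV).le ?_ ?_).outcome e₄
      · rw [zero_add, add_left_comm, ENat.top_mul_add_self]
      · exact (CLeClosed.nrecStep c₂ cP).trans ((CLe.betaSucc cE c₁ c₂.nrecStep).trans
          (.nrec hE c₁ c₂.nrecStep))

/-- As for naturals, except that list elements own credits: the head takes `a₁`, the rest `a₂`. The
tail and the recursive call form a lazy pair, so each may claim the full bank `a₂ + b + ⊤ * d`. -/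
theorem ListBdd.lrec_bdd (h₁ : ValBdd (.lolli .unit C) b (.lam N₁) E₁)
    (h₂ : ValBdd (.lolli (.tensor A (.amp (.list A) C)) C) d (.lam N₂) E₂) {a : ℕ∞} {v : Tm 0 0}
    {E : CTm 0} (hv : ListBdd (pot A) (ValBdd A) a v E) :
    Bdd C (a + b + ⊤ * d) (.lrec v (.lam N₁) (.save .inf (.lit 0) (.lam N₂)))
      (.lrec E E₁ E₂.lrecStep) := by
  have c₁ := h₁.ctyped
  have c₂ := h₂.ctyped
  have hs : IsValue (.save .inf (.lit 0) (.lam N₂)) := .save .lam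
  have typed {a : ℕ∞} {v : Tm 0 0} (hv : Typed a v (.list A)) :
      Typed (a + b + ⊤ * d) (.lrec v (.lam N₁) (.save .inf (.lit 0) (.lam N₂))) C :=
    hv.lrec h₁.typed (h₂.typed.save (a := ⊤ * d) (k := .inf) (c := .lit 0)
      (by simp [Mult.inf, Cred.lit]))
  induction hv with
  | @nil a E hE =>
    refine ⟨typed HasTy.nil, CHasTy.lrec hE.typed.2 c₁ c₂.lrecStep, fun m r v h => ?_⟩
    cases h with
    | lrecCons h => cases (IsValue.nil.eval_eq h).2.2
    | lrecNil e₁ e₂ e₃ e₄ =>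
      obtain ⟨rfl, rfl, -⟩ := IsValue.nil.eval_eq e₁
      obtain ⟨rfl, rfl, h⟩ := IsValue.lam.eval_eq e₂
      cases h
      obtain ⟨rfl, rfl, -⟩ := hs.eval_eq e₃
      simp only [zero_add]
      refine ((h₁.lam_app .unit).le ?_ ((CLe.betaNil c₁ c₂.lrecStep).trans
        (.lrec hE c₁ c₂.lrecStep))).outcome e₄
      rw [add_zero, add_right_comm]
      exact le_add_self
  | @cons a₁ a₂ v₁ v₂ E F₁ F₂ hE hv₁ hv₂ ih =>
    have hv := hv₁.isValue.cons (hv₂.isValue fun _ _ _ => ValBdd.isValue)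
    refine ⟨typed (hv₁.typed.cons hv₂.typed), CHasTy.lrec hE.typed.2 c₁ c₂.lrecStep,
      fun m r u h => ?_⟩
    cases h with
    | lrecNil h => cases (hv.eval_eq h).2.2
    | lrecCons e₁ e₂ e₃ e₄ =>
      obtain ⟨rfl, rfl, h⟩ := hv.eval_eq e₁
      cases h
      obtain ⟨rfl, rfl, h⟩ := IsValue.lam.eval_eq e₂
      cases h
      obtain ⟨rfl, rfl, h⟩ := hs.eval_eq e₃
      cases h
      simp only [zero_add]
      have cF₁ := hv₁.ctyped
      have cF₂ := hv₂.ctyped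
      have cR : CTyped (.lrec F₂ E₁ E₂.lrecStep) (cpx C) := .lrec cF₂ c₁ c₂.lrecStep
      set R : CTm 0 := .lrec F₂ E₁ E₂.lrecStep with hR
      have cS : CTyped (.pair F₂ R) (.prod (.list (pot A)) (cpx C)) := .pair cF₂ cR
      set P : CTm 0 := .pair F₁ (.pair F₂ R) with hP
      have cP : CTyped P (.prod (pot A) (.prod (.list (pot A)) (cpx C))) := .pair cF₁ cS
      have cL : CTyped (.pair (.const 0) (.fst (.snd P))) (.prod .cost (.list (pot A))) :=
        .pair (.const 0) cP.snd.fst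
      have cK : CTyped (.pair (.pair (.const 0) (.fst (.snd P))) (.snd (.snd P)))
        (.prod (.prod .cost (.list (pot A))) (cpx C)) := .pair cL cP.snd.snd
      set Q : CTm 0 := .pair (.fst P) (.pair (.pair (.const 0) (.fst (.snd P))) (.snd (.snd P)))
        with hQ
      have cQ : CTyped Q (.prod (pot A) (.prod (.prod .cost (.list (pot A))) (cpx C))) :=
        .pair cP.fst cK
      have hP₂ : CLeClosed (.pair F₂ R) (.snd P) (.prod (.list (pot A)) (cpx C)) :=
        .betaSnd cF₁ cS
      have hQ₂ : CLeClosed (.pair (.pair (.const 0) (.fst (.snd P))) (.snd (.snd P))) (.snd Q)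
          (.prod (.prod .cost (.list (pot A))) (cpx C)) := .betaSnd cP.fst cK
      have hV : ValBdd (.tensor A (.amp (.list A) C)) (a₁ + (a₂ + b + ⊤ * d))
          (.pair v₁ (.lazyPair v₂ (.lrec v₂ (.lam N₁) (.save .inf (.lit 0) (.lam N₂))))) Q := by
        -- The head lies below the first projection of `Q` after two `β` expansions, one through `P`
        -- and one through the repackaging done by `lrecStep`.
        refine .pair (hv₁.mono le_rfl ((CLe.betaFst cF₁ cS).trans (.betaFst cP.fst cK))) ?_ cQ
        have hl : a₂ ≤ a₂ + b + ⊤ * d := le_self_add.trans le_self_add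
        rw [ValBdd.eq_def]
        refine ⟨HasTy.lazyPair (hv₂.typed.mono hl) (typed hv₂.typed), cQ.snd, _, _, rfl,
          ExpBdd.le (ValBdd.bdd (hv₂.valBdd.mono hl ((CLe.betaFst cF₂ cR).trans hP₂.fst))) le_rfl
            ((CLe.betaFst cL cP.snd.snd).trans hQ₂.fst),
          ExpBdd.le ih le_rfl ?_⟩
        exact (CLe.betaSnd cF₂ cR).trans (hP₂.snd.trans ((CLe.betaSnd cL cP.snd.snd).trans hQ₂.snd))
      refine ((h₂.lam_app hV).le ?_ ?_).outcome e₄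
      · rw [add_comm d, add_assoc a₁, add_assoc a₁, add_assoc (a₂ + b), add_comm _ d,
          ENat.top_mul_add_self, add_assoc a₁]
      · exact (CLeClosed.lrecStep c₂ cP).trans ((CLe.betaCons cF₁ cF₂ c₁ c₂.lrecStep).trans
          (.lrec hE c₁ c₂.lrecStep))

end Recursors

/-! ## Substitution instances of extracted recurrences -/

section Extract

variable {δ n : ℕ} (W : Fin δ → CTm 0) (T : Fin n → CTm 0)

/-- The closed recurrence that is obtained from the extraction of an open term. -/
def closedExtract (M : Tm δ n) : CTm 0 := (extract M).subst (Fin.append W T)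

theorem subst_extract_extend (M : Tm δ (n + 1)) (E : CTm 0) :
    CTm.subst (n := δ + n + 1) (extend (n := δ + n) (Fin.append W T) E)
      (extract (n := n + 1) M) =
      closedExtract W (extend T E) M := by
  rw [closedExtract, append_extend]

theorem closedExtract_split (k : Mult) (M : Tm δ n) (N : Tm δ (n + 2)) :
    closedExtract W T (.split k M N) =
      .addCost (.scale k (.fst (closedExtract W T M)))
        (closedExtract W (extend (extend T (.fst (.snd (closedExtract W T M))))
          (.snd (.snd (closedExtract W T M)))) N) := by
  have h := CTm.subst_inst₂ (n := δ + n) (extract (n := n + 2) N) (.fst (.snd (extract M)))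
    (.snd (.snd (extract M))) (Fin.append W T)
  have h' (E F : CTm 0) : Fin.append W (extend (extend T E) F) =
      extend (n := δ + n + 1) (extend (n := δ + n) (Fin.append W T) E) F :=
    (append_extend W (extend T E) F).trans
      (congrArg (fun u => extend (n := δ + n + 1) u F) (append_extend W T E))
  have hN (E F : CTm 0) : closedExtract W (extend (extend T E) F) N =
      CTm.subst (n := δ + n + 1 + 1)
        (extend (n := δ + n + 1) (extend (n := δ + n) (Fin.append W T) E) F)
        (extract (n := n + 2) N) :=
    congrArg (fun u => CTm.subst u (extract N)) (h' E F)
  rw [hN, closedExtract, extract]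
  exact congrArg (CTm.addCost _) h

theorem closedExtract_caseOf (k : Mult) (M : Tm δ n) (N₁ N₂ : Tm δ (n + 1)) :
    closedExtract W T (.caseOf k M N₁ N₂) =
      .addCost (.scale k (.fst (closedExtract W T M)))
        (.caseOf (.snd (closedExtract W T M))
          (CTm.subst (n := δ + n + 1) (CTm.lift (n := δ + n) (Fin.append W T))
            (extract (n := n + 1) N₁))
          (CTm.subst (n := δ + n + 1) (CTm.lift (n := δ + n) (Fin.append W T))
            (extract (n := n + 1) N₂))) := by
  rw [closedExtract, extract]
  rfl

theorem closedExtract_lam (M : Tm δ (n + 1)) :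
    closedExtract W T (.lam M) = .pair (.const 0)
      (.lam (CTm.subst (n := δ + n + 1) (CTm.lift (n := δ + n) (Fin.append W T))
            (extract (n := n + 1) M))) := by
  rw [closedExtract, extract]
  rfl

theorem closedExtract_transfer (k' k : Mult) (c : Cred δ) (M : Tm δ n) (N : Tm δ (n + 1)) :
    closedExtract W T (.transfer k' k c M N) =
      .addCost (.scale k' (.fst (closedExtract W T M)))
        (closedExtract W (extend T (.snd (closedExtract W T M))) N) := by
  rw [← subst_extract_extend, closedExtract, extract]
  exact congrArg (CTm.addCost _)
    (CTm.subst_inst (n := δ + n) (extract (n := n + 1) N) (.snd (extract M)) (Fin.append W T))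

/-- The substitution extends both halves of the context, the credits by the first projection of the
potential and the terms by the second. -/
theorem closedExtract_unpack (k : Mult) (M : Tm δ n) (N : Tm (δ + 1) (n + 1)) :
    closedExtract W T (.unpack k M N) =
      .addCost (.scale k (.fst (closedExtract W T M)))
        (closedExtract (extend W (.fst (.snd (closedExtract W T M))))
          (extend T (.snd (.snd (closedExtract W T M)))) N) := by
  rw [closedExtract, extract]
  refine congrArg (CTm.addCost _) ?_
  rw [CTm.subst_subst, closedExtract]
  congr 1
  funext i
  induction i using Fin.addCases with
  | left i =>
    rw [Fin.append_left, Fin.append_left]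
    induction i using Fin.lastCases <;> simp [CTm.subst, closedExtract]
  | right j =>
    rw [Fin.append_right, Fin.append_right]
    induction j using Fin.lastCases <;> simp [CTm.subst, closedExtract]

theorem closedExtract_nrec (M N₁ N₂ : Tm δ n) :
    closedExtract W T (.nrec M N₁ N₂) =
      .addCost (.add (.add (.fst (closedExtract W T M)) (.fst (closedExtract W T N₁)))
          (.fst (closedExtract W T N₂)))
        (.nrec (.snd (closedExtract W T M)) (.snd (closedExtract W T N₁))
          (CTm.nrecStep (.snd (closedExtract W T N₂)))) := by
  rw [closedExtract, extract]
  exact congrArg (fun F => CTm.addCost _ (CTm.nrec _ _ F)) (CTm.subst_nrecStep _ _)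

theorem closedExtract_lrec (M N₁ N₂ : Tm δ n) :
    closedExtract W T (.lrec M N₁ N₂) =
      .addCost (.add (.add (.fst (closedExtract W T M)) (.fst (closedExtract W T N₁)))
          (.fst (closedExtract W T N₂)))
        (.lrec (.snd (closedExtract W T M)) (.snd (closedExtract W T N₁))
          (CTm.lrecStep (.snd (closedExtract W T N₂)))) := by
  rw [closedExtract, extract]
  exact congrArg (fun F => CTm.addCost _ (CTm.lrec _ _ F)) (CTm.subst_lrecStep _ _)

end Extract

/-! ## Compatibility of the bounding relation with the term constructors -/

/-- The evaluations of all closing instances of an open term are bounded by its recurrence. -/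
def OutcomeBdd {δ n : ℕ} (Γ : Fin n → Ty δ) (f : Res δ n) (M : Tm δ n) (A : Ty δ) : Prop :=
  ∀ (w : Fin δ → ℕ) (W : Fin δ → CTm 0), CredBdd w W →
  ∀ (s : Fin n → ℕ∞) (t : Fin n → Tm 0 0) (T : Fin n → CTm 0),
    SubBdd (fun j => (Γ j).subst (closeCred w)) s t T →
    ∀ (m : ℕ) (r : ExtInt) (v : Tm 0 0), Eval ((M.csubst (closeCred w)).subst t) m r v →
      Outcome (A.subst (closeCred w)) (f.eval w s) m r v (closedExtract W T M)

theorem CredBdd.ctyped {δ n : ℕ} {w : Fin δ → ℕ} {W : Fin δ → CTm 0} (hw : CredBdd w W)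
    {Γ : Fin n → Ty δ} {s : Fin n → ℕ∞} {t : Fin n → Tm 0 0} {T : Fin n → CTm 0}
    (hs : SubBdd (fun j => (Γ j).subst (closeCred w)) s t T) (i : Fin (δ + n)) :
    CTyped (Fin.append W T i) (potCtx Γ i) := by
  induction i using Fin.addCases with
  | left i =>
    rw [Fin.append_left, potCtx_castAdd]
    exact (hw i).typed.2
  | right j => simpa using (hs j).ctyped

/-- The typing components are settled once here, so the constructor cases concern evaluation only.
Typings of subterms are still needed where unevaluated code enters a value (`lam`, `lazyPair`) or a
`β` rule (`caseOf`). -/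
theorem OutcomeBdd.openBdd {δ n : ℕ} {Γ : Fin n → Ty δ} {f : Res δ n} {M : Tm δ n} {A : Ty δ}
    (h : OutcomeBdd Γ f M A) (hM : HasTy Γ f M A) : OpenBdd Γ f M A (extract M) := by
  intro w W hw s t T hs
  refine ⟨hM.close w fun j => (hs j).typed, ?_, h w W hw s t T hs⟩
  rw [cpx_subst]
  exact hM.extract_typed.subst _ (hw.ctyped hs)

theorem SubBdd.extend {δ n : ℕ} {Γ : Fin n → Ty δ} {A : Ty δ} {c : Fin δ → Cred 0} {s : Fin n → ℕ∞}
    {t : Fin n → Tm 0 0} {T : Fin n → CTm 0} {a : ℕ∞} {v : Tm 0 0} {E : CTm 0}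
    (hs : SubBdd (fun j => (Γ j).subst c) s t T) (hv : ValBdd (A.subst c) a v E) :
    SubBdd (fun j => (Amortized.extend Γ A j).subst c) (Amortized.extend s a)
      (Amortized.extend t v) (Amortized.extend T E) := by
  intro j
  induction j using Fin.lastCases with
  | cast j => simpa using hs j
  | last => simpa using hv

namespace OutcomeBdd

variable {δ n : ℕ} {Γ : Fin n → Ty δ} {f g h : Res δ n} {A B C : Ty δ}

theorem var (j : Fin n) (hf : Res.ofVar j ≤ f) : OutcomeBdd Γ f (.var j) (Γ j) := by
  intro w W hw s t T hs m r v hv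
  have hb := (hs j).mono (by simpa using Res.eval_mono w s hf) (.refl (hs j).ctyped)
  obtain ⟨rfl, rfl, rfl⟩ := hb.isValue.eval_eq hv
  simpa [closedExtract, extract, CTm.subst] using hb.outcome

theorem unit : OutcomeBdd Γ f .unit .unit := by
  intro w W hw s t T hs m r v hv
  cases hv
  exact (ValBdd.unit.mono zero_le (.refl .unit)).outcome

theorem zero : OutcomeBdd Γ f .zero .nat := by
  intro w W hw s t T hs m r v hv
  cases hv
  exact ((NatBdd.zero (.refl .zero)).valBdd.mono zero_le (.refl .zero)).outcome

theorem nil : OutcomeBdd Γ f .nil (.list A) := by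
  intro w W hw s t T hs m r v hv
  cases hv
  exact (ListBdd.nil (.refl .nil)).valBdd.outcome

theorem pair {M N : Tm δ n} (hM : OutcomeBdd Γ f M A) (hN : OutcomeBdd Γ g N B) :
    OutcomeBdd Γ (f + g) (.pair M N) (.tensor A B) := by
  intro w W hw s t T hs m r v hv
  simp only [Tm.csubst, Tm.subst] at hv
  cases hv with | pair h₁ h₂ =>
  obtain ⟨c₁, b₁, hb₁, hV₁⟩ := hM w W hw s t T hs _ _ _ h₁
  obtain ⟨c₂, b₂, hb₂, hV₂⟩ := hN w W hw s t T hs _ _ _ h₂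
  refine .of_pair (CLeClosed.cost_add c₁ c₂) (b := b₁ + b₂) ?_ ?_
  · rw [Res.eval_add, ExtInt.ofENat_add, ExtInt.ofENat_add, hb₁, hb₂, add_add_add_comm]
  · exact .pair (hV₁.mono le_rfl (.betaFst hV₁.ctyped hV₂.ctyped))
      (hV₂.mono le_rfl (.betaSnd hV₁.ctyped hV₂.ctyped)) (.pair hV₁.ctyped hV₂.ctyped)

theorem cons {M N : Tm δ n} (hM : OutcomeBdd Γ f M A) (hN : OutcomeBdd Γ g N (.list A)) :
    OutcomeBdd Γ (f + g) (.cons M N) (.list A) := by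
  intro w W hw s t T hs m r v hv
  simp only [Tm.csubst, Tm.subst] at hv
  cases hv with | cons h₁ h₂ =>
  obtain ⟨c₁, b₁, hb₁, hV₁⟩ := hM w W hw s t T hs _ _ _ h₁
  obtain ⟨c₂, b₂, hb₂, hV₂⟩ := hN w W hw s t T hs _ _ _ h₂
  refine .of_pair (CLeClosed.cost_add c₁ c₂) (b := b₁ + b₂) ?_ ?_
  · rw [Res.eval_add, ExtInt.ofENat_add, ExtInt.ofENat_add, hb₁, hb₂, add_add_add_comm]
  · have hE := CHasTy.cons hV₁.ctyped hV₂.ctyped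
    rw [Ty.subst, ValBdd.eq_def] at hV₂
    exact (ListBdd.cons (.refl hE) hV₁ hV₂.2.2).valBdd

theorem split {k : Mult} {M : Tm δ n} {N : Tm δ (n + 2)} (hM : OutcomeBdd Γ f M (.tensor A B))
    (hN : OutcomeBdd (extend (extend Γ A) B) ((g.push k.1).push k.1) N C) :
    OutcomeBdd Γ (f.scale k.1 + g) (.split k M N) C := by
  intro w W hw s t T hs m r v hv
  simp only [Tm.csubst, Tm.subst] at hv
  cases hv with | split h₁ h₂ =>
  obtain ⟨c₁, b, hb, hV⟩ := hM w W hw s t T hs _ _ _ h₁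
  rw [Ty.subst, ValBdd.eq_def] at hV
  obtain ⟨_, _, v₁, v₂, a₁, a₂, h, rfl, hV₁, hV₂⟩ := hV
  cases h
  rw [Tm.inst₂_subst_lift] at h₂
  rw [closedExtract_split]
  refine .seq (CLeClosed.cost_scale k c₁) ?_
    (hN w W hw _ _ _ ((hs.extend hV₁).extend hV₂) _ _ _ h₂)
  have := ExtInt.scale_resource_le k (g.eval w s) hb
  simpa [mul_add, add_comm, add_assoc, add_left_comm] using this

theorem inl {M : Tm δ n} (hM : OutcomeBdd Γ f M A) : OutcomeBdd Γ f (.inl M) (.plus A B) := by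
  intro w W hw s t T hs m r v hv
  simp only [Tm.csubst, Tm.subst] at hv
  cases hv with | inl h₁ =>
  obtain ⟨c₁, b, hb, hV⟩ := hM w W hw s t T hs _ _ _ h₁
  refine .of_pair c₁ hb ?_
  rw [Ty.subst, ValBdd.eq_def]
  exact ⟨HasTy.inl hV.typed, .inl hV.ctyped, .inl ⟨_, _, rfl, .refl (.inl hV.ctyped), hV⟩⟩

theorem inr {M : Tm δ n} (hM : OutcomeBdd Γ f M B) : OutcomeBdd Γ f (.inr M) (.plus A B) := by
  intro w W hw s t T hs m r v hv
  simp only [Tm.csubst, Tm.subst] at hv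
  cases hv with | inr h₁ =>
  obtain ⟨c₁, b, hb, hV⟩ := hM w W hw s t T hs _ _ _ h₁
  refine .of_pair c₁ hb ?_
  rw [Ty.subst, ValBdd.eq_def]
  exact ⟨HasTy.inr hV.typed, .inr hV.ctyped, .inr ⟨_, _, rfl, .refl (.inr hV.ctyped), hV⟩⟩

theorem succ {M : Tm δ n} (hM : OutcomeBdd Γ f M .nat) : OutcomeBdd Γ f (.succ M) .nat := by
  intro w W hw s t T hs m r v hv
  simp only [Tm.csubst, Tm.subst] at hv
  cases hv with | succ h₁ =>
  obtain ⟨c₁, b, hb, hV⟩ := hM w W hw s t T hs _ _ _ h₁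
  refine .of_pair c₁ hb ?_
  rw [Ty.subst, ValBdd.eq_def] at hV ⊢
  exact ⟨HasTy.succ hV.1, .succ hV.2.1, .succ (.refl (.succ hV.2.1)) hV.2.2⟩

theorem caseOf {k : Mult} {M : Tm δ n} {N₁ N₂ : Tm δ (n + 1)} (hM : OutcomeBdd Γ f M (.plus A B))
    (h₁ : HasTy (extend Γ A) (g.push k.1) N₁ C) (h₂ : HasTy (extend Γ B) (g.push k.1) N₂ C)
    (hN₁ : OutcomeBdd (extend Γ A) (g.push k.1) N₁ C)
    (hN₂ : OutcomeBdd (extend Γ B) (g.push k.1) N₂ C) :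
    OutcomeBdd Γ (f.scale k.1 + g) (.caseOf k M N₁ N₂) C := by
  intro w W hw s t T hs m r v hv
  simp only [Tm.csubst, Tm.subst] at hv
  rw [closedExtract_caseOf]
  have c {A : Ty δ} {N : Tm δ (n + 1)} (h : HasTy (extend Γ A) (g.push k.1) N C) :
      CHasTy (extend Fin.elim0 (pot A))
        (CTm.subst (n := δ + n + 1) (CTm.lift (n := δ + n) (Fin.append W T))
            (extract (n := n + 1) N))
        (cpx C) := by
    have := h.extract_typed
    rw [potCtx_extend] at this
    exact this.subst _ (.lift _ (hw.ctyped hs))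
  have e (N : Tm δ (n + 1)) (E : CTm 0) :
      (CTm.subst (n := δ + n + 1) (CTm.lift (n := δ + n) (Fin.append W T))
            (extract (n := n + 1) N)).inst E =
        closedExtract W (extend T E) N := by
    rw [← subst_extract_extend]
    exact CTm.inst_subst_lift _ _ _
  cases hv with
  | caseInl e₁ e₂ =>
    obtain ⟨c₁, b, hb, hV⟩ := hM w W hw s t T hs _ _ _ e₁
    rw [Ty.subst, ValBdd.eq_def] at hV
    obtain ⟨_, _, ⟨v', E', h, hE, hV⟩ | ⟨v', E', h, hE, hV⟩⟩ := hV <;> cases h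
    rw [Tm.inst_subst_lift] at e₂
    simp only [pot_subst] at hE
    refine .seq (CLeClosed.cost_scale k c₁) ?_
      ((hN₁ w W hw _ _ _ (hs.extend hV) _ _ _ e₂).le ?_)
    · simpa [add_comm] using ExtInt.scale_resource_le k (g.eval w s) hb
    · rw [cpx_subst, ← e]
      -- The branch at `E'` is the reduct of a case on `inl E'`, and `inl E'` may be replaced by the
      -- larger potential since it stands in principal position.
      have hE' : CTyped E' (pot A) := by cases hE.typed.1 with | inl h => exact h
      exact (CLe.betaInl hE' (c h₁) (c h₂)).trans (.caseOf hE (c h₁) (c h₂))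
  | caseInr e₁ e₂ =>
    obtain ⟨c₁, b, hb, hV⟩ := hM w W hw s t T hs _ _ _ e₁
    rw [Ty.subst, ValBdd.eq_def] at hV
    obtain ⟨_, _, ⟨v', E', h, hE, hV⟩ | ⟨v', E', h, hE, hV⟩⟩ := hV <;> cases h
    rw [Tm.inst_subst_lift] at e₂
    simp only [pot_subst] at hE
    refine .seq (CLeClosed.cost_scale k c₁) ?_
      ((hN₂ w W hw _ _ _ (hs.extend hV) _ _ _ e₂).le ?_)
    · simpa [add_comm] using ExtInt.scale_resource_le k (g.eval w s) hb
    · rw [cpx_subst, ← e]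
      have hE' : CTyped E' (pot B) := by cases hE.typed.1 with | inr h => exact h
      exact (CLe.betaInr hE' (c h₁) (c h₂)).trans (.caseOf hE (c h₁) (c h₂))

theorem lazyPair {M N : Tm δ n} (tM : HasTy Γ f M A) (tN : HasTy Γ f N B)
    (hM : OutcomeBdd Γ f M A) (hN : OutcomeBdd Γ f N B) :
    OutcomeBdd Γ f (.lazyPair M N) (.amp A B) := by
  intro w W hw s t T hs m r v hv
  simp only [Tm.csubst, Tm.subst] at hv
  cases hv
  have bM := hM.openBdd tM w W hw s t T hs
  have bN := hN.openBdd tN w W hw s t T hs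
  refine ValBdd.outcome ?_
  rw [Ty.subst, ValBdd.eq_def]
  exact ⟨HasTy.lazyPair bM.1 bN.1, .pair bM.2.1 bN.2.1, _, _, rfl,
    ExpBdd.le bM le_rfl (.betaFst bM.2.1 bN.2.1), ExpBdd.le bN le_rfl (.betaSnd bM.2.1 bN.2.1)⟩

theorem fst {M : Tm δ n} (hM : OutcomeBdd Γ f M (.amp A B)) : OutcomeBdd Γ f (.fst M) A := by
  intro w W hw s t T hs m r v hv
  simp only [Tm.csubst, Tm.subst] at hv
  cases hv with | fst h₁ h₂ =>
  obtain ⟨c₁, b, hb, hV⟩ := hM w W hw s t T hs _ _ _ h₁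
  rw [Ty.subst, ValBdd.eq_def] at hV
  obtain ⟨_, _, M₁, M₂, h, hV₁, hV₂⟩ := hV
  cases h
  exact .seq c₁ hb.le (ExpBdd.outcome hV₁ h₂)

theorem snd {M : Tm δ n} (hM : OutcomeBdd Γ f M (.amp A B)) : OutcomeBdd Γ f (.snd M) B := by
  intro w W hw s t T hs m r v hv
  simp only [Tm.csubst, Tm.subst] at hv
  cases hv with | snd h₁ h₂ =>
  obtain ⟨c₁, b, hb, hV⟩ := hM w W hw s t T hs _ _ _ h₁
  rw [Ty.subst, ValBdd.eq_def] at hV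
  obtain ⟨_, _, M₁, M₂, h, hV₁, hV₂⟩ := hV
  cases h
  exact .seq c₁ hb.le (ExpBdd.outcome hV₂ h₂)

theorem lam {M : Tm δ (n + 1)} (tM : HasTy (extend Γ A) (f.push 1) M B)
    (hM : OutcomeBdd (extend Γ A) (f.push 1) M B) : OutcomeBdd Γ f (.lam M) (.lolli A B) := by
  intro w W hw s t T hs m r v hv
  have tL := (HasTy.lam tM).close w fun j => (hs j).typed
  have cL := (HasTy.lam tM).extract_typed.subst _ (hw.ctyped hs)
  change CHasTy _ (closedExtract W T _) _ at cL
  rw [closedExtract_lam] at cL ⊢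
  simp only [Tm.csubst, Tm.subst] at hv tL
  cases hv
  cases cL with | pair _ cL =>
  refine ValBdd.outcome ?_
  rw [Ty.subst, ValBdd.eq_def]
  refine ⟨tL, ?_, _, rfl, fun d u E' hu => ?_⟩
  · rw [← Ty.subst, pot_subst]
    exact cL
  -- The bound variable has coefficient `1`, so the body starts from the bank of the abstraction
  -- plus that of the argument.
  have := hM.openBdd tM w W hw _ _ _ (hs.extend hu)
  rw [Res.eval_push, one_mul] at this
  rw [Tm.inst_subst_lift]
  refine ExpBdd.le this le_rfl ?_
  rw [cpx_subst, ← closedExtract, ← subst_extract_extend]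
  cases cL with | lam cL =>
  have hE := hu.ctyped
  rw [pot_subst] at hE
  have := CLe.betaLam cL hE
  rwa [CTm.inst_subst_lift] at this

theorem app {M N : Tm δ n} (hM : OutcomeBdd Γ f M (.lolli A B)) (hN : OutcomeBdd Γ g N A) :
    OutcomeBdd Γ (f + g) (.app M N) B := by
  intro w W hw s t T hs m r v hv
  simp only [Tm.csubst, Tm.subst] at hv
  cases hv with | app h₁ h₂ h₃ =>
  obtain ⟨c₁, b₁, hb₁, hV₁⟩ := hM w W hw s t T hs _ _ _ h₁
  obtain ⟨c₂, b₂, hb₂, hV₂⟩ := hN w W hw s t T hs _ _ _ h₂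
  refine .seq (CLeClosed.cost_add c₁ c₂) ?_ ((ValBdd.lam_app hV₁ hV₂).outcome h₃)
  rw [Res.eval_add, ExtInt.ofENat_add, ExtInt.ofENat_add, hb₁, hb₂, add_add_add_comm]

theorem save {k : Mult} {c : Cred δ} {M : Tm δ n} (hM : OutcomeBdd Γ f M A)
    (hfg : f.scale k.1 + Res.ofCred c ≤ g) : OutcomeBdd Γ g (.save k c M) (.bang k c A) := by
  intro w W hw s t T hs m r v hv
  simp only [Tm.csubst, Tm.subst] at hv
  cases hv with | save h₁ =>
  obtain ⟨c₁, b, hb, hV⟩ := hM w W hw s t T hs _ _ _ h₁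
  have hg := Res.eval_mono w s hfg
  rw [Res.eval_add, Res.eval_scale, Res.eval_ofCred] at hg
  -- The bank of the saved value dominates `k b + c`, so `b` itself can serve as the witness in the
  -- clause for `!`.
  obtain ⟨b', hb', hbb'⟩ := ExtInt.exists_ofENat_of_le ((ExtInt.scale_resource_le k _ hb).trans
    (add_le_add_left (ExtInt.ofENat_le.2 hg) _))
  refine .of_pair (CLeClosed.cost_scale k c₁) hb' ?_
  rw [Ty.subst, ValBdd.eq_def]
  exact ⟨hV.typed.save hbb', hV.ctyped, _, _, rfl, hbb', hV⟩

theorem transfer {k' k : Mult} {c : Cred δ} {M : Tm δ n} {N : Tm δ (n + 1)}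
    (hM : OutcomeBdd Γ f M (.bang k c A))
    (hN : OutcomeBdd (extend Γ A) ((g + (Res.ofCred c).scale k'.1).push (k'.1 * k.1)) N C) :
    OutcomeBdd Γ (f.scale k'.1 + g) (.transfer k' k c M N) C := by
  intro w W hw s t T hs m r v hv
  simp only [Tm.csubst, Tm.subst] at hv
  cases hv with | transfer h₁ h₂ =>
  obtain ⟨c₁, b, hb, hV⟩ := hM w W hw s t T hs _ _ _ h₁
  rw [Ty.subst, ValBdd.eq_def] at hV
  obtain ⟨_, _, v', d, h, hd, hV⟩ := hV
  cases h
  rw [Tm.inst_subst_lift] at h₂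
  rw [closedExtract_transfer]
  refine .seq (CLeClosed.cost_scale k' c₁) ?_ (hN w W hw _ _ _ (hs.extend hV) _ _ _ h₂)
  rw [Res.eval_add, Res.eval_scale, Res.eval_push, Res.eval_add, Res.eval_scale, Res.eval_ofCred]
  refine le_trans ?_ (ExtInt.scale_resource_le k' (g.eval w s) hb)
  -- After regrouping, what remains is `k' (k d + c) ≤ k' b`, and `k d + c ≤ b` is the clause for
  -- `!`.
  rw [ExtInt.ofENat_le, mul_assoc, add_assoc, ← mul_add, add_comm, add_comm (_ : ℕ∞) (k.1 * d)]
  gcongr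

/-- Treated as an instantaneous first stage of cost `1` and net credit `0`. In the same way `create`
and `spend` are stages without ticks and with net credit `c` and `-c`. -/
theorem tick {M : Tm δ n} (hM : OutcomeBdd Γ f M A) : OutcomeBdd Γ f (.tick M) A := by
  intro w W hw s t T hs m r v hv
  simp only [Tm.csubst, Tm.subst] at hv
  cases hv with | tick h₁ =>
  have := Outcome.seq (m := 1) (r := 0) (a := f.eval w s) (CLeClosed.cost_const 1 (ExtInt.ofInt 1) (by simp)) (by simp)
    (hM w W hw s t T hs _ _ _ h₁)
  rwa [zero_add, add_comm] at this

theorem create {c : Cred δ} {M : Tm δ n} (hM : OutcomeBdd Γ (f + Res.ofCred c) M A) :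
    OutcomeBdd Γ f (.create c M) A := by
  intro w W hw s t T hs m r v hv
  simp only [Tm.csubst, Tm.subst] at hv
  cases hv with | create h₁ =>
  have hc := CLeClosed.credTm hw c T
  rw [add_comm]
  nth_rw 1 [← zero_add m]
  refine Outcome.seq ?_ ?_ (hM w W hw s t T hs _ _ _ h₁)
  · refine CLeClosed.cost_mono ?_ ((CLe.litToCost _).trans hc.toCost)
    refine (CLe.constLe ?_).trans (.constAdd _ _)
    simp
  · rw [Res.eval_add, Res.eval_ofCred, ExtInt.ofENat_add, ExtInt.ofENat_natCast]

theorem spend {c : Cred δ} {M : Tm δ n} (hM : OutcomeBdd Γ f M A) :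
    OutcomeBdd Γ (f + Res.ofCred c) (.spend c M) A := by
  intro w W hw s t T hs m r v hv
  simp only [Tm.csubst, Tm.subst] at hv
  cases hv with | spend h₁ =>
  have hc := CLeClosed.credTm hw c T
  rw [add_comm]
  nth_rw 1 [← zero_add m]
  refine Outcome.seq ?_ ?_ (hM w W hw s t T hs _ _ _ h₁)
  -- Negation is antitone, so an upper bound on the extracted credit term is needed. It is available
  -- because credits are ordered discretely, that is symmetrically.
  · refine CLeClosed.cost_mono ?_ ((CLe.constNeg _).trans
      (CLe.neg (hc.credSymm.toCost.trans (.toCostLit _))))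
    refine (CLe.constLe ?_).trans (.constAdd _ _)
    simp
  -- Closed credit amounts are finite, so `c` and `-c` cancel even when the rest of the bank is
  -- infinite.
  · rw [Res.eval_add, Res.eval_ofCred, ExtInt.ofENat_add, ExtInt.ofENat_natCast, add_assoc,
      ExtInt.ofInt_add, add_neg_cancel, ExtInt.ofInt_zero, add_zero]

theorem pack {c : Cred δ} {M : Tm δ n} {A : Ty (δ + 1)} (hM : OutcomeBdd Γ f M (A.inst c)) :
    OutcomeBdd Γ f (.pack c M) (.ex A) := by
  intro w W hw s t T hs m r v hv
  simp only [Tm.csubst, Tm.subst] at hv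
  cases hv with | pack h₁ =>
  obtain ⟨c₁, b, hb, hV⟩ := hM w W hw s t T hs _ _ _ h₁
  -- Instantiating before or after closing gives the same type, here brought to the form that the
  -- existential clause expects.
  rw [Ty.subst_inst, ← Ty.inst_subst_lift] at hV
  have hc := CLeClosed.credTm hw c T
  have cV := hV.ctyped
  rw [Ty.inst, pot_subst] at cV
  refine .of_pair c₁ hb ?_
  rw [Ty.subst, ValBdd.eq_def]
  exact ⟨HasTy.pack hV.typed, .pair hc.typed.2 cV, _, _, rfl,
    hc.trans (.betaFst hc.typed.2 cV), hV.mono le_rfl (.betaSnd hc.typed.2 hV.ctyped)⟩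

theorem unpack {k : Mult} {M : Tm δ n} {N : Tm (δ + 1) (n + 1)} {A : Ty (δ + 1)}
    (hM : OutcomeBdd Γ f M (.ex A))
    (hN : OutcomeBdd (extend (fun j => (Γ j).weaken) A) (g.cweaken.push k.1) N C.weaken) :
    OutcomeBdd Γ (f.scale k.1 + g) (.unpack k M N) C := by
  intro w W hw s t T hs m r v hv
  simp only [Tm.csubst, Tm.subst] at hv
  cases hv with | @unpack _ c _ _ _ _ _ _ _ _ h₁ h₂ =>
  obtain ⟨c₁, b, hb, hV⟩ := hM w W hw s t T hs _ _ _ h₁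
  rw [Ty.subst, ValBdd.eq_def] at hV
  obtain ⟨_, _, _, _, h, hc, hV⟩ := hV
  cases h
  -- A closed credit term is a numeral, so the packed witness is an admissible amount for the new
  -- credit variable.
  have close : extend (closeCred w) c = closeCred (extend w c.const) := by
    have : c = Cred.lit c.const := by ext i; exacts [rfl, i.elim0]
    funext i
    induction i using Fin.lastCases with
    | cast i => simp [closeCred]
    | last => simpa [closeCred] using this
  -- Freshness of the credit variable: types from the outer scope do not see its amount.
  have weaken (A : Ty δ) : A.weaken.subst (closeCred (extend w c.const)) = A.subst (closeCred w) := by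
    rw [← close, Ty.weaken_subst_extend]
  rw [Ty.inst_subst_lift, close] at hV
  rw [Tm.cinst_subst_lift, close] at h₂
  -- The existential clause bounds the witness by the first projection of the potential, which is
  -- the very term substituted for the credit variable.
  have hw' : CredBdd (extend w c.const) (extend W (.fst (.snd (closedExtract W T M)))) := by
    intro i
    induction i using Fin.lastCases with
    | cast i => simpa using hw i
    | last => simpa using hc
  have hs' : SubBdd (fun j => (Γ j).weaken.subst (closeCred (extend w c.const))) s t T := by
    simpa only [weaken] using hs
  have := hN _ _ hw' _ _ _ (SubBdd.extend hs' hV) _ _ _ h₂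
  rw [weaken, Res.eval_push, Res.eval_cweaken] at this
  rw [closedExtract_unpack]
  refine .seq (CLeClosed.cost_scale k c₁) ?_ this
  simpa [add_comm] using ExtInt.scale_resource_le k (g.eval w s) hb

theorem nrec {M N₁ N₂ : Tm δ n} (hM : OutcomeBdd Γ f M .nat)
    (hN₁ : OutcomeBdd Γ g N₁ (.lolli .unit C))
    (hN₂ : OutcomeBdd Γ h N₂ (.bang .inf (.lit 0) (.lolli (.tensor .nat (.lolli .unit C)) C))) :
    OutcomeBdd Γ (f + g + h) (.nrec M N₁ N₂) C := by
  intro w W hw s t T hs m r v hv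
  simp only [Tm.csubst, Tm.subst] at hv
  rw [closedExtract_nrec]
  -- Both evaluation rules factor into evaluating the three arguments and then running the recursor
  -- on the resulting values, which re-evaluate for free. The first part is additive, and the second
  -- is bounded by `NatBdd.nrec_bdd`.
  have key {m₁ m₂ m₃ m₄ : ℕ} {r₁ r₂ r₃ r₄ : ExtInt} {u : Tm 0 0} {N₁' N₂' : Tm 0 1}
      (h₁ : Eval ((M.csubst (closeCred w)).subst t) m₁ r₁ u)
      (h₂ : Eval ((N₁.csubst (closeCred w)).subst t) m₂ r₂ (.lam N₁'))
      (h₃ : Eval ((N₂.csubst (closeCred w)).subst t) m₃ r₃ (.save .inf (.lit 0) (.lam N₂')))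
      (h₄ : Eval u 0 0 u →
        Eval (.nrec u (.lam N₁') (.save .inf (.lit 0) (.lam N₂'))) m₄ r₄ v) :
      Outcome (C.subst (closeCred w)) ((f + g + h).eval w s) (m₁ + m₂ + m₃ + m₄)
        (r₁ + r₂ + r₃ + r₄) v
        (.addCost (.add (.add (.fst (closedExtract W T M)) (.fst (closedExtract W T N₁)))
          (.fst (closedExtract W T N₂)))
        (.nrec (.snd (closedExtract W T M)) (.snd (closedExtract W T N₁))
          (CTm.nrecStep (.snd (closedExtract W T N₂))))) := by
    obtain ⟨c₁, b₁, hb₁, hV₁⟩ := hM w W hw s t T hs _ _ _ h₁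
    obtain ⟨c₂, b₂, hb₂, hV₂⟩ := hN₁ w W hw s t T hs _ _ _ h₂
    obtain ⟨c₃, b₃, hb₃, hV₃⟩ := hN₂ w W hw s t T hs _ _ _ h₃
    have h₄ := h₄ hV₁.isValue.eval_self
    rw [Ty.subst, ValBdd.eq_def] at hV₁
    simp only [Ty.subst, Cred.lit_subst] at hV₂ hV₃
    rw [ValBdd.eq_def] at hV₃
    obtain ⟨_, _, _, d, h, hd, hV₃⟩ := hV₃
    cases h
    refine .seq (CLeClosed.cost_add (CLeClosed.cost_add c₁ c₂) c₃) ?_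
      ((NatBdd.nrec_bdd hV₂ hV₃ hV₁.2.2).outcome h₄)
    have hd : ⊤ * d ≤ b₃ := le_self_add.trans hd
    -- The bank `b₁` left over from the numeral is discarded.
    calc ExtInt.ofENat (b₂ + ⊤ * d) ≤ ExtInt.ofENat (b₁ + b₂ + b₃) :=
          ExtInt.ofENat_le.2 (add_le_add le_add_self hd)
      _ = _ := by
          simp only [Res.eval_add, ExtInt.ofENat_add, hb₁, hb₂, hb₃]
          ac_rfl
  cases hv with
  | nrecZero h₁ h₂ h₃ h₄ =>
    refine key h₁ h₂ h₃ fun h => ?_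
    simpa using Eval.nrecZero h .lam (IsValue.save .lam).eval_self h₄
  | nrecSucc h₁ h₂ h₃ h₄ =>
    refine key h₁ h₂ h₃ fun h => ?_
    simpa using Eval.nrecSucc h .lam (IsValue.save .lam).eval_self h₄

theorem lrec {M N₁ N₂ : Tm δ n} (hM : OutcomeBdd Γ f M (.list A))
    (hN₁ : OutcomeBdd Γ g N₁ (.lolli .unit C))
    (hN₂ : OutcomeBdd Γ h N₂ (.bang .inf (.lit 0) (.lolli (.tensor A (.amp (.list A) C)) C))) :
    OutcomeBdd Γ (f + g + h) (.lrec M N₁ N₂) C := by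
  intro w W hw s t T hs m r v hv
  simp only [Tm.csubst, Tm.subst] at hv
  rw [closedExtract_lrec]
  have key {m₁ m₂ m₃ m₄ : ℕ} {r₁ r₂ r₃ r₄ : ExtInt} {u : Tm 0 0} {N₁' N₂' : Tm 0 1}
      (h₁ : Eval ((M.csubst (closeCred w)).subst t) m₁ r₁ u)
      (h₂ : Eval ((N₁.csubst (closeCred w)).subst t) m₂ r₂ (.lam N₁'))
      (h₃ : Eval ((N₂.csubst (closeCred w)).subst t) m₃ r₃ (.save .inf (.lit 0) (.lam N₂')))
      (h₄ : Eval u 0 0 u →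
        Eval (.lrec u (.lam N₁') (.save .inf (.lit 0) (.lam N₂'))) m₄ r₄ v) :
      Outcome (C.subst (closeCred w)) ((f + g + h).eval w s) (m₁ + m₂ + m₃ + m₄)
        (r₁ + r₂ + r₃ + r₄) v
        (.addCost (.add (.add (.fst (closedExtract W T M)) (.fst (closedExtract W T N₁)))
          (.fst (closedExtract W T N₂)))
        (.lrec (.snd (closedExtract W T M)) (.snd (closedExtract W T N₁))
          (CTm.lrecStep (.snd (closedExtract W T N₂))))) := by
    obtain ⟨c₁, b₁, hb₁, hV₁⟩ := hM w W hw s t T hs _ _ _ h₁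
    obtain ⟨c₂, b₂, hb₂, hV₂⟩ := hN₁ w W hw s t T hs _ _ _ h₂
    obtain ⟨c₃, b₃, hb₃, hV₃⟩ := hN₂ w W hw s t T hs _ _ _ h₃
    have h₄ := h₄ hV₁.isValue.eval_self
    rw [Ty.subst, ValBdd.eq_def] at hV₁
    simp only [Ty.subst, Cred.lit_subst] at hV₂ hV₃
    rw [ValBdd.eq_def] at hV₃
    obtain ⟨_, _, _, d, h, hd, hV₃⟩ := hV₃
    cases h
    refine .seq (CLeClosed.cost_add (CLeClosed.cost_add c₁ c₂) c₃) ?_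
      ((ListBdd.lrec_bdd hV₂ hV₃ hV₁.2.2).outcome h₄)
    have hd : ⊤ * d ≤ b₃ := le_self_add.trans hd
    -- Here `b₁` is kept, since it holds the credits of the list elements.
    calc ExtInt.ofENat (b₁ + b₂ + ⊤ * d) ≤ ExtInt.ofENat (b₁ + b₂ + b₃) :=
          ExtInt.ofENat_le.2 (by gcongr)
      _ = _ := by
          simp only [Res.eval_add, ExtInt.ofENat_add, hb₁, hb₂, hb₃]
          ac_rfl
  cases hv with
  | lrecNil h₁ h₂ h₃ h₄ =>
    refine key h₁ h₂ h₃ fun h => ?_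
    simpa using Eval.lrecNil h .lam (IsValue.save .lam).eval_self h₄
  | lrecCons h₁ h₂ h₃ h₄ =>
    refine key h₁ h₂ h₃ fun h => ?_
    simpa using Eval.lrecCons h .lam (IsValue.save .lam).eval_self h₄

end OutcomeBdd

theorem HasTy.outcomeBdd {δ n : ℕ} {Γ : Fin n → Ty δ} {f : Res δ n} {M : Tm δ n} {A : Ty δ}
    (h : HasTy Γ f M A) : OutcomeBdd Γ f M A := by
  induction h with
  | var j h => exact .var j h
  | unit => exact .unit
  | zero => exact .zero
  | nil => exact .nil
  | pair _ _ ih ih' => exact .pair ih ih'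
  | cons _ _ ih ih' => exact .cons ih ih'
  | app _ _ ih ih' => exact .app ih ih'
  | nrec _ _ _ ih ih₁ ih₂ => exact .nrec ih ih₁ ih₂
  | lrec _ _ _ ih ih₁ ih₂ => exact .lrec ih ih₁ ih₂
  | split _ _ ih ih' => exact .split ih ih'
  | caseOf _ h₁ h₂ ih ih₁ ih₂ => exact .caseOf ih h₁ h₂ ih₁ ih₂
  | transfer _ _ ih ih' => exact .transfer ih ih'
  | unpack _ _ ih ih' => exact .unpack ih ih'
  | spend _ ih => exact .spend ih
  | create _ ih => exact .create ih
  | save _ h ih => exact .save ih h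
  | lam h ih => exact .lam h ih
  | lazyPair h h' ih ih' => exact .lazyPair h h' ih ih'
  | inl _ ih => exact .inl ih
  | inr _ ih => exact .inr ih
  | fst _ ih => exact .fst ih
  | snd _ ih => exact .snd ih
  | succ _ ih => exact .succ ih
  | tick _ ih => exact .tick ih
  | pack _ ih => exact .pack ih

end Amortized

theorem mainTheorem3 {δ n : ℕ} (Γ : Fin n → Amortized.Ty δ) (f : Amortized.Res δ n)
    (M : Amortized.Tm δ n) (A : Amortized.Ty δ) (hM : Amortized.HasTy Γ f M A) :
    Amortized.OpenBdd Γ f M A (Amortized.extract M) :=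
  hM.outcomeBdd.openBdd hM
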